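/- \textbf{Setting.} Let $V$ be a finite dimensional Euclidean space with scalar product $(\cdot,\cdot)$ and let $R\subset V$ be a finite, reduced, irreducible, crystallographic root system in its real span $V_s\subseteq V$ ($V_s\neq V$ is allowed), with co-roots $\alpha^\vee=2\alpha/(\alpha,\alpha)$ and Weyl group $W$. (For instance $V=V_s\oplus V'$ is a real form of a Cartan subalgebra of a complex reductive Lie algebra $\mathfrak g$ with $[\mathfrak g,\mathfrak g]$ simple.) Fix simple roots $F\subset R$ with highest root $\theta$, and a lattice $Y\subset V$, not necessarily of full rank, containing all co-roots and with $(Y,R)\subseteq\mathbb Z$. Put $\widehat V=V\oplus\mathbb Rc\oplus\mathbb Rd$, extend $(\cdot,\cdot)$ to a symmetric bilinear form on $\widehat V$ by $(c,d)=1$, $(c,c)=(d,d)=(c,v)=(d,v)=0$ for $v\in V$, and complex bilinearly to $\widehat{\mathfrak h}=\mathbb C\otimes_{\mathbb R}\widehat V$. For $(a,a)\neq0$ let $a^\vee=2a/(a,a)$ and $s_a(x)=x-(x,a^\vee)a$; for $u\in V$ let $$t_u(v+\eta c+\xi d)=v+\xi u+\bigl(\eta-\tfrac{\xi}{2}(u,u)-(v,u)\bigr)c+\xi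 d .$$ Let $\widehat R=\{\alpha+mc:\alpha\in R,\ m\in\mathbb Z\}$, $\widehat F=F\cup\{-\theta+c\}$, and let $\widehat R^+$ be the set of elements of $\widehat R$ that are nonnegative integral combinations of $\widehat F$. Let $\widehat W$ be the group generated by the $s_a$ $(a\in\widehat R)$, let $\widehat W^Y=W\ltimes Y$ be the group generated by the $s_\alpha$ $(\alpha\in R)$ and the $t_y$ $(y\in Y)$, and let $\Omega=\{\omega\in\widehat W^Y:\omega(\widehat R^+)\subseteq\widehat R^+\}$. Let $k:\widehat R\to\mathbb C$ be $\widehat W^Y$-invariant. The extended trigonometric Cherednik algebra $\widehat H^Y(k)$ is the unital associative $\mathbb C$-algebra generated by the symmetric algebra $S(\widehat{\mathfrak h})$ and the group algebra $\mathbb C[\widehat W^Y]$, subject to the cross relations $$s_a\cdot \widehat v=s_a(\widehat v)\cdot s_a-k_a(a,\widehat v)\quad(a\in\widehat F),\qquad \omega\cdot\widehat v=\omega(\widehat v)\cdot\omega\quad(\omega\in\Omega),\qquad \widehat v\in\widehat{\mathfrak h}.$$ Let $\widehat V^+=V\oplus\mathbb Rc\oplus\mathbb R_{>0}d$, let $C^\omega(\widehat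 V^+)$ be the space of complex valued real analytic functions on $\widehat V^+$, let $\mathcal C$ be the set of connected components of $\{x\in\widehat V^+:(a,x)\neq0\ \forall a\in\widehat R\}$, and let $\widehat C_+=\{x\in\widehat V:(a,x)>0\ \forall a\in\widehat F\}\in\mathcal C$. Let $(M,\pi_M)$ be a finite dimensional complex $\widehat W^Y$-module and $$\mathcal F_M=\prod_{C\in\mathcal C}\bigl(C^\omega(\widehat V^+)\otimes_{\mathbb C}M\bigr).$$ For $w\in\widehat W^Y$ and $f\in\mathcal F_M$ put $(wf)_C(x)=\pi_M(w)\bigl(f_{w^{-1}C}(w^{-1}x)\bigr)$; for $v\in\widehat V$ let $\partial_v$ be the directional derivative (componentwise on $\mathcal F_M$); for $a\in\widehat R^+$ let $\chi_a$ multiply the component $f_C$ by $1$ if $(a,\cdot)<0$ on $C$ and by $0$ otherwise. Define the Dunkl operators $$\mathcal D^M_vf=\partial_vf-\sum_{a\in\widehat R^+}k_a(a,v)\,\chi_a s_af\qquad(v\in\widehat V),$$ the sum being finite in each component, and for $a\in\widehat R$ the integral operators on $C^\omega(\widehat V^+)$ $$(I(a)f)(x)=\int_0^{(a,x)}f(x-ta^\vee)\,dt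 .$$ \textbf{Statement.} (i) There is a unique unital algebra homomorphism $\widehat Q:\widehat H^Y(k)\to\mathrm{End}_{\mathbb C}(C^\omega(\widehat V^+)\otimes_{\mathbb C}M)$ with $\widehat Q(s_a)=s_a\otimes\pi_M(s_a)-k_aI(a)\otimes\mathrm{Id}_M$ for $a\in\widehat F$, $\widehat Q(\omega)=\omega\otimes\pi_M(\omega)$ for $\omega\in\Omega$, and $\widehat Q(v)=\partial_v\otimes\mathrm{Id}_M$ for $v\in\widehat V$, where $w\in\widehat W^Y$ acts on $C^\omega(\widehat V^+)$ by $(wf)(x)=f(w^{-1}x)$. (ii) There is a unique unital algebra homomorphism $\widehat\pi:\widehat H^Y(k)\to\mathrm{End}_{\mathbb C}(\mathcal F_M)$ with $\widehat\pi(w)f=wf$ for $w\in\widehat W^Y$ and $\widehat\pi(v)=\mathcal D^M_v$ for $v\in\widehat V$. (iii) There is a unique linear map $T:C^\omega(\widehat V^+)\otimes_{\mathbb C}M\to\mathcal F_M$ (the propagation operator) such that $$(Tf)_{w\widehat C_+}(x)=\pi_M(w)\Bigl(\bigl(\widehat Q(w^{-1})f\bigr)(w^{-1}x)\Bigr)\qquad(w\in\widehat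 W,\ x\in\widehat V^+),$$ and it is $\widehat H^Y(k)$-linear: $$T\circ\widehat Q(h)=\widehat\pi(h)\circ T\qquad\text{for all }h\in\widehat H^Y(k).$$ -/

import Mathlib

open scoped ENNReal NNReal Topology TensorProduct InnerProductSpace

noncomputable section

namespace TrigCherednik

/-! ### Analyticity of integrals along segments -/

theorem hasFPowerSeriesOnBall_integral_segment {E : Type*} [NormedAddCommGroup E] [NormedSpace ℝ E]
    {f : E → ℂ} {p : FormalMultilinearSeries ℝ E ℂ} {x : E} {r : ℝ≥0}
    (hf : HasFPowerSeriesOnBall f p x r) :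
    ∃ q : FormalMultilinearSeries ℝ (E × E) ℂ,
      HasFPowerSeriesOnBall (fun y : E × E => ∫ θ in (0 : ℝ)..1, f (y.1 + θ • y.2)) q (x, 0)
        ((r / 2 : ℝ≥0) : ℝ≥0∞) := by
  have hr : 0 < r := by exact_mod_cast hf.r_pos
  let L : ℝ → (E × E →L[ℝ] E) := fun θ =>
    ContinuousLinearMap.fst ℝ E E + θ • ContinuousLinearMap.snd ℝ E E
  have hLc : Continuous L := by fun_prop
  have hLn : ∀ θ ∈ Set.uIoc (0 : ℝ) 1, ‖L θ‖ ≤ 2 := by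
    intro θ hθ
    rw [Set.uIoc_of_le zero_le_one] at hθ
    refine (norm_add_le _ _).trans ?_
    have h1 := ContinuousLinearMap.norm_fst_le (𝕜 := ℝ) (E := E) (F := E)
    have h2 := ContinuousLinearMap.norm_snd_le (𝕜 := ℝ) (E := E) (F := E)
    rw [norm_smul, Real.norm_of_nonneg hθ.1.le]
    nlinarith [hθ.2, hθ.1, norm_nonneg (ContinuousLinearMap.snd ℝ E E)]
  let A : ∀ n, ℝ → ContinuousMultilinearMap ℝ (fun _ : Fin n => E × E) ℂ := fun n θ =>
    (p n).compContinuousLinearMap (fun _ => L θ)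
  have hAc : ∀ n, Continuous (A n) := by
    intro n
    have : A n = fun θ => ContinuousMultilinearMap.compContinuousLinearMapLRight
      (E := fun _ : Fin n => E × E) (p n) (fun _ => L θ) := rfl
    rw [this]
    exact (ContinuousMultilinearMap.cont _).comp (continuous_pi fun _ => hLc)
  have hAn : ∀ n, ∀ θ ∈ Set.uIoc (0 : ℝ) 1, ‖A n θ‖ ≤ ‖p n‖ * 2 ^ n := by
    intro n θ hθ
    refine (ContinuousMultilinearMap.norm_compContinuousLinearMap_le _ _).trans ?_
    rw [Finset.prod_const, Finset.card_univ, Fintype.card_fin]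
    gcongr
    exact hLn θ hθ
  refine ⟨fun n => ∫ θ in (0 : ℝ)..1, A n θ, ?_, ?_, ?_⟩
  · refine ENNReal.le_of_forall_nnreal_lt fun s hs => ?_
    have hs' : s < r / 2 := by exact_mod_cast hs
    have h2 : ((2 * s : ℝ≥0) : ℝ≥0∞) < p.radius := by
      refine lt_of_lt_of_le ?_ hf.r_le
      have : 2 * s < r := by
        have := (lt_div_iff₀ (two_pos : (0 : ℝ≥0) < 2)).1 hs'
        rwa [mul_comm]
      exact_mod_cast this
    obtain ⟨C, -, hC⟩ := p.norm_mul_pow_le_of_lt_radius h2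
    refine FormalMultilinearSeries.le_radius_of_bound _ C fun n => ?_
    have h3 : ‖∫ θ in (0 : ℝ)..1, A n θ‖ ≤ ‖p n‖ * 2 ^ n := by
      simpa using intervalIntegral.norm_integral_le_of_norm_le_const (hAn n)
    calc _ ≤ ‖p n‖ * 2 ^ n * (s : ℝ) ^ n := by gcongr
      _ = ‖p n‖ * ((2 * s : ℝ≥0) : ℝ) ^ n := by push_cast; rw [mul_pow]; ring
      _ ≤ C := hC n
  · exact_mod_cast half_pos hr
  · intro y hy
    have hy' : ‖y‖₊ < r / 2 := by
      rw [Metric.mem_eball, edist_zero_right] at hy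
      have hy2 : ((‖y‖₊ : ℝ≥0) : ℝ≥0∞) < ((r / 2 : ℝ≥0) : ℝ≥0∞) := hy
      exact_mod_cast hy2
    have h2 : ((2 * ‖y‖₊ : ℝ≥0) : ℝ≥0∞) < r := by
      have : 2 * ‖y‖₊ < r := by
        have := (lt_div_iff₀ (two_pos : (0 : ℝ≥0) < 2)).1 hy'
        rwa [mul_comm]
      exact_mod_cast this
    have hsum : Summable fun n => ‖p n‖ * ((2 * ‖y‖₊ : ℝ≥0) : ℝ) ^ n :=
      p.summable_norm_mul_pow (h2.trans_le hf.r_le)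
    have key := intervalIntegral.hasSum_integral_of_dominated_convergence
      (μ := MeasureTheory.volume) (a := 0) (b := 1)
      (F := fun n θ => A n θ (fun _ => y))
      (f := fun θ => f (((x, (0 : E)) + y).1 + θ • ((x, (0 : E)) + y).2))
      (fun n _ => ‖p n‖ * ((2 * ‖y‖₊ : ℝ≥0) : ℝ) ^ n) ?_ ?_ ?_ ?_ ?_
    · convert key using 2 with n
      exact ((ContinuousMultilinearMap.apply ℝ (fun _ : Fin n => E × E) ℂ
        (fun _ => y)).intervalIntegral_comp_comm ((hAc n).intervalIntegrable 0 1)).symm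
    · intro n
      exact ((ContinuousMultilinearMap.apply ℝ (fun _ : Fin n => E × E) ℂ
        (fun _ => y)).continuous.comp (hAc n)).aestronglyMeasurable
    · refine fun n => Filter.Eventually.of_forall fun θ hθ => ?_
      refine ((A n θ).le_opNorm _).trans ?_
      rw [Finset.prod_const, Finset.card_univ, Fintype.card_fin]
      calc _ ≤ ‖p n‖ * 2 ^ n * ‖y‖ ^ n := by gcongr; exact hAn n θ hθ
        _ = _ := by push_cast; rw [mul_pow]; ring
    · exact Filter.Eventually.of_forall fun _ _ => hsum
    · exact intervalIntegrable_const
    · refine Filter.Eventually.of_forall fun θ hθ => ?_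
      have hLy : L θ y ∈ Metric.eball (0 : E) r := by
        rw [Metric.mem_eball, edist_zero_right]
        refine lt_of_le_of_lt ?_ h2
        have : ‖L θ y‖₊ ≤ 2 * ‖y‖₊ := by
          have h5 := ((L θ).le_opNorm y).trans
            (mul_le_mul_of_nonneg_right (hLn θ hθ) (norm_nonneg y))
          exact_mod_cast h5
        exact_mod_cast this
      have := hf.hasSum hLy
      have e : x + L θ y = ((x, (0 : E)) + y).1 + θ • ((x, (0 : E)) + y).2 := by
        simp [L, add_assoc]
      rw [e] at this
      exact this


theorem analyticAt_integral_segment {E : Type*} [NormedAddCommGroup E] [NormedSpace ℝ E]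
    {f : E → ℂ} {U : Set E} (hU : IsOpen U) (hc : Convex ℝ U) (hf : AnalyticOnNhd ℝ f U)
    {z w : E} (hz : z ∈ U) (hw : z + w ∈ U) :
    AnalyticAt ℝ (fun y : E × E => ∫ θ in (0 : ℝ)..1, f (y.1 + θ • y.2)) (z, w) := by
  have hseg : ∀ y : E × E, y.1 ∈ U → y.1 + y.2 ∈ U → ∀ θ ∈ Set.Icc (0 : ℝ) 1,
      y.1 + θ • y.2 ∈ U := by
    intro y h1 h2 θ hθ
    exact hc.add_smul_mem h1 h2 hθ
  have hnear : ∀ᶠ y : E × E in 𝓝 (z, w), y.1 ∈ U ∧ y.1 + y.2 ∈ U := by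
    refine ((hU.preimage continuous_fst).inter
      (hU.preimage (continuous_fst.add continuous_snd))).mem_nhds ⟨hz, hw⟩
  have hint : ∀ y : E × E, y.1 ∈ U → y.1 + y.2 ∈ U → ∀ s ∈ Set.Icc (0 : ℝ) 1,
      ∀ t ∈ Set.Icc (0 : ℝ) 1,
      IntervalIntegrable (fun θ : ℝ => f (y.1 + θ • y.2)) MeasureTheory.volume s t := by
    intro y h1 h2 s hs t ht
    refine ContinuousOn.intervalIntegrable ?_
    refine hf.continuousOn.comp (by fun_prop) ?_
    intro θ hθ
    exact hseg y h1 h2 θ ((Set.uIcc_subset_Icc hs ht) hθ)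
  refine isPreconnected_Icc.induction₂ (s := Set.Icc (0 : ℝ) 1)
    (fun s t => AnalyticAt ℝ (fun y : E × E => ∫ θ in s..t, f (y.1 + θ • y.2)) (z, w))
    ?_ ?_ ?_ (Set.left_mem_Icc.2 zero_le_one) (Set.right_mem_Icc.2 zero_le_one)
  · intro s hs
    obtain ⟨p, r, hp⟩ := hf _ (hseg (z, w) hz hw s hs)
    obtain ⟨r', hr', hrr⟩ := ENNReal.lt_iff_exists_nnreal_btwn.1 hp.r_pos
    obtain ⟨q, hq⟩ := hasFPowerSeriesOnBall_integral_segment (hp.mono hr' hrr.le)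
    have hcont : Filter.Tendsto (fun t : ℝ => (z + s • w, (t - s) • w)) (𝓝 s)
        (𝓝 (z + s • w, (0 : E))) := by
      have : Continuous fun t : ℝ => (z + s • w, (t - s) • w) := by fun_prop
      simpa using this.tendsto s
    have hball := hcont (Metric.eball_mem_nhds _ hq.r_pos)
    refine Filter.Eventually.filter_mono nhdsWithin_le_nhds ?_
    filter_upwards [hball] with t ht
    have h1 := hq.analyticAt_of_mem ht
    have h2 : AnalyticAt ℝ (fun y : E × E => (y.1 + s • y.2, (t - s) • y.2)) (z, w) := by
      have : (fun y : E × E => (y.1 + s • y.2, (t - s) • y.2)) =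
        ((ContinuousLinearMap.fst ℝ E E + s • ContinuousLinearMap.snd ℝ E E).prod
          ((t - s) • ContinuousLinearMap.snd ℝ E E)) := rfl
      rw [this]
      exact ContinuousLinearMap.analyticAt _ _
    have h3 := AnalyticAt.comp_of_eq (x := (z, w)) h1 h2 rfl
    have h4 : AnalyticAt ℝ (fun y : E × E => ((t - s : ℝ) : ℂ) *
        ∫ θ in (0 : ℝ)..1, f (y.1 + s • y.2 + θ • (t - s) • y.2)) (z, w) :=
      analyticAt_const.mul h3
    refine h4.congr (Filter.Eventually.of_forall fun y => ?_)
    have := intervalIntegral.smul_integral_comp_mul_add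
      (a := 0) (b := 1) (fun θ : ℝ => f (y.1 + θ • y.2)) (t - s) s
    simp only [mul_zero, zero_add, mul_one, sub_add_cancel, Complex.real_smul] at this
    refine Eq.trans ?_ this
    have e : ∀ θ : ℝ, y.1 + s • y.2 + θ • (t - s) • y.2 = y.1 + ((t - s) * θ + s) • y.2 :=
      fun θ => by module
    simp only [e]
  · intro s t u hs ht hu h1 h2
    refine (h1.add h2).congr ?_
    filter_upwards [hnear] with y hy
    exact intervalIntegral.integral_add_adjacent_intervals
      (hint y hy.1 hy.2 s hs t ht) (hint y hy.1 hy.2 t ht u hu)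
  · intro s t _ _ h
    refine h.neg.congr (Filter.Eventually.of_forall fun y => ?_)
    simp [intervalIntegral.integral_symm s t]

/-! ### The space `V ⊕ ℝc ⊕ ℝd` and its isometries -/

section Ambient

variable {V : Type*} [NormedAddCommGroup V] [InnerProductSpace ℝ V]

/-- The real vector space `V ⊕ ℝc ⊕ ℝd`; the triple `(v, η, ξ)` stands for `v + ηc + ξd`. -/
abbrev AffV (V : Type*) := V × ℝ × ℝ

/-- The complexification of `V ⊕ ℝc ⊕ ℝd`. -/
abbrev CAffV (V : Type*) [NormedAddCommGroup V] [InnerProductSpace ℝ V] := ℂ ⊗[ℝ] AffV V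

/-- The symmetric bilinear form on `V ⊕ ℝc ⊕ ℝd` extending the inner product of `V`, with
`(c, d) = 1` and `(c, c) = (d, d) = (c, v) = (d, v) = 0` for `v` in `V`. -/
def form : LinearMap.BilinForm ℝ (AffV V) :=
  LinearMap.mk₂ ℝ (fun x y => ⟪x.1, y.1⟫_ℝ + x.2.1 * y.2.2 + x.2.2 * y.2.1)
    (fun x x' y => by simp only [Prod.fst_add, Prod.snd_add, inner_add_left]; ring)
    (fun r x y => by
      simp only [Prod.smul_fst, Prod.smul_snd, real_inner_smul_left, smul_eq_mul]; ring)
    (fun x y y' => by simp only [Prod.fst_add, Prod.snd_add, inner_add_right]; ring)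
    (fun r x y => by
      simp only [Prod.smul_fst, Prod.smul_snd, real_inner_smul_right, smul_eq_mul]; ring)

theorem form_apply (x y : AffV V) :
    form x y = ⟪x.1, y.1⟫_ℝ + x.2.1 * y.2.2 + x.2.2 * y.2.1 := rfl

theorem form_comm (x y : AffV V) : form x y = form y x := by
  simp only [form_apply, real_inner_comm]; ring

/-- `a^∨ = 2a / (a, a)`. -/
def coroot (a : AffV V) : AffV V := (2 / form a a) • a

/-- The reflection `s_a(x) = x - (x, a^∨) a` (the identity if `(a, a) = 0`). -/
def refl (a : AffV V) : AffV V ≃ₗ[ℝ] AffV V :=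
  LinearEquiv.ofInvolutive
    { toFun := fun x => x - form x (coroot a) • a
      map_add' := fun x y => by simp only [map_add, LinearMap.add_apply]; module
      map_smul' := fun r x => by
        simp only [map_smul, LinearMap.smul_apply, smul_eq_mul, RingHom.id_apply]; module }
    (fun x => by
      by_cases h : form a a = 0
      · simp [coroot, h]
      · have hc : 2 / form a a * form a a = 2 := div_mul_cancel₀ 2 h
        simp only [LinearMap.coe_mk, AddHom.coe_mk, coroot, map_smul, smul_eq_mul]
        have e : 2 / form a a * form (x - (2 / form a a * form x a) • a) a =
            -(2 / form a a * form x a) := by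
          simp only [map_sub, map_smul, LinearMap.sub_apply, LinearMap.smul_apply, smul_eq_mul,
            mul_sub]
          rw [mul_left_comm, hc]
          ring
        rw [e]
        module)

theorem refl_apply (a x : AffV V) : refl a x = x - form x (coroot a) • a := rfl

/-- The translation
`t_u(v + ηc + ξd) = v + ξu + (η - (ξ/2)(u, u) - (v, u))c + ξd`. -/
def transl (u : V) : AffV V ≃ₗ[ℝ] AffV V where
  toFun x := (x.1 + x.2.2 • u, x.2.1 - x.2.2 / 2 * ⟪u, u⟫_ℝ - ⟪x.1, u⟫_ℝ, x.2.2)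
  map_add' x y := by
    ext <;> simp [inner_add_left, add_smul] <;> first | module | ring
  map_smul' r x := by
    ext <;> simp [real_inner_smul_left, mul_smul] <;> ring
  invFun x := (x.1 - x.2.2 • u, x.2.1 - x.2.2 / 2 * ⟪u, u⟫_ℝ + ⟪x.1, u⟫_ℝ, x.2.2)
  left_inv x := by
    ext <;> simp [inner_add_left, real_inner_smul_left] ; ring
  right_inv x := by
    ext <;> simp [inner_sub_left, real_inner_smul_left] ; ring

theorem transl_apply (u : V) (x : AffV V) :
    transl u x = (x.1 + x.2.2 • u, x.2.1 - x.2.2 / 2 * ⟪u, u⟫_ℝ - ⟪x.1, u⟫_ℝ, x.2.2) := rfl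

theorem form_refl (a x y : AffV V) : form (refl a x) (refl a y) = form x y := by
  by_cases h : form a a = 0
  · simp [refl_apply, coroot, h]
  · simp only [refl_apply, coroot, map_smul, map_sub, LinearMap.sub_apply,
      LinearMap.smul_apply, smul_eq_mul]
    rw [form_comm a y]
    field_simp
    ring

theorem form_transl (u : V) (x y : AffV V) : form (transl u x) (transl u y) = form x y := by
  simp only [transl_apply, form_apply, inner_add_left, inner_add_right, real_inner_smul_left,
    real_inner_smul_right]
  rw [real_inner_comm y.1 u]
  ring

/-- `V ⊕ ℝc ⊕ ℝ_{>0}d`. -/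
def VPlus (V : Type*) : Set (AffV V) := {x | 0 < x.2.2}

theorem isOpen_VPlus : IsOpen (VPlus V) :=
  isOpen_lt continuous_const (by fun_prop)

theorem convex_VPlus : Convex ℝ (VPlus V) :=
  (convex_Ioi (0 : ℝ)).is_linear_preimage
    (f := fun x : AffV V => x.2.2) ⟨fun _ _ => rfl, fun _ _ => rfl⟩

/-- Extension of a function on `V ⊕ ℝc ⊕ ℝ_{>0}d` by zero. -/
def extendZero (f : VPlus V → ℂ) : AffV V → ℂ := Function.extend Subtype.val f 0

theorem extendZero_coe (f : VPlus V → ℂ) (x : VPlus V) : extendZero f x = f x :=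
  Subtype.val_injective.extend_apply f 0 x

theorem extendZero_eventuallyEq {f : VPlus V → ℂ} {g : AffV V → ℂ}
    (h : ∀ x : VPlus V, f x = g x) {x : AffV V} (hx : x ∈ VPlus V) :
    g =ᶠ[𝓝 x] extendZero f := by
  filter_upwards [isOpen_VPlus.mem_nhds hx] with y hy
  exact ((extendZero_coe f ⟨y, hy⟩).trans (h ⟨y, hy⟩)).symm

/-- The complex valued real analytic functions on the open set `V ⊕ ℝc ⊕ ℝ_{>0}d`, as a subspace
of all functions on this set. -/
def analyticSubmodule (V : Type*) [NormedAddCommGroup V] [InnerProductSpace ℝ V] :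
    Submodule ℂ (VPlus V → ℂ) where
  carrier := {f | AnalyticOnNhd ℝ (extendZero f) (VPlus V)}
  add_mem' {f g} hf hg x hx :=
    ((hf x hx).add (hg x hx)).congr
      (extendZero_eventuallyEq (fun y => by simp [extendZero_coe]) hx)
  zero_mem' x hx :=
    (analyticAt_const (v := (0 : ℂ))).congr
      (extendZero_eventuallyEq (fun y => by simp) hx)
  smul_mem' r {f} hf x hx :=
    ((analyticAt_const (v := r)).mul (hf x hx)).congr
      (extendZero_eventuallyEq (fun y => by simp [extendZero_coe]) hx)

theorem mem_analyticFun_of {f : VPlus V → ℂ} {g : AffV V → ℂ}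
    (h : ∀ x : VPlus V, f x = g x) (hg : AnalyticOnNhd ℝ g (VPlus V)) : f ∈ analyticSubmodule V :=
  fun x hx => (hg x hx).congr (extendZero_eventuallyEq h hx)

/-- The space `C^ω` of complex valued real analytic functions on `V ⊕ ℝc ⊕ ℝ_{>0}d`. -/
structure AnalyticFun (V : Type*) [NormedAddCommGroup V] [InnerProductSpace ℝ V] where
  val : VPlus V → ℂ
  property : val ∈ analyticSubmodule V

namespace AnalyticFun

theorem val_injective : Function.Injective (AnalyticFun.val (V := V)) :=
  fun ⟨_, _⟩ ⟨_, _⟩ h => by cases h; rfl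

theorem ext {f g : AnalyticFun V} (h : ∀ x, f.1 x = g.1 x) : f = g := val_injective (funext h)

instance : Zero (AnalyticFun V) := ⟨⟨0, zero_mem _⟩⟩
instance : Add (AnalyticFun V) := ⟨fun f g => ⟨f.1 + g.1, add_mem f.2 g.2⟩⟩
instance : Neg (AnalyticFun V) := ⟨fun f => ⟨-f.1, neg_mem f.2⟩⟩
instance : Sub (AnalyticFun V) := ⟨fun f g => ⟨f.1 - g.1, sub_mem f.2 g.2⟩⟩
instance : SMul ℕ (AnalyticFun V) := ⟨fun n f => ⟨n • f.1, nsmul_mem f.2 n⟩⟩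
instance : SMul ℤ (AnalyticFun V) := ⟨fun n f => ⟨n • f.1, zsmul_mem f.2 n⟩⟩
instance : SMul ℂ (AnalyticFun V) := ⟨fun r f => ⟨r • f.1, Submodule.smul_mem _ r f.2⟩⟩

instance : AddCommGroup (AnalyticFun V) :=
  val_injective.addCommGroup _ rfl (fun _ _ => rfl) (fun _ => rfl) (fun _ _ => rfl)
    (fun _ _ => rfl) (fun _ _ => rfl)

instance : Module ℂ (AnalyticFun V) :=
  val_injective.module ℂ ⟨⟨AnalyticFun.val, rfl⟩, fun _ _ => rfl⟩ (fun _ _ => rfl)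

theorem val_add (f g : AnalyticFun V) : (f + g).1 = f.1 + g.1 := rfl

theorem val_smul (r : ℂ) (f : AnalyticFun V) : (r • f).1 = r • f.1 := rfl

end AnalyticFun

theorem extendZero_add (f g : VPlus V → ℂ) :
    extendZero (f + g) = extendZero f + extendZero g := by
  funext x
  by_cases hx : x ∈ VPlus V
  · simpa using (extendZero_coe (f + g) ⟨x, hx⟩).trans
      (congrArg₂ (· + ·) (extendZero_coe f ⟨x, hx⟩) (extendZero_coe g ⟨x, hx⟩)).symm
  · have : ¬ ∃ y : VPlus V, y.1 = x := by rintro ⟨y, rfl⟩; exact hx y.2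
    simp [extendZero, Function.extend_apply' _ _ _ this]

theorem extendZero_smul (r : ℂ) (f : VPlus V → ℂ) :
    extendZero (r • f) = r • extendZero f := by
  funext x
  by_cases hx : x ∈ VPlus V
  · simpa using (extendZero_coe (r • f) ⟨x, hx⟩).trans
      (congrArg (r * ·) (extendZero_coe f ⟨x, hx⟩)).symm
  · have : ¬ ∃ y : VPlus V, y.1 = x := by rintro ⟨y, rfl⟩; exact hx y.2
    simp [extendZero, Function.extend_apply' _ _ _ this]

theorem differentiableAt_extendZero (f : AnalyticFun V) (x : VPlus V) :
    DifferentiableAt ℝ (extendZero f.1) x.1 := (f.2 x.1 x.2).differentiableAt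

/-- The directional derivative `(∂_v f)(u) = d/dt f(u + tv)` at `t = 0`. -/
def dirDeriv [FiniteDimensional ℝ V] (v : AffV V) : AnalyticFun V →ₗ[ℂ] AnalyticFun V where
  toFun f := ⟨fun u => lineDeriv ℝ (extendZero f.1) u.1 v,
    mem_analyticFun_of (g := fun u => fderiv ℝ (extendZero f.1) u v)
      (fun u => (differentiableAt_extendZero f u).lineDeriv_eq_fderiv)
      (fun u hu => ((ContinuousLinearMap.apply ℝ ℂ v).analyticAt _).comp (f.2.fderiv u hu))⟩
  map_add' f g := by
    refine AnalyticFun.ext fun u => ?_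
    simp only [AnalyticFun.val_add, extendZero_add, Pi.add_apply]
    rw [DifferentiableAt.lineDeriv_eq_fderiv, fderiv_add, add_apply,
      (differentiableAt_extendZero f u).lineDeriv_eq_fderiv,
      (differentiableAt_extendZero g u).lineDeriv_eq_fderiv]
    exacts [differentiableAt_extendZero f u, differentiableAt_extendZero g u,
      (differentiableAt_extendZero f u).add (differentiableAt_extendZero g u)]
  map_smul' r f := by
    refine AnalyticFun.ext fun u => ?_
    simp only [AnalyticFun.val_smul, extendZero_smul, Pi.smul_apply, RingHom.id_apply]
    rw [DifferentiableAt.lineDeriv_eq_fderiv, fderiv_const_smul, smul_apply,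
      (differentiableAt_extendZero f u).lineDeriv_eq_fderiv]
    exacts [differentiableAt_extendZero f u, (differentiableAt_extendZero f u).const_smul r]

end Ambient

/-! ### Affine root data -/

/-- The root theoretic data in a Euclidean space `V`: a reduced, irreducible, crystallographic
root system `R` in its span `V_s` (which may be a proper subspace of `V`), whose coroots are
`α^∨ = 2α / (α, α)`, a choice of simple roots, the corresponding highest root `θ`, and a lattice
`Y` in `V` (not necessarily of full rank) which contains all coroots and satisfies
`(Y, R) ⊆ ℤ`. -/
structure AffineDatum (ι V : Type*) [NormedAddCommGroup V] [InnerProductSpace ℝ V] where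
  P : RootPairing ι ℝ V V
  toLinearMap_eq : ∀ x y : V, P.toLinearMap x y = ⟪x, y⟫_ℝ
  coroot_eq : ∀ i, P.coroot i = (2 / ⟪P.root i, P.root i⟫_ℝ) • P.root i
  crystallographic : P.IsCrystallographic
  reduced : P.IsReduced
  irreducible : ∀ s : Set ι, s.Nonempty → sᶜ.Nonempty →
    ∃ i ∈ s, ∃ j ∈ sᶜ, ⟪P.root i, P.root j⟫_ℝ ≠ 0
  base : P.Base
  θ : ι
  highest : ∀ i, P.root θ - P.root i ∈ AddSubmonoid.closure (P.root '' base.support)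
  Y : AddSubgroup V
  discrete : DiscreteTopology Y
  coroot_mem : ∀ i, P.coroot i ∈ Y
  inner_root_mem : ∀ y ∈ Y, ∀ i, ∃ n : ℤ, ⟪y, P.root i⟫_ℝ = n

namespace AffineDatum

variable {ι V : Type*} [NormedAddCommGroup V] [InnerProductSpace ℝ V] (D : AffineDatum ι V)

/-- The affine root `α + mc`, where `α` is the root with index `i`. -/
def affRoot (i : ι) (m : ℤ) : AffV V := (D.P.root i, (m : ℝ), 0)

/-- The set of all affine roots `α + mc`. -/
def affRoots : Set (AffV V) := {a | ∃ (i : ι) (m : ℤ), a = D.affRoot i m}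

/-- The simple affine roots: `a₀ = -θ + c` and the simple roots. -/
def simpleAffRoots : Set (AffV V) :=
  insert (-D.P.root D.θ, 1, 0) ((fun i => D.affRoot i 0) '' D.base.support)

/-- The positive affine roots. -/
def posAffRoots : Set (AffV V) :=
  {a | a ∈ D.affRoots ∧ a ∈ AddSubmonoid.closure D.simpleAffRoots}

/-- The affine Weyl group, generated by all `s_a`. -/
def affWeyl : Subgroup (AffV V ≃ₗ[ℝ] AffV V) := Subgroup.closure (refl '' D.affRoots)

/-- The extended affine Weyl group `W ⋉ Y`: the group generated by the reflections in the roots of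
`R` and the translations `t_y`, `y` in `Y`. -/
def extWeyl : Subgroup (AffV V ≃ₗ[ℝ] AffV V) :=
  Subgroup.closure (Set.range (fun i => refl (D.affRoot i 0)) ∪ transl '' (D.Y : Set V))

theorem inner_root_self_ne (i : ι) : ⟪D.P.root i, D.P.root i⟫_ℝ ≠ 0 := by
  have h := D.P.root_coroot_two i
  rw [D.toLinearMap_eq, D.coroot_eq, real_inner_smul_right] at h
  intro h0
  rw [h0, mul_zero] at h
  exact two_ne_zero h.symm

theorem form_affRoot_self (i : ι) (m : ℤ) :
    form (D.affRoot i m) (D.affRoot i m) = ⟪D.P.root i, D.P.root i⟫_ℝ := by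
  simp [form_apply, affRoot]

/-- `s_{α + mc} = s_α t_{mα^∨}`. -/
theorem refl_affRoot (i : ι) (m : ℤ) :
    refl (D.affRoot i m) = refl (D.affRoot i 0) * transl (m • D.P.coroot i) := by
  have h := D.inner_root_self_ne i
  refine LinearEquiv.ext fun x => ?_
  rw [LinearEquiv.mul_apply]
  simp only [refl_apply, coroot, form_affRoot_self, transl_apply, map_smul, smul_eq_mul]
  simp only [form_apply, affRoot, D.coroot_eq, ← Int.cast_smul_eq_zsmul ℝ, inner_add_left,
    real_inner_smul_left, real_inner_smul_right]
  generalize hN : ⟪D.P.root i, D.P.root i⟫_ℝ = N at h ⊢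
  ext
  · simp only [Prod.fst_sub, Prod.smul_fst]
    match_scalars
    · simp
    · field_simp
      ring
  · simp only [Prod.fst_sub, Prod.snd_sub, Prod.smul_snd, Prod.smul_fst, smul_eq_mul]
    field_simp
    push_cast
    ring
  · simp

theorem refl_mem_extWeyl {a : AffV V} (ha : a ∈ D.affRoots) : refl a ∈ D.extWeyl := by
  obtain ⟨i, m, rfl⟩ := ha
  rw [refl_affRoot]
  exact mul_mem (Subgroup.subset_closure (Or.inl ⟨i, rfl⟩))
    (Subgroup.subset_closure (Or.inr ⟨_, zsmul_mem (D.coroot_mem i) m, rfl⟩))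

theorem simple_subset : D.simpleAffRoots ⊆ D.affRoots := by
  rintro a (rfl | ⟨i, -, rfl⟩)
  · refine ⟨D.P.reflectionPerm D.θ D.θ, 1, ?_⟩
    simp [affRoot]
  · exact ⟨i, 0, rfl⟩

theorem extWeyl_induction {p : (AffV V ≃ₗ[ℝ] AffV V) → Prop}
    (hr : ∀ i, p (refl (D.affRoot i 0))) (ht : ∀ y ∈ D.Y, p (transl y)) (h1 : p 1)
    (hm : ∀ w w', p w → p w' → p (w * w')) (hi : ∀ w, p w → p w⁻¹)
    {w : AffV V ≃ₗ[ℝ] AffV V} (hw : w ∈ D.extWeyl) : p w := by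
  refine Subgroup.closure_induction (p := fun w _ => p w) ?_ h1
    (fun _ _ _ _ => hm _ _) (fun _ _ => hi _) hw
  rintro _ (⟨i, rfl⟩ | ⟨y, hy, rfl⟩)
  exacts [hr i, ht y hy]

theorem form_extWeyl (w : D.extWeyl) (x y : AffV V) : form (w.1 x) (w.1 y) = form x y := by
  refine D.extWeyl_induction (p := fun w => ∀ x y, form (w x) (w y) = form x y)
    (fun i => form_refl _) (fun y _ => form_transl y) (fun _ _ => rfl) ?_ ?_ w.2 x y
  · intro w w' h h' x y
    simp only [LinearEquiv.mul_apply, h, h']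
  · intro w h x y
    rw [← h, ← LinearEquiv.mul_apply, ← LinearEquiv.mul_apply, mul_inv_cancel]
    rfl

/-- The extended affine Weyl group preserves the coefficient of `d`. -/
theorem level_extWeyl (w : D.extWeyl) (x : AffV V) : (w.1 x).2.2 = x.2.2 := by
  refine D.extWeyl_induction (p := fun w => ∀ x : AffV V, (w x).2.2 = x.2.2)
    (fun i x => by simp [refl_apply, affRoot]) (fun y _ _ => rfl) (fun _ => rfl) ?_ ?_ w.2 x
  · intro w w' h h' x
    simp only [LinearEquiv.mul_apply, h, h']
  · intro w h x
    rw [← h, ← LinearEquiv.mul_apply, mul_inv_cancel]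
    rfl

theorem refl_mem_affRoots (i : ι) {a : AffV V} (ha : a ∈ D.affRoots) :
    refl (D.affRoot i 0) a ∈ D.affRoots := by
  obtain ⟨j, m, rfl⟩ := ha
  refine ⟨D.P.reflectionPerm i j, m, ?_⟩
  have h := D.P.reflectionPerm_root i j
  rw [D.toLinearMap_eq, D.coroot_eq, real_inner_smul_right] at h
  rw [refl_apply, coroot, form_affRoot_self, map_smul, smul_eq_mul]
  ext
  · simp [form_apply, affRoot, ← h]
  · simp [affRoot]
  · simp [affRoot]

theorem transl_mem_affRoots {y : V} (hy : y ∈ D.Y) {a : AffV V} (ha : a ∈ D.affRoots) :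
    transl y a ∈ D.affRoots := by
  obtain ⟨j, m, rfl⟩ := ha
  obtain ⟨n, hn⟩ := D.inner_root_mem y hy j
  refine ⟨j, m - n, ?_⟩
  rw [real_inner_comm] at hn
  ext <;> simp [transl_apply, affRoot, hn]

/-- The set of affine roots is invariant under the extended affine Weyl group. -/
theorem extWeyl_mem_affRoots (w : D.extWeyl) (a : AffV V) :
    w.1 a ∈ D.affRoots ↔ a ∈ D.affRoots := by
  refine D.extWeyl_induction (p := fun w => ∀ a, w a ∈ D.affRoots ↔ a ∈ D.affRoots)
    ?_ ?_ (fun _ => Iff.rfl) ?_ ?_ w.2 a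
  · intro i a
    refine ⟨fun h => ?_, D.refl_mem_affRoots i⟩
    have := D.refl_mem_affRoots i h
    have e : refl (D.affRoot i 0) (refl (D.affRoot i 0) a) = a :=
      (refl (D.affRoot i 0)).left_inv a
    rwa [e] at this
  · intro y hy a
    refine ⟨fun h => ?_, D.transl_mem_affRoots hy⟩
    have := D.transl_mem_affRoots (neg_mem hy) h
    have e : transl (-y) (transl y a) = a := by
      ext <;> simp [transl_apply, inner_add_left, real_inner_smul_left] ; ring
    rwa [e] at this
  · intro w w' h h' a
    simp only [LinearEquiv.mul_apply, h, h']
  · intro w h a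
    rw [← h, ← LinearEquiv.mul_apply, mul_inv_cancel]
    rfl

/-- The reflection `s_a` in an affine root, as an element of the extended affine Weyl group. -/
def s (a : D.affRoots) : D.extWeyl := ⟨refl a.1, D.refl_mem_extWeyl a.2⟩

/-- `Ω`: the elements of the extended affine Weyl group that map positive affine roots to positive
affine roots. -/
def Ω : Set D.extWeyl := {ω | ∀ a ∈ D.posAffRoots, ω.1 a ∈ D.posAffRoots}

/-- A multiplicity function: a complex function on the affine roots that is invariant under the
extended affine Weyl group. -/
structure Multiplicity where
  k : D.affRoots → ℂ
  invariant : ∀ (w : D.extWeyl) (a b : D.affRoots), w.1 a.1 = b.1 → k a = k b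

/-! ### The extended trigonometric Cherednik algebra -/

/-- Generators: the vectors of the complexification of `V ⊕ ℝc ⊕ ℝd`, and the elements of the
extended affine Weyl group. -/
inductive Gen
  | vec (v : CAffV V)
  | grp (w : D.extWeyl)

variable {D}

/-- The relations: those of the symmetric algebra of the complexification of `V ⊕ ℝc ⊕ ℝd`, those
of the group algebra of the extended affine Weyl group, and the cross relations. -/
inductive Rel (κ : D.Multiplicity) : FreeAlgebra ℂ D.Gen → FreeAlgebra ℂ D.Gen → Prop
  | add (v v' : CAffV V) : Rel κ (.ι ℂ (.vec (v + v'))) (.ι ℂ (.vec v) + .ι ℂ (.vec v'))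
  | smul (r : ℂ) (v : CAffV V) : Rel κ (.ι ℂ (.vec (r • v))) (r • .ι ℂ (.vec v))
  | comm (v v' : CAffV V) : Rel κ (.ι ℂ (.vec v) * .ι ℂ (.vec v')) (.ι ℂ (.vec v') * .ι ℂ (.vec v))
  | one : Rel κ (.ι ℂ (.grp 1)) 1
  | mul (w w' : D.extWeyl) : Rel κ (.ι ℂ (.grp (w * w'))) (.ι ℂ (.grp w) * .ι ℂ (.grp w'))
  | cross_refl (a : D.affRoots) (ha : a.1 ∈ D.simpleAffRoots) (v : CAffV V) :
      Rel κ (.ι ℂ (.grp (D.s a)) * .ι ℂ (.vec v))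
        (.ι ℂ (.vec ((D.s a).1.toLinearMap.baseChange ℂ v)) * .ι ℂ (.grp (D.s a)) -
          algebraMap ℂ _ (κ.k a * (LinearMap.BilinForm.baseChange ℂ form) (1 ⊗ₜ[ℝ] a.1) v))
  | cross_omega (ω : D.extWeyl) (hω : ω ∈ D.Ω) (v : CAffV V) :
      Rel κ (.ι ℂ (.grp ω) * .ι ℂ (.vec v))
        (.ι ℂ (.vec (ω.1.toLinearMap.baseChange ℂ v)) * .ι ℂ (.grp ω))

/-- The extended trigonometric Cherednik algebra with multiplicity function `κ`. -/
abbrev CherednikAlg (κ : D.Multiplicity) := RingQuot (Rel κ)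

/-- The canonical map from the complexification of `V ⊕ ℝc ⊕ ℝd` to the algebra. -/
def CherednikAlg.vec (κ : D.Multiplicity) (v : CAffV V) : CherednikAlg κ :=
  RingQuot.mkAlgHom ℂ (Rel κ) (.ι ℂ (.vec v))

/-- The canonical map from the extended affine Weyl group to the algebra. -/
def CherednikAlg.grp (κ : D.Multiplicity) (w : D.extWeyl) : CherednikAlg κ :=
  RingQuot.mkAlgHom ℂ (Rel κ) (.ι ℂ (.grp w))

/-! ### Operators on analytic functions -/

theorem extWeyl_mem_VPlus (w : D.extWeyl) {x : AffV V} (hx : x ∈ VPlus V) : w.1 x ∈ VPlus V := by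
  change 0 < (w.1 x).2.2
  rw [level_extWeyl]
  exact hx

/-- The action of the extended affine Weyl group on functions, `(wf)(x) = f(w⁻¹x)`. -/
def act [FiniteDimensional ℝ V] (w : D.extWeyl) : AnalyticFun V →ₗ[ℂ] AnalyticFun V where
  toFun f := ⟨fun x => f.1 ⟨w⁻¹.1 x.1, extWeyl_mem_VPlus w⁻¹ x.2⟩,
    mem_analyticFun_of (g := fun x => extendZero f.1 (w⁻¹.1 x))
      (fun x => (extendZero_coe f.1 ⟨w⁻¹.1 x.1, extWeyl_mem_VPlus w⁻¹ x.2⟩).symm)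
      (fun x hx => AnalyticAt.comp (g := extendZero f.1) (f := fun x => w⁻¹.1 x)
        (f.2 _ (extWeyl_mem_VPlus w⁻¹ hx))
        ((LinearMap.toContinuousLinearMap (w⁻¹.1 : AffV V →ₗ[ℝ] AffV V)).analyticAt x))⟩
  map_add' _ _ := rfl
  map_smul' _ _ := rfl

theorem coroot_level (a : D.affRoots) : (coroot a.1).2.2 = 0 := by
  obtain ⟨_, i, m, rfl⟩ := a
  simp [coroot, affRoot]

theorem sub_coroot_mem (a : D.affRoots) (t : ℝ) {x : AffV V} (hx : x ∈ VPlus V) :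
    x - t • coroot a.1 ∈ VPlus V := by
  have : (x - t • coroot a.1).2.2 = x.2.2 := by simp [coroot_level]
  change 0 < (x - t • coroot a.1).2.2
  rw [this]
  exact hx

theorem continuous_extendZero_line (f : AnalyticFun V) (a : D.affRoots) (x : VPlus V) :
    Continuous fun t : ℝ => extendZero f.1 (x.1 - t • coroot a.1) :=
  f.2.continuousOn.comp_continuous (by fun_prop) (fun t => sub_coroot_mem a t x.2)

/-- The integral operator `(I(a)f)(x) = ∫_0^{(a, x)} f(x - t a^∨) dt`. -/
def intRefl [FiniteDimensional ℝ V] (a : D.affRoots) : AnalyticFun V →ₗ[ℂ] AnalyticFun V where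
  toFun f := ⟨fun x => ∫ t in (0 : ℝ)..form a.1 x.1, extendZero f.1 (x.1 - t • coroot a.1),
    mem_analyticFun_of
      (g := fun x => ((form a.1 x : ℝ) : ℂ) *
        ∫ θ in (0 : ℝ)..1, extendZero f.1 (x + θ • (-(form a.1 x)) • coroot a.1))
      (fun x => by
        have := intervalIntegral.smul_integral_comp_mul_left (a := 0) (b := 1)
          (fun t : ℝ => extendZero f.1 (x.1 - t • coroot a.1)) (form a.1 x.1)
        rw [mul_zero, mul_one, Complex.real_smul] at this
        rw [← this]
        congr 2
        funext θ
        congr 1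
        module)
      (fun x hx => by
        let l : AffV V →L[ℝ] ℝ := LinearMap.toContinuousLinearMap (form a.1)
        have h1 : AnalyticAt ℝ (fun x : AffV V => ((form a.1 x : ℝ) : ℂ)) x :=
          (Complex.ofRealCLM.comp l).analyticAt x
        have h2 := analyticAt_integral_segment isOpen_VPlus convex_VPlus f.2 hx
          (w := (-(form a.1 x)) • coroot a.1)
          (by rw [neg_smul, ← sub_eq_add_neg]; exact sub_coroot_mem a _ hx)
        have h3 : AnalyticAt ℝ
            (fun x : AffV V => (x, (-(form a.1 x)) • coroot a.1)) x :=
          ((ContinuousLinearMap.id ℝ (AffV V)).prod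
            ((-l).smulRight (coroot a.1))).analyticAt x
        exact h1.mul (AnalyticAt.comp_of_eq (x := x) h2 h3 rfl))⟩
  map_add' f g := by
    refine AnalyticFun.ext fun x => ?_
    simp only [AnalyticFun.val_add, extendZero_add, Pi.add_apply]
    exact intervalIntegral.integral_add
      ((continuous_extendZero_line f a x).intervalIntegrable _ _)
      ((continuous_extendZero_line g a x).intervalIntegrable _ _)
  map_smul' r f := by
    refine AnalyticFun.ext fun x => ?_
    simp only [AnalyticFun.val_smul, extendZero_smul, Pi.smul_apply, RingHom.id_apply]
    exact intervalIntegral.integral_smul _ _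

/-! ### Chambers and the space `F_M` -/

variable (D) in
/-- The regular elements of `V ⊕ ℝc ⊕ ℝ_{>0}d`. -/
def regular : Set (AffV V) := {x | x ∈ VPlus V ∧ ∀ a ∈ D.affRoots, form a x ≠ 0}

variable (D) in
/-- The chambers: the connected components of the set of regular elements. -/
def Chamber := {C : Set (AffV V) // ∃ x ∈ D.regular, C = connectedComponentIn D.regular x}

variable (D) in
/-- The fundamental chamber. -/
def fundChamber : Set (AffV V) := {x | ∀ a ∈ D.simpleAffRoots, 0 < form a x}

theorem extWeyl_mem_regular (w : D.extWeyl) {x : AffV V} (hx : x ∈ D.regular) :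
    w.1 x ∈ D.regular := by
  refine ⟨extWeyl_mem_VPlus w hx.1, fun a ha => ?_⟩
  have h := D.form_extWeyl w⁻¹ a (w.1 x)
  have e : w⁻¹.1 (w.1 x) = x := by
    rw [← LinearEquiv.mul_apply, ← Subgroup.coe_mul, inv_mul_cancel]; rfl
  rw [← h, e]
  exact hx.2 _ ((D.extWeyl_mem_affRoots w⁻¹ a).2 ha)

theorem image_regular (w : D.extWeyl) : w.1 '' D.regular = D.regular := by
  refine Set.Subset.antisymm ?_ fun x hx => ⟨w⁻¹.1 x, extWeyl_mem_regular w⁻¹ hx, ?_⟩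
  · rintro _ ⟨x, hx, rfl⟩
    exact extWeyl_mem_regular w hx
  · rw [← LinearEquiv.mul_apply, ← Subgroup.coe_mul, mul_inv_cancel]; rfl

/-- The action of the extended affine Weyl group on the set of chambers. -/
def Chamber.move [FiniteDimensional ℝ V] (w : D.extWeyl) (C : D.Chamber) : D.Chamber :=
  ⟨w.1 '' C.1, by
    obtain ⟨_, x, hx, rfl⟩ := C
    refine ⟨w.1 x, extWeyl_mem_regular w hx, ?_⟩
    have := w.1.toContinuousLinearEquiv.toHomeomorph.image_connectedComponentIn hx
    have e : w.1.toContinuousLinearEquiv.toHomeomorph '' D.regular = D.regular := image_regular w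
    rw [e] at this
    exact this⟩

open Classical in
/-- The value on the chamber `C` of the characteristic function of the half-space
`{x | (a, x) < 0}`. -/
def chi (a : AffV V) (C : D.Chamber) : ℂ := if ∀ x ∈ C.1, form a x < 0 then 1 else 0

/-- Only finitely many positive affine roots are negative on a given chamber. -/
theorem finite_chi_ne_zero [Finite ι] (C : D.Chamber) :
    {a : D.affRoots | a.1 ∈ D.posAffRoots ∧ chi a.1 C ≠ 0}.Finite := by
  obtain ⟨x, hx, hC⟩ := C.2
  have hxC : x ∈ C.1 := hC ▸ mem_connectedComponentIn hx
  have hpos : ∀ a ∈ AddSubmonoid.closure D.simpleAffRoots, 0 ≤ a.2.1 := by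
    intro a ha
    induction ha using AddSubmonoid.closure_induction with
    | mem a ha =>
      rcases ha with rfl | ⟨i, -, rfl⟩ <;> simp [affRoot]
    | zero => simp
    | add a b _ _ ha hb => exact add_nonneg ha hb
  have hlev : 0 < x.2.2 := hx.1
  refine Set.Finite.of_finite_image (f := Subtype.val) ?_ Subtype.val_injective.injOn
  refine (Set.finite_iUnion fun i : ι => (Set.finite_Icc (0 : ℤ)
    ⌈-⟪D.P.root i, x.1⟫_ℝ / x.2.2⌉).image (D.affRoot i)).subset ?_
  rintro _ ⟨⟨_, i, m, rfl⟩, ⟨hp, hn⟩, rfl⟩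
  refine Set.mem_iUnion.2 ⟨i, m, ⟨?_, ?_⟩, rfl⟩
  · have := hpos _ hp.2
    simpa [affRoot] using this
  · have h : form (D.affRoot i m) x < 0 := by
      by_contra h
      exact hn (if_neg fun h' => h (h' x hxC))
    have h' : ⟪D.P.root i, x.1⟫_ℝ + m * x.2.2 < 0 := by simpa [form_apply, affRoot] using h
    have h2 : (m : ℝ) ≤ -⟪D.P.root i, x.1⟫_ℝ / x.2.2 := by
      rw [le_div_iff₀ hlev]; linarith
    exact_mod_cast h2.trans (Int.le_ceil _)

variable {M : Type*} [AddCommGroup M] [Module ℂ M]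

variable (D M) in
/-- The space `F_M`: families, indexed by the chambers, of elements of `C^ω ⊗ M`. -/
abbrev FSpace := D.Chamber → AnalyticFun V ⊗[ℂ] M

variable [FiniteDimensional ℝ V]

/-- The action of the extended affine Weyl group on `C^ω ⊗ M`, that is
`f ↦ π_M(w)(f(w⁻¹ ·))`. -/
def actTensor (ρ : Representation ℂ D.extWeyl M) (w : D.extWeyl) :
    AnalyticFun V ⊗[ℂ] M →ₗ[ℂ] AnalyticFun V ⊗[ℂ] M :=
  TensorProduct.map (act w) (ρ w)

/-- The action of the extended affine Weyl group on `F_M`, that is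
`(wf)_C(x) = π_M(w)(f_{w⁻¹C}(w⁻¹x))`. -/
def actF (ρ : Representation ℂ D.extWeyl M) (w : D.extWeyl) : FSpace D M →ₗ[ℂ] FSpace D M :=
  LinearMap.pi fun C => actTensor ρ w ∘ₗ LinearMap.proj (C.move w⁻¹)

/-- The directional derivative on `C^ω ⊗ M`. -/
def derivTensor (v : AffV V) : AnalyticFun V ⊗[ℂ] M →ₗ[ℂ] AnalyticFun V ⊗[ℂ] M :=
  TensorProduct.map (dirDeriv v) LinearMap.id

/-- The Dunkl operator
`(𝒟_v f)_C = ∂_v f_C - ∑ k_a (a, v) χ_a(C) (s_a f)_C`, the sum being over all positive affine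
roots `a`. -/
def dunkl [Finite ι] (κ : D.Multiplicity) (ρ : Representation ℂ D.extWeyl M) (v : AffV V) :
    FSpace D M →ₗ[ℂ] FSpace D M :=
  LinearMap.pi fun C => derivTensor v ∘ₗ (LinearMap.proj C : FSpace D M →ₗ[ℂ] _) -
    ∑ a ∈ (finite_chi_ne_zero C).toFinset,
      (κ.k a * (form a.1 v : ℝ) * chi a.1 C) • ((LinearMap.proj C : FSpace D M →ₗ[ℂ] _) ∘ₗ actF ρ (D.s a))

/-! ### The two representations and the propagation operator -/

/-- `Q` is the representation by integral-reflection operators. -/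
structure IsIntegralReflectionRep (κ : D.Multiplicity) (ρ : Representation ℂ D.extWeyl M)
    (Q : CherednikAlg κ →ₐ[ℂ] Module.End ℂ (AnalyticFun V ⊗[ℂ] M)) : Prop where
  refl : ∀ a : D.affRoots, a.1 ∈ D.simpleAffRoots →
    Q (CherednikAlg.grp κ (D.s a)) =
      actTensor ρ (D.s a) - κ.k a • TensorProduct.map (intRefl a) (LinearMap.id : M →ₗ[ℂ] M)
  omega : ∀ ω ∈ D.Ω, Q (CherednikAlg.grp κ ω) = actTensor ρ ω
  vec : ∀ v : AffV V, Q (CherednikAlg.vec κ (1 ⊗ₜ[ℝ] v)) = derivTensor v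

/-- `π` is the representation by Dunkl operators. -/
structure IsDunklRep [Finite ι] (κ : D.Multiplicity) (ρ : Representation ℂ D.extWeyl M)
    (π : CherednikAlg κ →ₐ[ℂ] Module.End ℂ (FSpace D M)) : Prop where
  grp : ∀ w : D.extWeyl, π (CherednikAlg.grp κ w) = actF ρ w
  vec : ∀ v : AffV V, π (CherednikAlg.vec κ (1 ⊗ₜ[ℝ] v)) = dunkl κ ρ v

/-- `T` is the propagation operator attached to `Q`:
`(Tf)_{wC₊}(x) = π_M(w)((Q(w⁻¹)f)(w⁻¹x))` for all `w` in the affine Weyl group, where `C₊` is the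
fundamental chamber. -/
def IsPropagationOperator (κ : D.Multiplicity) (ρ : Representation ℂ D.extWeyl M)
    (Q : CherednikAlg κ →ₐ[ℂ] Module.End ℂ (AnalyticFun V ⊗[ℂ] M))
    (T : AnalyticFun V ⊗[ℂ] M →ₗ[ℂ] FSpace D M) : Prop :=
  ∀ (f : AnalyticFun V ⊗[ℂ] M) (w : D.extWeyl), w.1 ∈ D.affWeyl →
    ∀ C : D.Chamber, C.1 = w.1 '' D.fundChamber →
      T f C = actTensor ρ w (Q (CherednikAlg.grp κ w⁻¹) f)

end AffineDatum

end TrigCherednik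

end

/-! The Dunkl representation is constructed first and then used to prove the relations between the
integral-reflection operators.

Dunkl side. A simple reflection `s_a` permutes the positive affine roots other than `a`, and exactly
one of `a`, `-a` is negative on a given chamber. Hence conjugation by `s_a` changes a Dunkl operator
only by exchanging the terms of `a` and `-a`, which gives the cross relation (`actF_s_dunkl`). On
the fundamental chamber Dunkl operators are plain derivatives and commute there. The cross relation
carries commutativity from `C` to `s_a C`, hence to every chamber (`dunkl_comm`).

Integral-reflection side. The cross relation is a one-variable computation with the fundamental
theorem of calculus (`intRefl_dirDeriv`). The difficulty is that the operators must satisfy the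
relations of the affine Weyl group. These are reduced to relations inside the stabilizer of one
point `x` of the closed fundamental chamber at positive level, a finite group, by an argument of
Matsumoto type with minimal coset representatives (`LocalRelations.prod_eq`).

For such an `x`, a family `f` in `F_M` is compared with an element `z` of `C^ω ⊗ M`: all iterated
Dunkl derivatives of `f`, evaluated at `x` and summed over the chambers around `x`, should equal the
iterated derivatives of `z` at `x` (`SameJet`). The relation survives applying `s_a` to `f` and the
integral-reflection operator to `z`: both obey the same cross relation, and `I(a)` vanishes on the
wall of `a`. Placing `z` on the chamber around `x` farthest from `C₊` gives a family with the jet of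
`z`. Along a word the family sees only the group element, and an analytic function is determined by
its jet, so the product of operators depends only on that element (`localRelations_reflOp`).

Finally, every element of the extended group is uniquely an affine Weyl element times an element of
`Ω`, which yields the action on all of it. Chambers correspond to affine Weyl elements, so the
propagation operator exists and is unique. Its equivariance is formal, and its compatibility with
derivatives follows by the same induction over chambers. -/

noncomputable section

namespace TrigCherednik

namespace AffineDatum

/-! ### Positive affine roots -/

section Roots

variable {ι V : Type*} [NormedAddCommGroup V] [InnerProductSpace ℝ V] (D : AffineDatum ι V)

/-- The nonnegative integral combinations of the simple affine roots. -/
def cone : AddSubmonoid (AffV V) := AddSubmonoid.closure D.simpleAffRoots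

variable {D}

theorem mem_cone_of_simple {a : AffV V} (ha : a ∈ D.simpleAffRoots) : a ∈ D.cone :=
  AddSubmonoid.subset_closure ha

theorem pos_of_simple {a : AffV V} (ha : a ∈ D.simpleAffRoots) : a ∈ D.posAffRoots :=
  ⟨D.simple_subset ha, mem_cone_of_simple ha⟩

theorem neg_affRoot (i : ι) (m : ℤ) :
    -D.affRoot i m = D.affRoot (D.P.reflectionPerm i i) (-m) := by
  simp [affRoot]

theorem neg_mem_affRoots {a : AffV V} (ha : a ∈ D.affRoots) : -a ∈ D.affRoots := by
  obtain ⟨i, m, rfl⟩ := ha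
  exact ⟨_, _, neg_affRoot i m⟩

theorem form_self_pos {a : AffV V} (ha : a ∈ D.affRoots) : 0 < form a a := by
  obtain ⟨i, m, rfl⟩ := ha
  rw [form_affRoot_self]
  exact lt_of_le_of_ne real_inner_self_nonneg (D.inner_root_self_ne i).symm

theorem ne_zero_of_mem {a : AffV V} (ha : a ∈ D.affRoots) : a ≠ 0 := by
  rintro rfl
  simpa using form_self_pos ha

theorem inl_mem_cone {v : V} (hv : v ∈ AddSubmonoid.closure (D.P.root '' D.base.support)) :
    ((v, 0, 0) : AffV V) ∈ D.cone := by
  induction hv using AddSubmonoid.closure_induction with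
  | mem v hv =>
    obtain ⟨i, hi, rfl⟩ := hv
    exact mem_cone_of_simple (Or.inr ⟨i, hi, by simp [affRoot]⟩)
  | zero => exact zero_mem _
  | add v w _ _ hv hw => simpa using add_mem hv hw

theorem highest_mem : D.P.root D.θ ∈ AddSubmonoid.closure (D.P.root '' D.base.support) := by
  rcases D.base.root_mem_or_neg_mem D.θ with h | h
  · exact h
  -- If `-θ` were a nonnegative combination, then so would be `θ - (-θ) = 2θ`, and the sum of the
  -- two is `θ`.
  · have h2 := D.highest (D.P.reflectionPerm D.θ D.θ)
    have := add_mem h h2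
    simpa using this

theorem c_mem_cone : ((0, 1, 0) : AffV V) ∈ D.cone := by
  have h := add_mem (mem_cone_of_simple (D := D) (Or.inl rfl)) (inl_mem_cone (D := D) highest_mem)
  simpa using h

/-- Write `α + (n+1)c = (n+1)(-θ + c) + nθ + (θ - (-α))`; the last bracket is a nonnegative
combination because `θ` is highest. -/
theorem pos_of_pos_level {i : ι} {n : ℕ} : D.affRoot i (n + 1) ∈ D.posAffRoots := by
  refine ⟨⟨i, _, rfl⟩, ?_⟩
  have h2 := D.highest (D.P.reflectionPerm i i)
  have h := add_mem (add_mem (nsmul_mem (mem_cone_of_simple (D := D) (Or.inl rfl)) (n + 1))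
    (nsmul_mem (inl_mem_cone (D := D) highest_mem) n)) (inl_mem_cone h2)
  change _ ∈ D.cone
  convert h using 1
  ext
  · simp [affRoot, add_smul]
  · simp [affRoot]
  · simp [affRoot]

theorem pos_or_neg {a : AffV V} (ha : a ∈ D.affRoots) :
    a ∈ D.posAffRoots ∨ -a ∈ D.posAffRoots := by
  obtain ⟨i, m, rfl⟩ := ha
  rcases lt_trichotomy m 0 with h | rfl | h
  · right
    rw [neg_affRoot]
    obtain ⟨n, hn⟩ := Int.eq_succ_of_zero_lt (a := -m) (by omega)
    rw [hn]
    exact_mod_cast pos_of_pos_level (D := D) (n := n)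
  · rcases D.base.root_mem_or_neg_mem i with h | h
    · exact Or.inl ⟨⟨i, 0, rfl⟩, by simpa [affRoot, cone] using inl_mem_cone h⟩
    · exact Or.inr ⟨⟨_, _, neg_affRoot i 0⟩, by simpa [affRoot, cone] using inl_mem_cone h⟩
  · left
    obtain ⟨n, hn⟩ := Int.eq_succ_of_zero_lt (a := m) (by omega)
    rw [hn]
    exact_mod_cast pos_of_pos_level (D := D) (n := n)

theorem level_nonneg {e : AffV V} (he : e ∈ D.cone) : 0 ≤ e.2.1 := by
  induction he using AddSubmonoid.closure_induction with
  | mem a ha => rcases ha with rfl | ⟨i, -, rfl⟩ <;> simp [affRoot]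
  | zero => simp
  | add a b _ _ ha hb => exact add_nonneg ha hb

theorem form_c (x : AffV V) : form ((0, 1, 0) : AffV V) x = x.2.2 := by
  simp [form_apply]

theorem form_nonneg_of_mem_cone {x : AffV V} (hx : ∀ a ∈ D.simpleAffRoots, 0 ≤ form a x)
    {e : AffV V} (he : e ∈ D.cone) : 0 ≤ form e x := by
  induction he using AddSubmonoid.closure_induction with
  | mem a ha => exact hx a ha
  | zero => simp
  | add a b _ _ ha hb => rw [map_add, LinearMap.add_apply]; exact add_nonneg ha hb

/-- A nonnegative combination that vanishes at a point of the closed fundamental chamber only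
involves the simple affine roots vanishing there. -/
theorem mem_closure_of_form_eq_zero {x : AffV V} (hx : ∀ a ∈ D.simpleAffRoots, 0 ≤ form a x)
    {e : AffV V} (he : e ∈ D.cone) (h0 : form e x = 0) :
    e ∈ AddSubmonoid.closure {a | a ∈ D.simpleAffRoots ∧ form a x = 0} := by
  induction he using AddSubmonoid.closure_induction with
  | mem a ha => exact AddSubmonoid.subset_closure ⟨ha, h0⟩
  | zero => exact zero_mem _
  | add a b ha' hb' ha hb =>
    rw [map_add, LinearMap.add_apply] at h0
    have h1 := form_nonneg_of_mem_cone hx ha'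
    have h2 := form_nonneg_of_mem_cone hx hb'
    exact add_mem (ha (by linarith)) (hb (by linarith))

theorem form_pos_of_mem_cone {x : AffV V} (hx : x ∈ D.fundChamber) {e : AffV V}
    (he : e ∈ D.cone) (h0 : e ≠ 0) : 0 < form e x := by
  refine lt_of_le_of_ne (form_nonneg_of_mem_cone (fun a ha => (hx a ha).le) he) fun h => h0 ?_
  have := mem_closure_of_form_eq_zero (fun a ha => (hx a ha).le) he h.symm
  have h2 : {a | a ∈ D.simpleAffRoots ∧ form a x = 0} = ∅ := by
    ext a
    simp only [Set.mem_ofPred_eq, Set.mem_empty_iff_false, iff_false, not_and]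
    exact fun ha => (hx a ha).ne'
  rw [h2] at this
  simpa using this

theorem form_pos {x : AffV V} (hx : x ∈ D.fundChamber) {a : AffV V} (ha : a ∈ D.posAffRoots) :
    0 < form a x :=
  form_pos_of_mem_cone hx ha.2 (ne_zero_of_mem ha.1)

theorem fundChamber_subset_VPlus : D.fundChamber ⊆ VPlus V := fun x hx => by
  have := form_pos_of_mem_cone hx (c_mem_cone (D := D)) (by simp)
  rwa [form_c] at this

theorem pos_iff {x : AffV V} (hx : x ∈ D.fundChamber) {a : AffV V} (ha : a ∈ D.affRoots) :
    a ∈ D.posAffRoots ↔ 0 < form a x := by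
  refine ⟨form_pos hx, fun h => (pos_or_neg ha).resolve_right fun h' => ?_⟩
  have := form_pos hx h'
  simp only [map_neg, LinearMap.neg_apply] at this
  linarith

theorem neg_pos_iff {x : AffV V} (hx : x ∈ D.fundChamber) {a : AffV V} (ha : a ∈ D.affRoots) :
    -a ∈ D.posAffRoots ↔ form a x < 0 := by
  rw [pos_iff hx (neg_mem_affRoots ha)]
  simp

theorem fundChamber_subset_regular : D.fundChamber ⊆ D.regular := fun x hx =>
  ⟨fundChamber_subset_VPlus hx, fun a ha => by
    rcases pos_or_neg ha with h | h
    · exact ((pos_iff hx ha).1 h).ne'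
    · exact ((neg_pos_iff hx ha).1 h).ne⟩

/-- The simple affine roots are linearly independent, so that their values at a point can be
prescribed. -/
theorem exists_form_eq [FiniteDimensional ℝ V] (t : AffV V → ℝ) :
    ∃ x : AffV V, ∀ a ∈ D.simpleAffRoots, form a x = t a := by
  have hli := D.base.linearIndepOn_root
  -- The roots need not span `V`, so the simple roots are completed to a basis before a functional
  -- is prescribed.
  let b := Module.Basis.extend (LinearIndepOn.id_image hli)
  have key : ∃ v : V, ∀ i ∈ D.base.support, ⟪D.P.root i, v⟫_ℝ = t (D.affRoot i 0) := by
    let φ : V →ₗ[ℝ] ℝ := b.constr ℝ fun j => t ((j : V), 0, 0)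
    refine ⟨(InnerProductSpace.toDual ℝ V).symm (LinearMap.toContinuousLinearMap φ),
      fun i hi => ?_⟩
    rw [real_inner_comm, InnerProductSpace.toDual_symm_apply]
    have hm : D.P.root i ∈ (LinearIndepOn.id_image hli).extend (Set.subset_univ _) :=
      Module.Basis.subset_extend _ ⟨i, hi, rfl⟩
    have : D.P.root i = b ⟨_, hm⟩ := by simp [b]
    change φ (D.P.root i) = _
    rw [this, Module.Basis.constr_basis]
    simp [affRoot]
  obtain ⟨v, hv⟩ := key
  -- `-θ + c` takes the value `ξ - (θ, v)` at `v + ξd`, so the level `ξ` is free to fit the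
  -- remaining condition.
  refine ⟨(v, 0, t (-D.P.root D.θ, 1, 0) + ⟪D.P.root D.θ, v⟫_ℝ), ?_⟩
  rintro a (rfl | ⟨i, hi, rfl⟩)
  · simp [form_apply]
  · simp [form_apply, affRoot, hv i hi]

/-! ### Reflections -/

theorem refl_refl (a x : AffV V) : refl a (refl a x) = x := (refl a).left_inv x

theorem form_refl_left (a x y : AffV V) : form (refl a x) y = form x (refl a y) := by
  rw [← form_refl a x (refl a y), refl_refl]

theorem form_coroot (a x : AffV V) : form x (coroot a) = 2 / form a a * form x a := by
  simp [coroot]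

theorem refl_self {a : AffV V} (ha : a ∈ D.affRoots) : refl a a = -a := by
  rw [refl_apply, form_coroot, div_mul_cancel₀ _ (form_self_pos ha).ne']
  module

theorem refl_neg (a : AffV V) : refl (-a) = refl a := by
  ext1 x
  simp [refl_apply, coroot]

theorem refl_of_form_eq_zero {a x : AffV V} (h : form a x = 0) : refl a x = x := by
  rw [refl_apply, form_coroot, form_comm x a, h]
  simp

/-- The affine root system is reduced. -/
theorem eq_of_nsmul_eq {a b : AffV V} (ha : a ∈ D.affRoots) (hb : b ∈ D.affRoots) {n : ℕ}
    (h : b = n • a) : b = a := by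
  obtain ⟨i, m, rfl⟩ := ha
  obtain ⟨j, l, rfl⟩ := hb
  have h1 : D.P.root j = n • D.P.root i := congrArg Prod.fst h
  have hne : D.P.root i ≠ 0 := fun h0 => D.inner_root_self_ne i (by simp [h0])
  suffices n = 1 by rw [h, this, one_smul]
  by_cases hij : j = i
  · subst hij
    have : ((n : ℝ) - 1) • D.P.root j = 0 := by
      rw [sub_smul, one_smul, Nat.cast_smul_eq_nsmul, ← h1, sub_self]
    have := (smul_eq_zero.1 this).resolve_right hne
    exact_mod_cast sub_eq_zero.1 this
  · have h2 : D.P.root j = -D.P.root i := D.reduced.eq_or_eq_neg j i (fun hl => by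
      have := LinearIndependent.pair_iff.1 hl 1 (-n) (by
        rw [h1, neg_smul, Nat.cast_smul_eq_nsmul, one_smul, add_neg_cancel])
      simp at this) |>.resolve_left (fun h3 => hij (D.P.root.injective h3))
    -- The opposite root would require `n = -1`, impossible for a natural number.
    have : ((n : ℝ) + 1) • D.P.root i = 0 := by
      rw [add_smul, one_smul, Nat.cast_smul_eq_nsmul, ← h1, h2, neg_add_cancel]
    have := (smul_eq_zero.1 this).resolve_right hne
    have h0 : (0 : ℝ) ≤ n := n.cast_nonneg
    linarith

theorem refl_mem {a : AffV V} (ha : a ∈ D.affRoots) {b : AffV V} (hb : b ∈ D.affRoots) :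
    refl a b ∈ D.affRoots :=
  (D.extWeyl_mem_affRoots (D.s ⟨a, ha⟩) b).2 hb

/-! ### The point `rho` -/

section Rho

variable [FiniteDimensional ℝ V]

variable (D) in
/-- A point at which all simple affine roots take the value `1`. -/
def rho : AffV V := (exists_form_eq (D := D) fun _ => 1).choose

theorem form_rho {a : AffV V} (ha : a ∈ D.simpleAffRoots) : form a D.rho = 1 :=
  (exists_form_eq (D := D) fun _ => 1).choose_spec a ha

theorem rho_mem : D.rho ∈ D.fundChamber := fun a ha => by simp [form_rho ha]

/-- The value at `rho` counts the simple affine roots in a combination, so heights are natural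
numbers, available for induction, and heights `0` and `1` identify the element. -/
theorem height_cone {e : AffV V} (he : e ∈ D.cone) :
    ∃ n : ℕ, form e D.rho = n ∧ (n = 0 → e = 0) ∧ (n = 1 → e ∈ D.simpleAffRoots) := by
  induction he using AddSubmonoid.closure_induction with
  | mem a ha => exact ⟨1, by simp [form_rho ha], by simp, fun _ => ha⟩
  | zero => exact ⟨0, by simp⟩
  | add a b _ _ ha hb =>
    obtain ⟨n, h1, h2, h3⟩ := ha
    obtain ⟨m, h1', h2', h3'⟩ := hb
    refine ⟨n + m, by simp [h1, h1'], fun h => ?_, fun h => ?_⟩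
    · rw [h2 (by omega), h2' (by omega), add_zero]
    · rcases Nat.eq_zero_or_pos n with h0 | h0
      · rw [h2 h0, zero_add]; exact h3' (by omega)
      · rw [h2' (by omega), add_zero]; exact h3 (by omega)

theorem not_neg_of_pos {a : AffV V} (ha : a ∈ D.posAffRoots) : -a ∉ D.posAffRoots := fun h => by
  have h1 := form_pos rho_mem ha
  have h2 := form_pos rho_mem h
  simp only [map_neg, LinearMap.neg_apply] at h2
  linarith

/-- A simple reflection permutes the positive affine roots other than its own root. -/
theorem refl_pos {a : AffV V} (ha : a ∈ D.simpleAffRoots) {b : AffV V} (hb : b ∈ D.posAffRoots)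
    (hab : b ≠ a) : refl a b ∈ D.posAffRoots := by
  classical
  -- `x` lies on the wall of `a` and on no other wall of the fundamental chamber. It is fixed by
  -- `s_a`, so if `s_a b` is negative then `b` vanishes at `x`; it is then a multiple of `a`, hence
  -- equal to `a`.
  obtain ⟨x, hx⟩ := exists_form_eq (D := D) fun e => if e = a then 0 else 1
  have hx0 : ∀ e ∈ D.simpleAffRoots, 0 ≤ form e x := by
    intro e he
    rw [hx e he]
    split_ifs <;> simp
  have hxa : form a x = 0 := by simp [hx a ha]
  have ha' := D.simple_subset ha
  refine (pos_or_neg (refl_mem ha' hb.1)).resolve_right fun h => hab ?_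
  have h1 := form_nonneg_of_mem_cone hx0 h.2
  rw [map_neg, LinearMap.neg_apply, form_refl_left, refl_of_form_eq_zero hxa] at h1
  have h2 := form_nonneg_of_mem_cone hx0 hb.2
  have h3 := mem_closure_of_form_eq_zero hx0 hb.2 (by linarith)
  have h4 : {e | e ∈ D.simpleAffRoots ∧ form e x = 0} ⊆ {a} := by
    rintro e ⟨he, h0⟩
    by_contra hne
    rw [hx e he, if_neg (by simpa using hne)] at h0
    exact one_ne_zero h0
  obtain ⟨n, hn⟩ := AddSubmonoid.mem_closure_singleton.1 (AddSubmonoid.closure_mono h4 h3)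
  exact eq_of_nsmul_eq ha' hb.1 hn.symm

theorem refl_pos_iff {a : AffV V} (ha : a ∈ D.simpleAffRoots) {b : AffV V} (hb : b ≠ a)
    (hb' : b ≠ -a) : refl a b ∈ D.posAffRoots ↔ b ∈ D.posAffRoots := by
  refine ⟨fun h => ?_, fun h => refl_pos ha h hb⟩
  have := refl_pos ha h (fun h1 => hb' ?_)
  · rwa [refl_refl] at this
  · rw [← refl_refl a b, h1, refl_self (D.simple_subset ha)]

end Rho

/-- For each of the finitely many finite parts, the coefficient of `c` is at least `0` by positivity
and bounded above because `x` has positive level. -/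
theorem finite_pos_le [Finite ι] {x : AffV V} (hx : x ∈ VPlus V) (r : ℝ) :
    {b | b ∈ D.posAffRoots ∧ form b x ≤ r}.Finite := by
  have hlev : 0 < x.2.2 := hx
  refine (Set.finite_iUnion fun i : ι => (Set.finite_Icc (0 : ℤ)
    ⌈(r - ⟪D.P.root i, x.1⟫_ℝ) / x.2.2⌉).image (D.affRoot i)).subset ?_
  rintro _ ⟨⟨⟨i, m, rfl⟩, hp⟩, hn⟩
  refine Set.mem_iUnion.2 ⟨i, m, ⟨?_, ?_⟩, rfl⟩
  · simpa [affRoot] using level_nonneg hp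
  · have h' : ⟪D.P.root i, x.1⟫_ℝ + m * x.2.2 ≤ r := by simpa [form_apply, affRoot] using hn
    have h2 : (m : ℝ) ≤ (r - ⟪D.P.root i, x.1⟫_ℝ) / x.2.2 := by
      rw [le_div_iff₀ hlev]; linarith
    exact_mod_cast h2.trans (Int.le_ceil _)

end Roots

/-! ### Words in the simple reflections -/

section Words

variable {ι V : Type*} [NormedAddCommGroup V] [InnerProductSpace ℝ V] {D : AffineDatum ι V}

theorem mul_val_apply (w w' : D.extWeyl) (x : AffV V) : (w * w').1 x = w.1 (w'.1 x) := rfl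

theorem one_val_apply (x : AffV V) : (1 : D.extWeyl).1 x = x := rfl

theorem inv_val_apply (w : D.extWeyl) (x : AffV V) : w⁻¹.1 (w.1 x) = x := by
  rw [← mul_val_apply, inv_mul_cancel, one_val_apply]

theorem val_inv_apply (w : D.extWeyl) (x : AffV V) : w.1 (w⁻¹.1 x) = x := by
  rw [← mul_val_apply, mul_inv_cancel, one_val_apply]

theorem form_val_left (w : D.extWeyl) (x y : AffV V) : form (w.1 x) y = form x (w⁻¹.1 y) := by
  rw [← D.form_extWeyl w x, val_inv_apply]

theorem form_val_right (w : D.extWeyl) (x y : AffV V) : form x (w.1 y) = form (w⁻¹.1 x) y := by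
  rw [form_val_left, inv_inv]

theorem s_val (a : D.affRoots) (x : AffV V) : (D.s a).1 x = refl a.1 x := rfl

theorem s_mul_s (a : D.affRoots) : D.s a * D.s a = 1 :=
  Subtype.ext (LinearEquiv.ext fun x => refl_refl a.1 x)

theorem s_inv (a : D.affRoots) : (D.s a)⁻¹ = D.s a := inv_eq_of_mul_eq_one_left (s_mul_s a)

theorem s_congr {a b : D.affRoots} (h : a.1 = b.1 ∨ a.1 = -b.1) : D.s a = D.s b := by
  refine Subtype.ext ?_
  change refl a.1 = refl b.1
  rcases h with h | h
  · rw [h]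
  · rw [h, refl_neg]

/-- The action of the extended affine Weyl group on the affine roots. -/
def mapRoot (w : D.extWeyl) (a : D.affRoots) : D.affRoots :=
  ⟨w.1 a.1, (D.extWeyl_mem_affRoots w a.1).2 a.2⟩

theorem s_mapRoot (w : D.extWeyl) (a : D.affRoots) : D.s (mapRoot w a) = w * D.s a * w⁻¹ := by
  refine Subtype.ext (LinearEquiv.ext fun x => ?_)
  change refl (w.1 a.1) x = w.1 (refl a.1 (w⁻¹.1 x))
  simp only [refl_apply, map_sub, val_inv_apply, map_smul, coroot, D.form_extWeyl w, smul_eq_mul]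
  rw [form_comm x, form_val_left, form_comm (w⁻¹.1 x)]

theorem s_mul_eq (w : D.extWeyl) (a : D.affRoots) : w * D.s a = D.s (mapRoot w a) * w := by
  rw [s_mapRoot, inv_mul_cancel_right]

variable (D) in
/-- The simple affine roots. -/
abbrev SimpleRoot := {a : D.affRoots // a.1 ∈ D.simpleAffRoots}

/-- The product of a list of simple reflections. -/
def word (l : List D.SimpleRoot) : D.extWeyl := (l.map fun a => D.s a.1).prod

@[simp] theorem word_nil : word ([] : List D.SimpleRoot) = 1 := rfl

@[simp] theorem word_cons (a : D.SimpleRoot) (l : List D.SimpleRoot) :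
    word (a :: l) = D.s a.1 * word l := by simp [word]

@[simp] theorem word_append (l l' : List D.SimpleRoot) : word (l ++ l') = word l * word l' := by
  simp [word]

theorem word_reverse (l : List D.SimpleRoot) : word l.reverse = (word l)⁻¹ := by
  induction l with
  | nil => simp
  | cons a l ih => simp [ih, s_inv]

theorem word_singleton (a : D.SimpleRoot) : word [a] = D.s a.1 := by simp

/-- The inversion set: the positive affine roots that `w⁻¹` makes negative. -/
def inv (w : D.extWeyl) : Set (AffV V) := {b | b ∈ D.posAffRoots ∧ -(w⁻¹.1 b) ∈ D.posAffRoots}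

/-- The number of inversions. -/
def len (w : D.extWeyl) : ℕ := (inv w).ncard

theorem mapRoot_pos_or_neg (w : D.extWeyl) (a : D.affRoots) :
    w.1 a.1 ∈ D.posAffRoots ∨ -(w.1 a.1) ∈ D.posAffRoots :=
  pos_or_neg (mapRoot w a).2

theorem mul_s_neg {w : D.extWeyl} {a : D.SimpleRoot} (h : -(w.1 a.1.1) ∈ D.posAffRoots) :
    (w * D.s a.1).1 a.1.1 ∈ D.posAffRoots := by
  rw [mul_val_apply, s_val, refl_self a.1.2, map_neg]
  exact h

theorem word_mem_affWeyl (l : List D.SimpleRoot) : (word l).1 ∈ D.affWeyl := by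
  induction l with
  | nil => exact one_mem _
  | cons a l ih =>
    rw [word_cons]
    exact mul_mem (Subgroup.subset_closure ⟨_, a.1.2, rfl⟩) ih

theorem Omega_fundChamber {w : D.extWeyl} (hw : w ∈ D.Ω) {x : AffV V} (hx : x ∈ D.fundChamber) :
    w⁻¹.1 x ∈ D.fundChamber := by
  intro a ha
  rw [form_val_right, inv_inv]
  exact form_pos hx (hw a (pos_of_simple ha))

theorem Omega_mul {w w' : D.extWeyl} (hw : w ∈ D.Ω) (hw' : w' ∈ D.Ω) : w * w' ∈ D.Ω :=
  fun b hb => hw _ (hw' b hb)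

theorem Omega_one : (1 : D.extWeyl) ∈ D.Ω := fun _ hb => hb

/-- Positivity of an affine root can be tested at one point of the fundamental chamber, and the
value of `w b` at `x` is that of `b` at `w⁻¹ x`. -/
theorem mem_Omega_of_mem {w : D.extWeyl} {x : AffV V} (hx : x ∈ D.fundChamber)
    (h : w⁻¹.1 x ∈ D.fundChamber) : w ∈ D.Ω := by
  intro b hb
  refine (pos_iff hx (mapRoot w ⟨b, hb.1⟩).2).2 ?_
  change 0 < form (w.1 b) x
  rw [form_val_left]
  exact form_pos h hb

variable [FiniteDimensional ℝ V]

/-- Since `s_a` preserves the positive roots other than `a`, only the sign attached to `w a`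
changes. -/
theorem inv_mul_s {w : D.extWeyl} {a : D.SimpleRoot} (h : w.1 a.1.1 ∈ D.posAffRoots) :
    inv (w * D.s a.1) = insert (w.1 a.1.1) (inv w) := by
  ext b
  simp only [inv, Set.mem_ofPred_eq, Set.mem_insert_iff, mul_inv_rev, s_inv, mul_val_apply, s_val]
  constructor
  · rintro ⟨hb, h1⟩
    by_cases hba : w⁻¹.1 b = a.1.1
    · left; rw [← hba, val_inv_apply]
    refine Or.inr ⟨hb, ?_⟩
    rw [← map_neg] at h1
    rwa [refl_pos_iff a.2 ?_ ?_] at h1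
    · intro h2
      have h3 : w.1 a.1.1 = -b := by rw [← h2, map_neg, val_inv_apply]
      exact not_neg_of_pos hb (h3 ▸ h)
    · simpa using hba
  · rintro (rfl | ⟨hb, h1⟩)
    · refine ⟨h, ?_⟩
      rw [inv_val_apply, refl_self a.1.2, neg_neg]
      exact pos_of_simple a.2
    · refine ⟨hb, ?_⟩
      rw [← map_neg]
      refine refl_pos a.2 h1 fun h2 => ?_
      have h3 : w.1 a.1.1 = -b := by rw [← h2, map_neg, val_inv_apply]
      exact not_neg_of_pos hb (h3 ▸ h)

theorem not_mem_inv {w : D.extWeyl} {a : D.SimpleRoot} : w.1 a.1.1 ∉ inv w := by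
  rintro ⟨_, h⟩
  rw [inv_val_apply] at h
  exact not_neg_of_pos (pos_of_simple a.2) h

/-- The exchange property. -/
theorem exchange (a : D.SimpleRoot) (l : List D.SimpleRoot)
    (h : -((word l).1 a.1.1) ∈ D.posAffRoots) :
    ∃ l' : List D.SimpleRoot, l'.length + 1 = l.length ∧ word l' = word l * D.s a.1 := by
  induction l with
  | nil => exact absurd h (not_neg_of_pos (pos_of_simple a.2))
  | cons c m ih =>
    rcases mapRoot_pos_or_neg (word m) a.1 with h1 | h1
    · refine ⟨m, rfl, ?_⟩
      -- `s_c` turns the positive root `m a` negative, so that root is `c`. Hence `s_c m = m s_a`,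
      -- and the letter `c` can be deleted.
      have h2 : (word m).1 a.1.1 = c.1.1 := by
        by_contra hne
        refine not_neg_of_pos (refl_pos c.2 h1 hne) ?_
        simpa [mul_val_apply, s_val] using h
      have h3 : D.s (mapRoot (word m) a.1) = D.s c.1 := s_congr (Or.inl h2)
      rw [word_cons, ← h3, mul_assoc, s_mul_eq, ← mul_assoc, s_mul_s, one_mul]
    · obtain ⟨l', h2, h3⟩ := ih h1
      exact ⟨c :: l', by simp [h2], by simp [h3, mul_assoc]⟩

theorem len_one : len (1 : D.extWeyl) = 0 := by
  have : inv (1 : D.extWeyl) = ∅ := by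
    ext b
    simp only [Set.mem_empty_iff_false, iff_false]
    rintro ⟨h1, h2⟩
    rw [inv_one, one_val_apply] at h2
    exact not_neg_of_pos h1 h2
  rw [len, this, Set.ncard_empty]

/-- Every affine root is conjugate to a simple one under products of simple reflections. -/
theorem exists_word_simple {b : AffV V} (hb : b ∈ D.posAffRoots) :
    ∃ (l : List D.SimpleRoot) (a : D.SimpleRoot), b = (word l).1 a.1.1 := by
  obtain ⟨n, hn, -⟩ := height_cone hb.2
  induction n using Nat.strong_induction_on generalizing b with
  | _ n ih =>
    by_cases hs : b ∈ D.simpleAffRoots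
    · exact ⟨[], ⟨⟨b, hb.1⟩, hs⟩, rfl⟩
    -- Otherwise `b`, as a nonnegative combination of simple roots, would satisfy `(b, b) ≤ 0`.
    -- Reflecting in such an `a` lowers the height, which drives the induction.
    obtain ⟨a, ha, hab⟩ : ∃ a ∈ D.simpleAffRoots, 0 < form a b := by
      by_contra! h
      have := form_nonneg_of_mem_cone (x := -b) (fun a ha => by
        have := h a ha
        simp only [map_neg]; linarith) hb.2
      have h2 := form_self_pos hb.1
      simp only [map_neg] at this
      linarith
    let a' : D.SimpleRoot := ⟨⟨a, D.simple_subset ha⟩, ha⟩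
    have h1 := refl_pos ha hb (fun h => hs (h ▸ ha))
    obtain ⟨m, hm, -⟩ := height_cone h1.2
    have hlt : m < n := by
      have : form (refl a b) D.rho < form b D.rho := by
        rw [refl_apply, form_coroot, form_comm b a]
        simp only [map_sub, map_smul, LinearMap.sub_apply, LinearMap.smul_apply, form_rho ha,
          smul_eq_mul, mul_one]
        have := mul_pos (div_pos two_pos (form_self_pos a'.1.2)) hab
        linarith
      rw [hm, hn] at this
      exact_mod_cast this
    obtain ⟨l, e, he⟩ := ih m hlt h1 hm
    refine ⟨a' :: l, e, ?_⟩
    rw [word_cons, mul_val_apply, ← he, s_val, refl_refl]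

theorem s_mem_word (b : D.affRoots) : ∃ l : List D.SimpleRoot, D.s b = word l := by
  have key : ∀ b : D.affRoots, b.1 ∈ D.posAffRoots → ∃ l : List D.SimpleRoot, D.s b = word l := by
    intro b hb
    obtain ⟨l, a, h⟩ := exists_word_simple hb
    refine ⟨l ++ [a] ++ l.reverse, ?_⟩
    rw [s_congr (b := mapRoot (word l) a.1) (Or.inl h), s_mapRoot]
    simp [word_reverse, mul_assoc]
  rcases pos_or_neg b.2 with h | h
  · exact key b h
  · obtain ⟨l, hl⟩ := key ⟨_, h.1⟩ h
    exact ⟨l, by rw [← hl]; exact s_congr (Or.inr (neg_neg _).symm)⟩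

theorem exists_word_of_mem_affWeyl {w : D.extWeyl} (hw : w.1 ∈ D.affWeyl) :
    ∃ l : List D.SimpleRoot, w = word l := by
  suffices ∀ g ∈ D.affWeyl, ∃ l : List D.SimpleRoot, g = (word l).1 by
    obtain ⟨l, hl⟩ := this _ hw
    exact ⟨l, Subtype.ext hl⟩
  intro g hg
  induction hg using Subgroup.closure_induction with
  | mem g hg =>
    obtain ⟨b, hb, rfl⟩ := hg
    obtain ⟨l, hl⟩ := s_mem_word (D := D) ⟨b, hb⟩
    exact ⟨l, congrArg Subtype.val hl⟩
  | one => exact ⟨[], rfl⟩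
  | mul g g' _ _ h h' =>
    obtain ⟨l, rfl⟩ := h
    obtain ⟨l', rfl⟩ := h'
    exact ⟨l ++ l', by simp⟩
  | inv g _ h =>
    obtain ⟨l, rfl⟩ := h
    exact ⟨l.reverse, by simp [word_reverse]⟩

theorem Omega_inv {w : D.extWeyl} (hw : w ∈ D.Ω) : w⁻¹ ∈ D.Ω := by
  intro b hb
  refine (mapRoot_pos_or_neg w⁻¹ ⟨b, hb.1⟩).resolve_right fun h => ?_
  have := hw _ h
  rw [map_neg, val_inv_apply] at this
  exact not_neg_of_pos hb this

/-- `w⁻¹` also lies in `Ω`, so it sends simple roots to positive roots and never lowers heights on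
the cone. Applied to `w a`, this bounds its height by that of `a`, namely `1`. -/
theorem Omega_simple {w : D.extWeyl} (hw : w ∈ D.Ω) {a : AffV V} (ha : a ∈ D.simpleAffRoots) :
    w.1 a ∈ D.simpleAffRoots := by
  have key : ∀ e ∈ D.cone, form e D.rho ≤ form (w⁻¹.1 e) D.rho := by
    intro e he
    induction he using AddSubmonoid.closure_induction with
    | mem e he =>
      obtain ⟨n, hn, h0, -⟩ := height_cone (Omega_inv hw e (pos_of_simple he)).2
      rw [hn, form_rho he]
      have : n ≠ 0 := fun h => ne_zero_of_mem (mapRoot w⁻¹ ⟨e, D.simple_subset he⟩).2 (h0 h)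
      exact_mod_cast Nat.one_le_iff_ne_zero.2 this
    | zero => simp
    | add e e' _ _ h h' =>
      simp only [map_add, LinearMap.add_apply]
      exact add_le_add h h'
  have hp := hw a (pos_of_simple ha)
  have h1 := key _ hp.2
  rw [inv_val_apply, form_rho ha] at h1
  obtain ⟨n, hn, h0, h2⟩ := height_cone hp.2
  have : n ≠ 0 := fun h => ne_zero_of_mem hp.1 (h0 h)
  have h3 : n ≤ 1 := by rw [hn] at h1; exact_mod_cast h1
  exact h2 (by omega)

/-! ### Lengths, reduced words and the decomposition of the extended group -/

variable [Finite ι]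

theorem finite_inv (w : D.extWeyl) : (inv w).Finite := by
  refine (finite_pos_le (D := D) (x := w.1 D.rho)
    (extWeyl_mem_VPlus w (fundChamber_subset_VPlus rho_mem)) 0).subset ?_
  rintro b ⟨hb, h⟩
  refine ⟨hb, ?_⟩
  have := form_pos rho_mem h
  rw [form_val_right]
  simp only [map_neg, LinearMap.neg_apply] at this
  linarith

theorem len_mul_s {w : D.extWeyl} {a : D.SimpleRoot} (h : w.1 a.1.1 ∈ D.posAffRoots) :
    len (w * D.s a.1) = len w + 1 := by
  rw [len, inv_mul_s h, Set.ncard_insert_of_notMem not_mem_inv (finite_inv w), len]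

theorem len_mul_s_neg {w : D.extWeyl} {a : D.SimpleRoot} (h : -(w.1 a.1.1) ∈ D.posAffRoots) :
    len (w * D.s a.1) + 1 = len w := by
  rw [← len_mul_s (mul_s_neg h), mul_assoc, s_mul_s, mul_one]

/-- Every product of simple reflections has a reduced expression. -/
theorem exists_reduced (l : List D.SimpleRoot) :
    ∃ l' : List D.SimpleRoot, word l' = word l ∧ l'.length = len (word l) := by
  induction l using List.reverseRecOn with
  | nil => exact ⟨[], rfl, by simp [len_one]⟩
  | append_singleton l a ih =>
    obtain ⟨m, h1, h2⟩ := ih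
    rcases mapRoot_pos_or_neg (word l) a.1 with h | h
    · exact ⟨m ++ [a], by simp [h1], by simp [h2, len_mul_s h]⟩
    · obtain ⟨l', h3, h4⟩ := exchange a m (by rwa [h1])
      refine ⟨l', by simp [h4, h1], ?_⟩
      have := len_mul_s_neg h
      rw [word_append, word_singleton]
      omega

/-- There are no inversions, so a reduced expression is the empty word. -/
theorem word_eq_one_of_pos {l : List D.SimpleRoot}
    (h : ∀ b ∈ D.posAffRoots, (word l)⁻¹.1 b ∈ D.posAffRoots) : word l = 1 := by
  obtain ⟨l', h1, h2⟩ := exists_reduced l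
  have : inv (word l) = ∅ := by
    ext b
    simp only [Set.mem_empty_iff_false, iff_false]
    exact fun hb => not_neg_of_pos (h b hb.1) hb.2
  rw [len, this, Set.ncard_empty, List.length_eq_zero_iff] at h2
  rw [← h1, h2, word_nil]

/-- Simple transitivity on the points of the fundamental chamber. -/
theorem word_eq_one_of_mem {l : List D.SimpleRoot} {x y : AffV V} (hx : x ∈ D.fundChamber)
    (hy : y ∈ D.fundChamber) (h : (word l).1 x = y) : word l = 1 := by
  refine word_eq_one_of_pos fun b hb => ?_
  refine (pos_iff hx (mapRoot (word l)⁻¹ ⟨b, hb.1⟩).2).2 ?_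
  change 0 < form ((word l)⁻¹.1 b) x
  rw [form_val_left, inv_inv, h]
  exact form_pos hy hb

/-- Every regular point can be moved into the fundamental chamber by simple reflections. -/
theorem exists_word_mem {x : AffV V} (hx : x ∈ D.regular) :
    ∃ l : List D.SimpleRoot, (word l).1 x ∈ D.fundChamber := by
  obtain ⟨n, hn⟩ : ∃ n, {b | b ∈ D.posAffRoots ∧ form b x ≤ 0}.ncard = n := ⟨_, rfl⟩
  induction n using Nat.strong_induction_on generalizing x with
  | _ n ih =>
    by_cases hC : x ∈ D.fundChamber
    · exact ⟨[], hC⟩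
    obtain ⟨a, ha, hax⟩ : ∃ a ∈ D.simpleAffRoots, form a x ≤ 0 := by
      by_contra! h
      exact hC h
    let a' : D.SimpleRoot := ⟨⟨a, D.simple_subset ha⟩, ha⟩
    have hax' : form a x < 0 := lt_of_le_of_ne hax (hx.2 a a'.1.2)
    -- `s_a` embeds the positive roots that are nonpositive at `s_a x` into those that are
    -- nonpositive at `x`, and `a` itself is not hit.
    have hlt : {b | b ∈ D.posAffRoots ∧ form b ((D.s a'.1).1 x) ≤ 0}.ncard < n := by
      rw [← hn, ← Set.ncard_image_of_injective _ (refl a).injective]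
      refine Set.ncard_lt_ncard ⟨?_, fun hsub => ?_⟩ (finite_pos_le hx.1 0)
      · rintro _ ⟨b, ⟨hb, h1⟩, rfl⟩
        rw [s_val, ← form_refl_left] at h1
        refine ⟨refl_pos ha hb ?_, h1⟩
        rintro rfl
        rw [refl_self a'.1.2, map_neg, LinearMap.neg_apply] at h1
        linarith
      · obtain ⟨b, ⟨hb, -⟩, h2⟩ := hsub (a := a) ⟨pos_of_simple ha, hax⟩
        have : b = -a := by rw [← refl_refl a b, h2, refl_self a'.1.2]
        rw [this] at hb
        exact not_neg_of_pos (pos_of_simple ha) hb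
    obtain ⟨l, hl⟩ := ih _ hlt (extWeyl_mem_regular (D.s a'.1) hx) rfl
    refine ⟨l ++ [a'], ?_⟩
    rwa [word_append, word_singleton, mul_val_apply]

/-- Every element of the extended affine Weyl group is the product of an element of the affine Weyl
group and an element of `Ω`. -/
theorem exists_word_mul_Omega (w : D.extWeyl) :
    ∃ (l : List D.SimpleRoot), ∃ ω ∈ D.Ω, w = word l * ω := by
  obtain ⟨l, hl⟩ := exists_word_mem (extWeyl_mem_regular w (fundChamber_subset_regular
    (rho_mem (D := D))))
  refine ⟨l.reverse, word l * w, ?_, by simp [word_reverse]⟩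
  rw [← inv_inv (word l * w)]
  refine Omega_inv (mem_Omega_of_mem (rho_mem (D := D)) ?_)
  rwa [inv_inv, mul_val_apply]

/-- A word that lies in `Ω` maps the fundamental chamber into itself and is therefore trivial. This
makes the factorization in `exists_word_mul_Omega` unique. -/
theorem word_eq_of_mul_Omega_eq {l l' : List D.SimpleRoot} {w w' : D.extWeyl} (hw : w ∈ D.Ω)
    (hw' : w' ∈ D.Ω) (h : word l * w = word l' * w') : word l = word l' := by
  have h1 : word (l'.reverse ++ l) = w' * w⁻¹ := by
    rw [word_append, word_reverse, eq_mul_inv_iff_mul_eq, mul_assoc, h, inv_mul_cancel_left]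
  have h2 := Omega_fundChamber (Omega_inv (Omega_mul hw' (Omega_inv hw))) (rho_mem (D := D))
  rw [inv_inv, ← h1] at h2
  have h3 := word_eq_one_of_mem rho_mem h2 rfl
  rw [word_append, word_reverse, inv_mul_eq_one] at h3
  exact h3.symm

end Words

/-! ### Chambers -/

section Chambers

variable {ι V : Type*} [NormedAddCommGroup V] [InnerProductSpace ℝ V] {D : AffineDatum ι V}
  [FiniteDimensional ℝ V]

theorem continuous_form (a : AffV V) : Continuous fun x : AffV V => form a x :=
  (LinearMap.toContinuousLinearMap (form a)).continuous

/-- The fundamental chamber is convex and consists of regular points, so it lies in one component.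
Leaving it inside the regular set is impossible by the intermediate value theorem for a simple
affine root. -/
theorem fundChamber_eq {x : AffV V} (hx : x ∈ D.fundChamber) :
    D.fundChamber = connectedComponentIn D.regular x := by
  refine Set.Subset.antisymm ?_ fun y hy a ha => ?_
  · refine IsPreconnected.subset_connectedComponentIn (Convex.isPreconnected ?_) hx
      fundChamber_subset_regular
    intro y hy z hz s t hs ht hst a ha
    rw [map_add, map_smul, map_smul, smul_eq_mul, smul_eq_mul]
    rcases hs.eq_or_lt with rfl | hs
    · have : t = 1 := by linarith
      simpa [this] using hz a ha
    · have := mul_pos hs (hy a ha)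
      have := mul_nonneg ht (hz a ha).le
      linarith
  · by_contra! hay
    have hxr := fundChamber_subset_regular hx
    obtain ⟨z, hz, h0⟩ := isPreconnected_connectedComponentIn.intermediate_value hy
      (mem_connectedComponentIn hxr) (continuous_form a).continuousOn
      (show (0 : ℝ) ∈ Set.Icc (form a y) (form a x) from ⟨hay, (hx a ha).le⟩)
    exact ((connectedComponentIn_subset _ _) hz).2 a (D.simple_subset ha) h0

variable (D) in
/-- The fundamental chamber, as a chamber. -/
def fundCh : D.Chamber :=
  ⟨D.fundChamber, D.rho, fundChamber_subset_regular rho_mem, fundChamber_eq rho_mem⟩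

theorem move_move (w w' : D.extWeyl) (C : D.Chamber) :
    (C.move w').move w = C.move (w * w') := by
  refine Subtype.ext ?_
  change w.1 '' (w'.1 '' C.1) = (w * w').1 '' C.1
  rw [Set.image_image]
  rfl

theorem move_one (C : D.Chamber) : C.move 1 = C := by
  refine Subtype.ext ?_
  change (1 : D.extWeyl).1 '' C.1 = C.1
  simp

theorem Omega_move [Finite ι] {w : D.extWeyl} (hw : w ∈ D.Ω) : D.fundCh.move w = D.fundCh := by
  refine Subtype.ext (Set.Subset.antisymm ?_ fun x hx => ?_)
  · rintro _ ⟨x, hx, rfl⟩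
    have := Omega_fundChamber (Omega_inv hw) hx
    rwa [inv_inv] at this
  · exact ⟨_, Omega_fundChamber hw hx, val_inv_apply w x⟩

/-- Together with `eq_of_move_eq`, this identifies the chambers with the products of simple
reflections. -/
theorem exists_eq_move [Finite ι] (C : D.Chamber) :
    ∃ l : List D.SimpleRoot, C = D.fundCh.move (word l) := by
  obtain ⟨x, hx, hC⟩ := C.2
  obtain ⟨l, hl⟩ := exists_word_mem hx
  refine ⟨l.reverse, ?_⟩
  suffices C.move (word l) = D.fundCh by
    rw [← this, move_move, word_reverse, inv_mul_cancel, move_one]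
  refine Subtype.ext ?_
  obtain ⟨y, hy, hCy⟩ := (C.move (word l)).2
  rw [hCy]
  change _ = D.fundChamber
  rw [fundChamber_eq hl]
  refine connectedComponentIn_eq ?_
  rw [← hCy]
  exact ⟨x, hC ▸ mem_connectedComponentIn hx, rfl⟩

theorem eq_of_move_eq [Finite ι] {l l' : List D.SimpleRoot}
    (h : D.fundCh.move (word l) = D.fundCh.move (word l')) : word l = word l' := by
  have h1 : (word l).1 D.rho ∈ (D.fundCh.move (word l')).1 := h ▸ ⟨_, rho_mem, rfl⟩
  obtain ⟨y, hy, h2⟩ := h1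
  have h3 : word (l'.reverse ++ l) = 1 := by
    refine word_eq_one_of_mem rho_mem hy ?_
    rw [word_append, word_reverse, mul_val_apply, ← h2, inv_val_apply]
  rw [word_append, word_reverse, inv_mul_eq_one] at h3
  exact h3.symm

theorem chi_move (a : AffV V) (w : D.extWeyl) (C : D.Chamber) :
    chi a (C.move w) = chi (w⁻¹.1 a) C := by
  unfold chi
  congr 1
  refine propext ⟨fun h x hx => ?_, ?_⟩
  · rw [form_val_left, inv_inv]
    exact h _ ⟨x, hx, rfl⟩
  · rintro h _ ⟨x, hx, rfl⟩
    rw [form_val_right]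
    exact h x hx

theorem chi_fundCh_of_pos {a : AffV V} (ha : a ∈ D.posAffRoots) : chi a D.fundCh = 0 :=
  if_neg fun h => (form_pos rho_mem ha).not_gt (h _ rho_mem)

theorem chi_fundCh_of_neg {a : AffV V} (ha : -a ∈ D.posAffRoots) : chi a D.fundCh = 1 :=
  if_pos fun x hx => (neg_pos_iff hx (by simpa using neg_mem_affRoots ha.1)).1 ha

/-- An affine root has one sign on a whole chamber: transport to the fundamental chamber, where the
sign is that of a positive or negative root. This identity produces the scalar in the Dunkl cross
relation. -/
theorem chi_add_chi_neg [Finite ι] {a : AffV V} (ha : a ∈ D.affRoots) (C : D.Chamber) :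
    chi a C + chi (-a) C = 1 := by
  obtain ⟨l, rfl⟩ := exists_eq_move C
  rw [chi_move, chi_move, map_neg]
  rcases mapRoot_pos_or_neg (word l)⁻¹ ⟨a, ha⟩ with h | h
  · rw [chi_fundCh_of_pos h, chi_fundCh_of_neg (by rwa [neg_neg]), zero_add]
  · rw [chi_fundCh_of_neg h, chi_fundCh_of_pos h, add_zero]

end Chambers

/-! ### Reduced expressions and lifting of words -/

section Matsumoto

variable {ι V : Type*} [NormedAddCommGroup V] [InnerProductSpace ℝ V] {D : AffineDatum ι V}

theorem word_fix {x : AffV V} {l : List D.SimpleRoot} (h : ∀ a ∈ l, form a.1.1 x = 0) :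
    (word l).1 x = x := by
  induction l with
  | nil => rfl
  | cons a l ih =>
    rw [word_cons, mul_val_apply, ih fun e he => h e (List.mem_cons_of_mem _ he), s_val,
      refl_of_form_eq_zero (h a List.mem_cons_self)]

theorem val_c (w : D.extWeyl) : w.1 ((0, 1, 0) : AffV V) = (0, 1, 0) := by
  refine D.extWeyl_induction (p := fun w => w ((0, 1, 0) : AffV V) = (0, 1, 0)) ?_ ?_ rfl ?_ ?_ w.2
  · intro i
    simp [refl_apply, coroot, form_apply, affRoot]
  · intro y _
    simp [transl_apply]
  · intro w w' h h'
    rw [LinearEquiv.mul_apply, h', h]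
  · intro w h
    conv_lhs => rw [← h]
    rw [← LinearEquiv.mul_apply, inv_mul_cancel]
    rfl

variable [FiniteDimensional ℝ V]

/-- Take the point where `S` vanishes and the other simple roots equal `1`. Its level is its pairing
with `c`. Were that zero, `c` would be a combination of the simple roots vanishing there, that is,
of `S`. -/
theorem exists_facet_point (S : Set D.SimpleRoot)
    (hS : ∀ e ∈ AddSubmonoid.closure ((fun a : D.SimpleRoot => a.1.1) '' S), e ≠ (0, 1, 0)) :
    ∃ x ∈ VPlus V, (∀ a ∈ D.simpleAffRoots, 0 ≤ form a x) ∧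
      ∀ a : D.SimpleRoot, form a.1.1 x = 0 ↔ a ∈ S := by
  classical
  obtain ⟨x, hx⟩ := exists_form_eq (D := D)
    fun e => if e ∈ (fun a : D.SimpleRoot => a.1.1) '' S then 0 else 1
  have hx0 : ∀ a ∈ D.simpleAffRoots, 0 ≤ form a x := by
    intro a ha
    rw [hx a ha]
    split_ifs <;> simp
  have hx1 : ∀ a : D.SimpleRoot, form a.1.1 x = 0 ↔ a ∈ S := by
    intro a
    rw [hx _ a.2, ite_eq_left_iff]
    simp only [one_ne_zero, imp_false, not_not]
    refine ⟨?_, fun h => ⟨a, h, rfl⟩⟩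
    rintro ⟨b, hb, hba⟩
    rwa [← Subtype.ext (Subtype.ext hba)]
  refine ⟨x, ?_, hx0, hx1⟩
  have h1 := form_nonneg_of_mem_cone hx0 (c_mem_cone (D := D))
  rw [form_c] at h1
  refine lt_of_le_of_ne h1 fun h2 => hS (0, 1, 0) ?_ rfl
  have h3 := mem_closure_of_form_eq_zero hx0 (c_mem_cone (D := D)) (by rw [form_c, ← h2])
  refine AddSubmonoid.closure_mono ?_ h3
  rintro e ⟨he, h0⟩
  exact ⟨⟨⟨e, D.simple_subset he⟩, he⟩, (hx1 ⟨⟨e, _⟩, he⟩).1 h0, rfl⟩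

variable {G : Type*} [Monoid G] {X : D.SimpleRoot → G}

variable (X) in
/-- Compatibility of `X` with the relations between products of simple reflections that fix a
common point of the closed fundamental chamber. -/
def LocalRelations : Prop :=
  ∀ x ∈ VPlus V, (∀ a ∈ D.simpleAffRoots, 0 ≤ form a x) →
    ∀ l l' : List D.SimpleRoot, (∀ a ∈ l, form a.1.1 x = 0) →
    (∀ a ∈ l', form a.1.1 x = 0) → word l = word l' → (l.map X).prod = (l'.map X).prod

/-- A multiple of `a` is never `c`, because `(c, c) = 0` and `(a, a) > 0`. So some point of positive
level lies on the wall of `a` alone, and the local relation there for `s_a s_a = 1` applies. -/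
theorem LocalRelations.mul_self (hX : LocalRelations X) (a : D.SimpleRoot) : X a * X a = 1 := by
  obtain ⟨x, hx, hx0, h⟩ := exists_facet_point {a} (by
    intro e he h
    rw [Set.image_singleton] at he
    obtain ⟨n, hn⟩ := AddSubmonoid.mem_closure_singleton.1 he
    have h1 : form e e = 0 := by rw [h]; simp [form_apply]
    have h2 : n ≠ 0 := by
      rintro rfl
      rw [h, zero_smul] at hn
      simpa using congrArg (fun x : AffV V => x.2.1) hn
    rw [← hn, ← Nat.cast_smul_eq_nsmul ℝ] at h1
    simp only [map_smul, LinearMap.smul_apply, smul_eq_mul, mul_eq_zero, Nat.cast_eq_zero, h2,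
      (form_self_pos a.1.2).ne', or_self] at h1)
  have h1 : form a.1.1 x = 0 := (h a).2 rfl
  have := hX x hx hx0 [a, a] [] (by simp [h1]) (by simp) (by simp [s_mul_s])
  simpa using this

variable [Finite ι]

theorem len_word_le (l : List D.SimpleRoot) : len (word l) ≤ l.length := by
  induction l using List.reverseRecOn with
  | nil => simp [len_one]
  | append_singleton l a ih =>
    rw [word_append, word_singleton, List.length_append, List.length_singleton]
    rcases mapRoot_pos_or_neg (word l) a.1 with h | h
    · have := len_mul_s h; omega
    · have := len_mul_s_neg h; omega

theorem reduced_append_singleton {l : List D.SimpleRoot} {a : D.SimpleRoot}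
    (h : len (word (l ++ [a])) = l.length + 1) :
    len (word l) = l.length ∧ -((word (l ++ [a])).1 a.1.1) ∈ D.posAffRoots := by
  have h0 := len_word_le l
  rw [word_append, word_singleton] at h ⊢
  rcases mapRoot_pos_or_neg (word l) a.1 with h1 | h1
  · refine ⟨by have := len_mul_s h1; omega, ?_⟩
    rw [mul_val_apply, s_val, refl_self a.1.2, map_neg, neg_neg]
    exact h1
  · have := len_mul_s_neg h1; omega

/-- Minimal coset representatives for the parabolic subgroup of a set of simple affine roots. -/
theorem exists_strip (S : Set D.SimpleRoot) (l : List D.SimpleRoot) :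
    ∃ u m : List D.SimpleRoot, (∀ e ∈ m, e ∈ S) ∧ word u * word m = word l ∧
      u.length = len (word u) ∧ u.length + m.length = len (word l) ∧
      ∀ e ∈ S, (word u).1 e.1.1 ∈ D.posAffRoots := by
  obtain ⟨n, hn⟩ : ∃ n, len (word l) = n := ⟨_, rfl⟩
  induction n using Nat.strong_induction_on generalizing l with
  | _ n ih =>
    by_cases h : ∀ e ∈ S, (word l).1 e.1.1 ∈ D.posAffRoots
    · obtain ⟨u, hu, hlen⟩ := exists_reduced l
      exact ⟨u, [], by simp, by simp [hu], by rw [hlen, hu], by simp [hlen], by rwa [hu]⟩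
    -- Some `e` in `S` is a right descent of the word; moving it into the right-hand factor shortens
    -- what remains.
    · push Not at h
      obtain ⟨e, he, h1⟩ := h
      have h2 := (mapRoot_pos_or_neg (word l) e.1).resolve_left h1
      have h3 := len_mul_s_neg h2
      have h4 : word (l ++ [e]) = word l * D.s e.1 := by simp
      obtain ⟨u, m, hm, hw, hu, hum, hS⟩ := ih (len (word l * D.s e.1)) (by omega) (l ++ [e]) (by rw [h4])
      refine ⟨u, m ++ [e], ?_, ?_, hu, ?_, hS⟩
      · intro f hf
        rcases List.mem_append.1 hf with hf | hf
        · exact hm f hf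
        · rw [List.mem_singleton.1 hf]; exact he
      · rw [word_append, ← mul_assoc, hw, h4, word_singleton, mul_assoc, s_mul_s, mul_one]
      · rw [List.length_append, List.length_singleton]
        rw [h4] at hum
        omega

/-- Uniqueness of minimal coset representatives for the stabilizer of a point of the closed
fundamental chamber. -/
theorem minimal_unique {x : AffV V} (hx : ∀ a ∈ D.simpleAffRoots, 0 ≤ form a x)
    {u u' m : List D.SimpleRoot} (hm : ∀ e ∈ m, form e.1.1 x = 0)
    (hu : ∀ e : D.SimpleRoot, form e.1.1 x = 0 → (word u).1 e.1.1 ∈ D.posAffRoots)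
    (hu' : ∀ e : D.SimpleRoot, form e.1.1 x = 0 → (word u').1 e.1.1 ∈ D.posAffRoots)
    (h : word u' = word u * word m) : word m = 1 := by
  -- A cone element vanishing at `x` only involves simple roots vanishing at `x`, so positivity of
  -- `w` on those suffices.
  have key : ∀ {w : D.extWeyl}, (∀ e : D.SimpleRoot, form e.1.1 x = 0 →
      w.1 e.1.1 ∈ D.posAffRoots) → ∀ {b : AffV V}, b ∈ D.cone → form b x = 0 →
      w.1 b ∈ D.cone := by
    intro w hw b hb hbx
    have hb' := mem_closure_of_form_eq_zero hx hb hbx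
    clear hb hbx
    induction hb' using AddSubmonoid.closure_induction with
    | mem e he => exact (hw ⟨⟨e, D.simple_subset he.1⟩, he.1⟩ he.2).2
    | zero => simp
    | add a b _ _ ha hb => rw [map_add]; exact add_mem ha hb
  refine word_eq_one_of_pos fun b hb => ?_
  refine (mapRoot_pos_or_neg (word m)⁻¹ ⟨b, hb.1⟩).resolve_right fun h1 => ?_
  have h2 := form_nonneg_of_mem_cone hx hb.2
  have h3 := form_nonneg_of_mem_cone hx h1.2
  rw [map_neg, LinearMap.neg_apply, form_val_left, inv_inv, word_fix hm] at h3
  -- Since `m` fixes `x`, both `b` and `-m⁻¹ b` are nonnegative there with opposite values. Then `u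
  -- b` and `u'(-m⁻¹ b) = -u b` both lie in the cone, a contradiction.
  have h0 : form b x = 0 := by linarith
  have h4 := key hu hb.2 h0
  have h5 := key hu' h1.2 (by
    rw [map_neg, LinearMap.neg_apply, form_val_left, inv_inv, word_fix hm, h0, neg_zero])
  rw [h, map_neg, mul_val_apply, val_inv_apply] at h5
  have hroot := (mapRoot (word u) ⟨b, hb.1⟩).2
  exact not_neg_of_pos ⟨hroot, h4⟩ ⟨neg_mem_affRoots hroot, h5⟩

/-- Two reduced expressions of the same element have the same image. -/
theorem LocalRelations.reduced (hX : LocalRelations X) (l l' : List D.SimpleRoot)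
    (hl : len (word l) = l.length) (hl' : len (word l') = l'.length) (h : word l = word l') :
    (l.map X).prod = (l'.map X).prod := by
  obtain ⟨n, hn⟩ : ∃ n, l.length = n := ⟨_, rfl⟩
  induction n using Nat.strong_induction_on generalizing l l' with
  | _ n ih =>
    have hlen : l'.length = l.length := by rw [← hl, ← hl', h]
    rcases l.eq_nil_or_concat' with rfl | ⟨l₁, a, rfl⟩
    · rw [List.length_nil, List.length_eq_zero_iff] at hlen
      rw [hlen]
    rcases l'.eq_nil_or_concat' with rfl | ⟨l₁', b, rfl⟩
    · simp at hlen
    simp only [List.length_append, List.length_singleton] at hn hl hl' hlen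
    obtain ⟨hr, ha⟩ := reduced_append_singleton hl
    obtain ⟨hr', hb⟩ := reduced_append_singleton hl'
    rw [List.map_append, List.prod_append, List.map_append, List.prod_append]
    by_cases hab : a = b
    · subst hab
      rw [ih _ (by omega) l₁ l₁' hr hr' (by simpa using h) rfl]
    rw [← h] at hb
    set w := word (l₁ ++ [a]) with hw
    -- Both `a` and `b` are descents of `w`, so `w` makes their combinations negative. As `w` fixes
    -- `c`, which has positive `c`-coefficient, `c` is no such combination and a suitable facet
    -- point exists.
    have hcone : ∀ e ∈ AddSubmonoid.closure ((fun a : D.SimpleRoot => a.1.1) '' {a, b}),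
        -(w.1 e) ∈ D.cone := by
      intro e he
      induction he using AddSubmonoid.closure_induction with
      | mem e he =>
        obtain ⟨f, hf, rfl⟩ := he
        rcases hf with rfl | rfl
        exacts [ha.2, hb.2]
      | zero => simp
      | add e f _ _ he hf => rw [map_add, neg_add]; exact add_mem he hf
    obtain ⟨x, hx, hx0, hS⟩ := exists_facet_point {a, b} (by
      intro e he h0
      have h1 := hcone e he
      rw [h0, val_c] at h1
      have := level_nonneg h1
      norm_num at this)
    -- Both prefixes are split into a minimal coset representative and a word in `a`, `b`.
    -- Uniqueness of the representative gives `u = u'` as group elements, and then `m a = m' b`.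
    obtain ⟨u, m, hm, hum, hu, hlu, hpos⟩ := exists_strip {a, b} l₁
    obtain ⟨u', m', hm', hum', hu', hlu', hpos'⟩ := exists_strip {a, b} l₁'
    have h1 : word u' = word u * word (m ++ [a] ++ [b] ++ m'.reverse) := by
      have e1 : w = word u * word m * D.s a.1 := by rw [hum, hw]; simp
      have e2 : w = word u' * word m' * D.s b.1 := by rw [hum', h]; simp
      simp only [word_append, word_singleton, word_reverse]
      rw [← mul_assoc, ← mul_assoc, ← mul_assoc, ← e1, e2]
      rw [mul_assoc _ _ (D.s b.1), s_mul_s, mul_one, mul_inv_cancel_right]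
    have ha' : form a.1.1 x = 0 := (hS a).2 (by simp)
    have hb' : form b.1.1 x = 0 := (hS b).2 (by simp)
    have h2 := minimal_unique hx0 (m := m ++ [a] ++ [b] ++ m'.reverse) (u := u) (u' := u') (by
      intro e he
      simp only [List.mem_append, List.mem_singleton, List.mem_reverse] at he
      rcases he with ((he | rfl) | rfl) | he
      exacts [(hS e).2 (hm e he), ha', hb', (hS e).2 (hm' e he)])
      (fun e he => hpos e ((hS e).1 he)) (fun e he => hpos' e ((hS e).1 he)) h1
    rw [h2, mul_one] at h1
    have h3 : word (m ++ [a]) = word (m' ++ [b]) := by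
      simp only [word_append, word_singleton, word_reverse] at h2 ⊢
      rw [mul_inv_eq_one] at h2
      rw [← h2, mul_assoc _ _ (D.s b.1), s_mul_s, mul_one]
    -- Three comparisons of shorter reduced words (`l₁` with `u m`, `l₁'` with `u' m'`, `u` with
    -- `u'`) and one local relation (`m a` with `m' b`) combine to the claim.
    have h4 := ih l₁.length (by omega) l₁ (u ++ m) hr (by
      rw [word_append, hum, List.length_append, hlu]) (by rw [word_append, hum]) rfl
    have h5 := ih l₁'.length (by omega) l₁' (u' ++ m') hr' (by
      rw [word_append, hum', List.length_append, hlu']) (by rw [word_append, hum']) rfl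
    have h6 := ih u.length (by omega) u u' hu.symm hu'.symm h1.symm rfl
    have h7 := hX x hx hx0 (m ++ [a]) (m' ++ [b]) (by
      intro e he
      rcases List.mem_append.1 he with he | he
      · exact (hS e).2 (hm e he)
      · rwa [List.mem_singleton.1 he]) (by
      intro e he
      rcases List.mem_append.1 he with he | he
      · exact (hS e).2 (hm' e he)
      · rwa [List.mem_singleton.1 he]) h3
    rw [List.map_append, List.prod_append, List.map_append, List.prod_append] at h7
    rw [h4, h5, List.map_append, List.prod_append, List.map_append, List.prod_append, ← h6,
      mul_assoc, mul_assoc, h7]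

/-- The affine Weyl group is presented by the local relations between simple reflections. -/
theorem LocalRelations.prod_eq (hX : LocalRelations X) {l l' : List D.SimpleRoot}
    (h : word l = word l') : (l.map X).prod = (l'.map X).prod := by
  have key : ∀ l : List D.SimpleRoot, ∃ r : List D.SimpleRoot, word r = word l ∧
      len (word r) = r.length ∧ (l.map X).prod = (r.map X).prod := by
    intro l
    induction l using List.reverseRecOn with
    | nil => exact ⟨[], rfl, by simp [len_one], rfl⟩
    | append_singleton l a ih =>
      obtain ⟨r, h1, h2, h3⟩ := ih
      rw [List.map_append, List.prod_append, h3, word_append, word_singleton, ← h1]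
      rcases mapRoot_pos_or_neg (word r) a.1 with h | h
      · refine ⟨r ++ [a], by simp, ?_, by simp⟩
        rw [word_append, word_singleton, len_mul_s h, h2]; simp
      · obtain ⟨r', h4, h5⟩ := exists_reduced (r ++ [a])
        rw [word_append, word_singleton] at h4 h5
        refine ⟨r', h4, by rw [h4, h5], ?_⟩
        -- At a descent, `r` may be replaced by the reduced word `r' a`; the appended letter then
        -- cancels by `mul_self`.
        have h6 : word (r' ++ [a]) = word r := by
          rw [word_append, word_singleton, h4, mul_assoc, s_mul_s, mul_one]
        have h7 := len_mul_s_neg h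
        have h8 := hX.reduced r (r' ++ [a]) h2 (by
          rw [h6, List.length_append, h5, List.length_singleton, h7]) h6.symm
        rw [h8, List.map_append, List.prod_append, mul_assoc, List.map_singleton,
          List.prod_singleton, hX.mul_self, mul_one]
  obtain ⟨r, h1, h2, h3⟩ := key l
  obtain ⟨r', h1', h2', h3'⟩ := key l'
  rw [h3, h3']
  exact hX.reduced r r' h2 h2' (by rw [h1, h1', h])

end Matsumoto

end AffineDatum

/-! ### Operators on analytic functions -/

section Analytic

variable {V : Type*} [NormedAddCommGroup V] [InnerProductSpace ℝ V]

/-- Evaluation at a point. -/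
def evalAt (x : VPlus V) : AnalyticFun V →ₗ[ℂ] ℂ where
  toFun f := f.1 x
  map_add' _ _ := rfl
  map_smul' _ _ := rfl

theorem extendZero_apply (f : AnalyticFun V) {x : AffV V} (hx : x ∈ VPlus V) :
    extendZero f.1 x = f.1 ⟨x, hx⟩ := extendZero_coe f.1 ⟨x, hx⟩

variable [FiniteDimensional ℝ V]

theorem dirDeriv_val (v : AffV V) (f : AnalyticFun V) (x : VPlus V) :
    (dirDeriv v f).1 x = fderiv ℝ (extendZero f.1) x.1 v :=
  (differentiableAt_extendZero f x).lineDeriv_eq_fderiv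

theorem extendZero_dirDeriv (v : AffV V) (f : AnalyticFun V) {x : AffV V} (hx : x ∈ VPlus V) :
    extendZero (dirDeriv v f).1 x = fderiv ℝ (extendZero f.1) x v := by
  rw [extendZero_apply _ hx, dirDeriv_val]

theorem extendZero_dirDeriv_eventuallyEq (v : AffV V) (f : AnalyticFun V) {x : AffV V}
    (hx : x ∈ VPlus V) :
    extendZero (dirDeriv v f).1 =ᶠ[𝓝 x] fun y => fderiv ℝ (extendZero f.1) y v := by
  filter_upwards [isOpen_VPlus.mem_nhds hx] with y hy using extendZero_dirDeriv v f hy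

theorem dirDeriv_add (v v' : AffV V) :
    dirDeriv (v + v') = (dirDeriv v + dirDeriv v' : AnalyticFun V →ₗ[ℂ] AnalyticFun V) :=
  LinearMap.ext fun f => AnalyticFun.ext fun x => by
    simp only [LinearMap.add_apply, AnalyticFun.val_add, Pi.add_apply, dirDeriv_val, map_add]

theorem dirDeriv_smul (r : ℝ) (v : AffV V) :
    dirDeriv (r • v) = ((r : ℂ) • dirDeriv v : AnalyticFun V →ₗ[ℂ] AnalyticFun V) :=
  LinearMap.ext fun f => AnalyticFun.ext fun x => by
    simp only [LinearMap.smul_apply, AnalyticFun.val_smul, Pi.smul_apply, dirDeriv_val, map_smul,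
      Complex.real_smul, smul_eq_mul]

theorem dirDeriv_comm (v v' : AffV V) (f : AnalyticFun V) :
    dirDeriv v (dirDeriv v' f) = dirDeriv v' (dirDeriv v f) := by
  refine AnalyticFun.ext fun x => ?_
  have key : ∀ v v' : AffV V, (dirDeriv v (dirDeriv v' f)).1 x =
      fderiv ℝ (fderiv ℝ (extendZero f.1)) x.1 v v' := by
    intro v v'
    rw [dirDeriv_val, (extendZero_dirDeriv_eventuallyEq v' f x.2).fderiv_eq]
    rw [fderiv_clm_apply (f.2.fderiv x.1 x.2).differentiableAt (differentiableAt_const _)]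
    simp
  rw [key, key]
  refine ContDiffAt.isSymmSndFDerivAt (n := 2) (f.2 x.1 x.2).contDiffAt ?_ v v'
  simp

theorem iteratedFDeriv_extendZero (f : AnalyticFun V) (y : AffV V) (n : ℕ) {x : AffV V}
    (hx : x ∈ VPlus V) :
    iteratedFDeriv ℝ n (extendZero f.1) x (fun _ => y) =
      extendZero (((dirDeriv y)^[n] f).1) x := by
  induction n generalizing x with
  | zero => simp
  | succ n ih =>
    have h1 : DifferentiableAt ℝ (iteratedFDeriv ℝ n (extendZero f.1)) x :=
      ((f.2.iteratedFDeriv n) x hx).differentiableAt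
    rw [h1.iteratedFDeriv_succ_apply_left', Function.iterate_succ_apply',
      extendZero_dirDeriv _ _ hx]
    congr 1
    refine Filter.EventuallyEq.fderiv_eq ?_
    filter_upwards [isOpen_VPlus.mem_nhds hx] with z hz using ih hz

/-- An analytic function all of whose derivatives vanish at a point is zero. -/
theorem eq_zero_of_derivatives (f : AnalyticFun V) (x : VPlus V)
    (h : ∀ (y : AffV V) (n : ℕ), ((dirDeriv y)^[n] f).1 x = 0) : f = 0 := by
  obtain ⟨p, r, hp⟩ := f.2 x.1 x.2
  have h1 : extendZero f.1 =ᶠ[𝓝 x.1] 0 := by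
    filter_upwards [Metric.eball_mem_nhds x.1 hp.r_pos] with z hz
    -- The Taylor series at `x` evaluated at `z` involves only repeated derivatives in the single
    -- direction `z - x`.
    have hy : z - x.1 ∈ Metric.eball (0 : AffV V) r := by
      rwa [Metric.mem_eball, edist_zero_right, ← edist_eq_enorm_sub, ← Metric.mem_eball]
    have h2 := hp.hasSum_iteratedFDeriv hy
    rw [add_sub_cancel] at h2
    have h3 : ∀ n : ℕ, ((n.factorial : ℝ)⁻¹ • iteratedFDeriv ℝ n (extendZero f.1) x.1
        fun _ => z - x.1) = 0 := by
      intro n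
      rw [iteratedFDeriv_extendZero f _ n x.2, extendZero_coe, h, smul_zero]
    simp only [h3] at h2
    exact h2.unique hasSum_zero
  have h2 := f.2.eqOn_zero_of_preconnected_of_eventuallyEq_zero convex_VPlus.isPreconnected x.2 h1
  refine AnalyticFun.ext fun y => ?_
  rw [← extendZero_coe f.1 y, h2 y.2]
  rfl

end Analytic

namespace AffineDatum

section Operators

variable {ι V : Type*} [NormedAddCommGroup V] [InnerProductSpace ℝ V] {D : AffineDatum ι V}

theorem map_coroot (w : D.extWeyl) (a : AffV V) : w.1 (coroot a) = coroot (w.1 a) := by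
  rw [coroot, coroot, map_smul, D.form_extWeyl]

theorem form_coroot_self (a : D.affRoots) : form a.1 (coroot a.1) = 2 := by
  rw [form_coroot, div_mul_cancel₀ _ (form_self_pos a.2).ne']

variable [FiniteDimensional ℝ V]

theorem act_val (w : D.extWeyl) (f : AnalyticFun V) (x : VPlus V) :
    (act w f).1 x = f.1 ⟨w⁻¹.1 x.1, extWeyl_mem_VPlus w⁻¹ x.2⟩ := rfl

theorem act_mul (w w' : D.extWeyl) (f : AnalyticFun V) : act (w * w') f = act w (act w' f) := by
  refine AnalyticFun.ext fun x => ?_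
  simp only [act_val, mul_inv_rev, mul_val_apply]

theorem act_one (f : AnalyticFun V) : act (1 : D.extWeyl) f = f := by
  refine AnalyticFun.ext fun x => ?_
  simp only [act_val, inv_one, one_val_apply]

theorem extendZero_act (w : D.extWeyl) (f : AnalyticFun V) (x : AffV V) :
    extendZero (act w f).1 x = extendZero f.1 (w⁻¹.1 x) := by
  by_cases hx : x ∈ VPlus V
  · rw [extendZero_apply _ hx, extendZero_apply _ (extWeyl_mem_VPlus w⁻¹ hx)]
    rfl
  · have hx' : w⁻¹.1 x ∉ VPlus V := fun h => hx (by
      simpa [val_inv_apply] using extWeyl_mem_VPlus w h)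
    have h0 : ∀ {g : VPlus V → ℂ} {y : AffV V}, y ∉ VPlus V → extendZero g y = 0 :=
      fun hy => Function.extend_apply' _ _ _ (by rintro ⟨z, rfl⟩; exact hy z.2)
    rw [h0 hx, h0 hx']

theorem act_dirDeriv (w : D.extWeyl) (v : AffV V) (f : AnalyticFun V) :
    act w (dirDeriv v f) = dirDeriv (w.1 v) (act w f) := by
  refine AnalyticFun.ext fun x => ?_
  change lineDeriv ℝ (extendZero f.1) (w⁻¹.1 x.1) v = lineDeriv ℝ (extendZero (act w f).1) x.1 _
  simp only [lineDeriv, extendZero_act, map_add, map_smul, inv_val_apply]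

theorem intRefl_val (a : D.affRoots) (f : AnalyticFun V) (x : VPlus V) :
    (intRefl a f).1 x =
      ∫ t in (0 : ℝ)..form a.1 x.1, extendZero f.1 (x.1 - t • coroot a.1) := rfl

theorem intRefl_val_eq_zero (a : D.affRoots) (f : AnalyticFun V) {x : VPlus V}
    (h : form a.1 x.1 = 0) : (intRefl a f).1 x = 0 := by
  rw [intRefl_val, h, intervalIntegral.integral_same]

theorem act_intRefl (w : D.extWeyl) (a : D.affRoots) (f : AnalyticFun V) :
    act w (intRefl a f) = intRefl (mapRoot w a) (act w f) := by
  refine AnalyticFun.ext fun x => ?_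
  rw [act_val, intRefl_val, intRefl_val]
  simp only [extendZero_act, map_sub, map_smul]
  change _ = ∫ t in (0 : ℝ)..form (w.1 a.1) x.1,
    extendZero f.1 (w⁻¹.1 x.1 - t • w⁻¹.1 (coroot (w.1 a.1)))
  rw [form_val_left, map_coroot, inv_val_apply]

theorem hasDerivAt_line (f : AnalyticFun V) (x v : AffV V) (s : ℝ) (h : x + s • v ∈ VPlus V) :
    HasDerivAt (fun s : ℝ => extendZero f.1 (x + s • v)) (extendZero (dirDeriv v f).1 (x + s • v))
      s := by
  rw [extendZero_dirDeriv v f h]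
  have h1 := (differentiableAt_extendZero f ⟨_, h⟩).hasFDerivAt
  have h2 : HasDerivAt (fun s : ℝ => x + s • v) v s := by
    simpa using ((hasDerivAt_id s).smul_const v).const_add x
  exact h1.comp_hasDerivAt s h2

theorem extendZero_intRefl (a : D.affRoots) (f : AnalyticFun V) {x : AffV V} (hx : x ∈ VPlus V) :
    extendZero (intRefl a f).1 x =
      ∫ t in (0 : ℝ)..form a.1 x, extendZero f.1 (x - t • coroot a.1) := by
  rw [extendZero_apply _ hx, intRefl_val]

/-- The derivative of `I(a)f` in the direction of `a^∨`. -/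
theorem intRefl_dirDeriv_coroot (a : D.affRoots) (f : AnalyticFun V) :
    intRefl a (dirDeriv (coroot a.1) f) + dirDeriv (coroot a.1) (intRefl a f) = (2 : ℂ) • f := by
  refine AnalyticFun.ext fun x => ?_
  set A := form a.1 x.1 with hA
  set G : ℝ → ℂ := fun t => extendZero f.1 (x.1 - t • coroot a.1) with hG
  have hGc : Continuous G := continuous_extendZero_line f a x
  have hGd : ∀ t, HasDerivAt G (-extendZero (dirDeriv (coroot a.1) f).1 (x.1 - t • coroot a.1))
      t := by
    intro t
    have h1 := hasDerivAt_line f x.1 (coroot a.1) (-t) (by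
      rw [neg_smul, ← sub_eq_add_neg]; exact sub_coroot_mem a t x.2)
    have h2 := h1.scomp t (hasDerivAt_neg t)
    convert! h2 using 1
    · funext s
      simp [hG, sub_eq_add_neg]
    · simp [sub_eq_add_neg]
  -- The derivative along `a^∨` is `-d/dt` on the line of integration, so the integral telescopes.
  have h1 : (intRefl a (dirDeriv (coroot a.1) f)).1 x = G 0 - G A := by
    have h2 := intervalIntegral.integral_eq_sub_of_hasDerivAt (a := 0) (b := A)
      (fun t _ => hGd t) (((continuous_extendZero_line _ a x).neg).intervalIntegrable _ _)
    rw [intervalIntegral.integral_neg] at h2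
    rw [intRefl_val, ← hA, ← neg_sub, ← h2, neg_neg]
  have h2 : (dirDeriv (coroot a.1) (intRefl a f)).1 x = G A + G 0 := by
    change lineDeriv ℝ (extendZero (intRefl a f).1) x.1 (coroot a.1) = _
    -- Because `(a, a^∨) = 2`, moving `x` by `s a^∨` turns the interval `[0, A]` into `[-s, A + s]`
    -- for the fixed integrand `G`; both endpoints contribute to the derivative.
    have h3 : ∀ s : ℝ, extendZero (intRefl a f).1 (x.1 + s • coroot a.1) =
        (∫ t in (0 : ℝ)..(A + s), G t) - ∫ t in (0 : ℝ)..(-s), G t := by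
      intro s
      have hs : x.1 + s • coroot a.1 ∈ VPlus V := by
        have := sub_coroot_mem a (-s) x.2
        rwa [neg_smul, sub_neg_eq_add] at this
      rw [extendZero_intRefl a f hs]
      have e : ∀ t : ℝ, extendZero f.1 (x.1 + s • coroot a.1 - t • coroot a.1) = G (t - s) := by
        intro t
        simp only [hG]
        congr 1
        module
      simp only [e]
      rw [intervalIntegral.integral_comp_sub_right, map_add, map_smul, form_coroot_self, ← hA,
        intervalIntegral.integral_interval_sub_left (hGc.intervalIntegrable _ _)
          (hGc.intervalIntegrable _ _)]
      congr 1
      · ring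
      · simp only [smul_eq_mul]; ring
    simp only [lineDeriv, h3]
    have h4 : HasDerivAt (fun s : ℝ => ∫ t in (0 : ℝ)..(A + s), G t) (G A) 0 := by
      have h5 := intervalIntegral.integral_hasDerivAt_right (a := 0) (b := A + 0)
        (hGc.intervalIntegrable _ _) (hGc.stronglyMeasurableAtFilter _ _) hGc.continuousAt
      have h6 := h5.scomp (0 : ℝ) ((hasDerivAt_id (0 : ℝ)).const_add A)
      simpa [Function.comp_def] using h6
    have h5 : HasDerivAt (fun s : ℝ => ∫ t in (0 : ℝ)..(-s), G t) (-G 0) 0 := by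
      have h5 := intervalIntegral.integral_hasDerivAt_right (a := 0) (b := -0)
        (hGc.intervalIntegrable _ _) (hGc.stronglyMeasurableAtFilter _ _) hGc.continuousAt
      have h6 := h5.scomp (0 : ℝ) (hasDerivAt_neg (0 : ℝ))
      simpa [Function.comp_def] using h6
    rw [(h4.fun_sub h5).deriv, sub_neg_eq_add]
  rw [AnalyticFun.val_add, Pi.add_apply, h1, h2, AnalyticFun.val_smul, Pi.smul_apply]
  have h3 : G 0 = f.1 x := by simp [hG, extendZero_coe]
  rw [h3, smul_eq_mul]
  ring

/-- The operator `I(a)` commutes with the derivatives along the hyperplane `(a, x) = 0`. -/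
theorem intRefl_dirDeriv_of_form_eq_zero (a : D.affRoots) (f : AnalyticFun V) {v : AffV V}
    (hv : form a.1 v = 0) : intRefl a (dirDeriv v f) = dirDeriv v (intRefl a f) := by
  refine AnalyticFun.ext fun x => ?_
  change _ = lineDeriv ℝ (extendZero (intRefl a f).1) x.1 v
  have hnear : ∀ᶠ s : ℝ in 𝓝 0, x.1 + s • v ∈ VPlus V := by
    have : Continuous fun s : ℝ => x.1 + s • v := by fun_prop
    exact this.continuousAt.preimage_mem_nhds (isOpen_VPlus.mem_nhds (by simp))
  obtain ⟨ε, hε, hball⟩ := Metric.eventually_nhds_iff_ball.1 hnear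
  have hmem : ∀ s ∈ Metric.closedBall (0 : ℝ) (ε / 2), ∀ t : ℝ,
      x.1 - t • coroot a.1 + s • v ∈ VPlus V := by
    intro s hs t
    have h1 := hball s (Metric.closedBall_subset_ball (by linarith) hs)
    have := sub_coroot_mem a t h1
    convert! this using 1
    module
  have hcont : ContinuousOn (fun q : ℝ × ℝ => extendZero (dirDeriv v f).1
      (x.1 - q.2 • coroot a.1 + q.1 • v))
      (Metric.closedBall (0 : ℝ) (ε / 2) ×ˢ Set.uIcc 0 (form a.1 x.1)) :=
    (dirDeriv v f).2.continuousOn.comp (by fun_prop) fun q hq => hmem q.1 hq.1 q.2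
  -- Compactness supplies the uniform bound needed to differentiate under the integral; the limits
  -- do not move since `(a, v) = 0`.
  obtain ⟨B, hB⟩ := ((isCompact_closedBall _ _).prod isCompact_uIcc).exists_bound_of_continuousOn
    hcont
  have hline : ∀ (g : AnalyticFun V), ∀ s ∈ Metric.closedBall (0 : ℝ) (ε / 2),
      Continuous fun t : ℝ => extendZero g.1 (x.1 - t • coroot a.1 + s • v) := by
    intro g s hs
    exact g.2.continuousOn.comp_continuous (by fun_prop) fun t => hmem s hs t
  have hnhds : Metric.closedBall (0 : ℝ) (ε / 2) ∈ 𝓝 (0 : ℝ) :=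
    Metric.closedBall_mem_nhds _ (by positivity)
  have h0 : (0 : ℝ) ∈ Metric.closedBall (0 : ℝ) (ε / 2) := mem_of_mem_nhds hnhds
  have key := (intervalIntegral.hasDerivAt_integral_of_dominated_loc_of_deriv_le
    (μ := MeasureTheory.volume) (a := 0) (b := form a.1 x.1) (bound := fun _ => B)
    (F := fun s t => extendZero f.1 (x.1 - t • coroot a.1 + s • v))
    (F' := fun s t => extendZero (dirDeriv v f).1 (x.1 - t • coroot a.1 + s • v))
    hnhds
    (by filter_upwards [hnhds] with s hs using (hline f s hs).aestronglyMeasurable)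
    ((hline f 0 h0).intervalIntegrable _ _)
    (hline _ 0 h0).aestronglyMeasurable
    (Filter.Eventually.of_forall fun t ht s hs => hB (s, t) ⟨hs, Set.uIoc_subset_uIcc ht⟩)
    intervalIntegrable_const
    (Filter.Eventually.of_forall fun t _ s hs => hasDerivAt_line f _ v s (hmem s hs t))).2
  have heq : (fun s : ℝ => extendZero (intRefl a f).1 (x.1 + s • v)) =ᶠ[𝓝 0]
      fun s => ∫ t in (0 : ℝ)..form a.1 x.1, extendZero f.1 (x.1 - t • coroot a.1 + s • v) := by
    filter_upwards [hnear] with s hs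
    rw [extendZero_intRefl a f hs, map_add, map_smul, hv, smul_zero, add_zero]
    refine intervalIntegral.integral_congr fun t _ => ?_
    congr 1
    module
  rw [lineDeriv, heq.deriv_eq, key.deriv, intRefl_val]
  simp

/-- Split `v` into a vector of the hyperplane of `a` and a multiple of `a^∨`; the two cases are the
preceding lemmas. This is the source of the cross relation for integral-reflection operators. -/
theorem intRefl_dirDeriv (a : D.affRoots) (v : AffV V) (f : AnalyticFun V) :
    intRefl a (dirDeriv v f) = dirDeriv (refl a.1 v) (intRefl a f) + ((form a.1 v : ℝ) : ℂ) • f := by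
  set r : ℝ := form a.1 v / 2 with hr
  set p : AffV V := v - r • coroot a.1 with hp
  have hp0 : form a.1 p = 0 := by
    rw [hp, map_sub, map_smul, form_coroot_self, smul_eq_mul, hr]; ring
  have e1 : v = p + r • coroot a.1 := by rw [hp]; module
  have e2 : refl a.1 v = p + (-r) • coroot a.1 := by
    rw [hp, refl_apply, form_coroot, form_comm v, hr, coroot]
    module
  have e3 : ((form a.1 v : ℝ) : ℂ) = (r : ℂ) * 2 := by rw [hr]; push_cast; ring
  rw [e2, e3]
  conv_lhs => rw [e1]
  rw [dirDeriv_add, dirDeriv_add, dirDeriv_smul, dirDeriv_smul, LinearMap.add_apply,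
    LinearMap.add_apply, LinearMap.smul_apply, LinearMap.smul_apply, map_add, map_smul,
    intRefl_dirDeriv_of_form_eq_zero a f hp0, mul_smul, ← intRefl_dirDeriv_coroot a f]
  push_cast
  module

end Operators

/-! ### The Dunkl operators -/

section Dunkl

variable {ι V M : Type*} [NormedAddCommGroup V] [InnerProductSpace ℝ V] [FiniteDimensional ℝ V]
  {D : AffineDatum ι V} [AddCommGroup M] [Module ℂ M] (ρ : Representation ℂ D.extWeyl M)

theorem actTensor_mul (w w' : D.extWeyl) (z : AnalyticFun V ⊗[ℂ] M) :
    actTensor ρ (w * w') z = actTensor ρ w (actTensor ρ w' z) := by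
  induction z using TensorProduct.induction_on with
  | zero => simp
  | tmul f m => simp [actTensor, act_mul]
  | add x y hx hy => simp only [map_add, hx, hy]

theorem actTensor_one (z : AnalyticFun V ⊗[ℂ] M) : actTensor ρ 1 z = z := by
  induction z using TensorProduct.induction_on with
  | zero => simp
  | tmul f m => simp [actTensor, act_one]
  | add x y hx hy => simp only [map_add, hx, hy]

theorem actTensor_injective (w : D.extWeyl) : Function.Injective (actTensor ρ w) :=
  Function.LeftInverse.injective (g := actTensor ρ w⁻¹) fun z => by
    rw [← actTensor_mul, inv_mul_cancel, actTensor_one]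

theorem actTensor_derivTensor (w : D.extWeyl) (v : AffV V) (z : AnalyticFun V ⊗[ℂ] M) :
    actTensor ρ w (derivTensor v z) = derivTensor (w.1 v) (actTensor ρ w z) := by
  induction z using TensorProduct.induction_on with
  | zero => simp
  | tmul f m => simp [actTensor, derivTensor, act_dirDeriv]
  | add x y hx hy => simp only [map_add, hx, hy]

theorem derivTensor_add (v v' : AffV V) :
    (derivTensor (v + v') : AnalyticFun V ⊗[ℂ] M →ₗ[ℂ] _) = derivTensor v + derivTensor v' := by
  rw [derivTensor, dirDeriv_add, TensorProduct.map_add_left]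
  rfl

theorem derivTensor_smul (r : ℝ) (v : AffV V) :
    (derivTensor (r • v) : AnalyticFun V ⊗[ℂ] M →ₗ[ℂ] _) = (r : ℂ) • derivTensor v := by
  rw [derivTensor, dirDeriv_smul, TensorProduct.map_smul_left]
  rfl

theorem derivTensor_comm (v v' : AffV V) (z : AnalyticFun V ⊗[ℂ] M) :
    derivTensor v (derivTensor v' z) = derivTensor v' (derivTensor v z) := by
  induction z using TensorProduct.induction_on with
  | zero => simp
  | tmul f m => simp [derivTensor, dirDeriv_comm v v']
  | add x y hx hy => simp only [map_add, hx, hy]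

theorem actF_apply (w : D.extWeyl) (f : FSpace D M) (C : D.Chamber) :
    actF ρ w f C = actTensor ρ w (f (C.move w⁻¹)) := rfl

theorem actF_mul (w w' : D.extWeyl) (f : FSpace D M) :
    actF ρ (w * w') f = actF ρ w (actF ρ w' f) := by
  funext C
  simp only [actF_apply, actTensor_mul, move_move, mul_inv_rev]

theorem actF_one (f : FSpace D M) : actF ρ 1 f = f := by
  funext C
  rw [actF_apply, actTensor_one, inv_one, move_one]

variable (κ : D.Multiplicity)

/-- The contribution of the affine root `a` to the Dunkl operator. -/
def dunklTerm (v : AffV V) (f : FSpace D M) (C : D.Chamber) (a : D.affRoots) :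
    AnalyticFun V ⊗[ℂ] M :=
  (κ.k a * (form a.1 v : ℝ) * chi a.1 C) • actF ρ (D.s a) f C

/-- The permutation of the affine roots given by an element of the extended affine Weyl group. -/
def mapRootEquiv (w : D.extWeyl) : D.affRoots ≃ D.affRoots where
  toFun := mapRoot w
  invFun := mapRoot w⁻¹
  left_inv a := Subtype.ext (inv_val_apply w a.1)
  right_inv a := Subtype.ext (val_inv_apply w a.1)

/-- Conjugation by `w` carries the term of `a` to the term of `w a`, so a Dunkl operator fails to be
equivariant only where `w` changes the positivity of a root. -/
theorem actTensor_dunklTerm (w : D.extWeyl) (v : AffV V) (f : FSpace D M) (C : D.Chamber)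
    (a : D.affRoots) : actTensor ρ w (dunklTerm ρ κ v f (C.move w⁻¹) a) =
      dunklTerm ρ κ (w.1 v) (actF ρ w f) C (mapRoot w a) := by
  have h1 : actTensor ρ w (actF ρ (D.s a) f (C.move w⁻¹)) =
      actF ρ (D.s (mapRoot w a)) (actF ρ w f) C := by
    rw [← actF_mul, ← s_mul_eq, actF_mul]
    rfl
  rw [dunklTerm, dunklTerm, map_smul, h1, κ.invariant w a (mapRoot w a) rfl, chi_move, inv_inv]
  change _ = (_ * ((form (w.1 a.1) (w.1 v) : ℝ) : ℂ) * _) • _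
  rw [D.form_extWeyl]
  rfl

variable [Finite ι]

theorem dunkl_apply (v : AffV V) (f : FSpace D M) (C : D.Chamber) :
    dunkl κ ρ v f C = derivTensor v (f C) -
      ∑ a ∈ (finite_chi_ne_zero C).toFinset, dunklTerm ρ κ v f C a := by
  simp [dunkl, dunklTerm, LinearMap.sum_apply]

open Classical in
theorem support_dunklTerm_subset (v : AffV V) (f : FSpace D M) (C : D.Chamber) :
    Function.support (fun a : D.affRoots => if a.1 ∈ D.posAffRoots then dunklTerm ρ κ v f C a
      else 0) ⊆ (finite_chi_ne_zero C).toFinset := by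
  intro a ha
  rw [Function.mem_support, ne_eq, ite_eq_right_iff, Classical.not_imp] at ha
  rw [Set.Finite.coe_toFinset]
  exact ⟨ha.1, fun h => ha.2 (by simp [dunklTerm, h])⟩

-- With the sum taken over all affine roots, the index set depends on neither the chamber nor
-- positivity and can be permuted by the group.
open Classical in
theorem dunkl_apply_finsum (v : AffV V) (f : FSpace D M) (C : D.Chamber) :
    dunkl κ ρ v f C = derivTensor v (f C) -
      ∑ᶠ a : D.affRoots, if a.1 ∈ D.posAffRoots then dunklTerm ρ κ v f C a else 0 := by
  rw [dunkl_apply, finsum_eq_sum_of_support_subset _ (support_dunklTerm_subset ρ κ v f C)]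
  congr 1
  refine Finset.sum_congr rfl fun a ha => ?_
  rw [Set.Finite.mem_toFinset] at ha
  rw [if_pos ha.1]

theorem dunkl_add (v v' : AffV V) : dunkl κ ρ (v + v') = dunkl κ ρ v + dunkl κ ρ v' := by
  refine LinearMap.ext fun f => funext fun C => ?_
  rw [LinearMap.add_apply, Pi.add_apply, dunkl_apply, dunkl_apply, dunkl_apply, derivTensor_add,
    LinearMap.add_apply, sub_add_sub_comm, ← Finset.sum_add_distrib]
  congr 1
  refine Finset.sum_congr rfl fun a _ => ?_
  rw [dunklTerm, dunklTerm, dunklTerm, ← add_smul, map_add]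
  push_cast
  congr 1
  ring

theorem dunkl_smul (r : ℝ) (v : AffV V) : dunkl κ ρ (r • v) = (r : ℂ) • dunkl κ ρ v := by
  refine LinearMap.ext fun f => funext fun C => ?_
  rw [LinearMap.smul_apply, Pi.smul_apply, dunkl_apply, dunkl_apply, derivTensor_smul,
    LinearMap.smul_apply, smul_sub, Finset.smul_sum]
  congr 1
  refine Finset.sum_congr rfl fun a _ => ?_
  rw [dunklTerm, dunklTerm, smul_smul, map_smul, smul_eq_mul]
  push_cast
  congr 1
  ring

/-- No positive affine root is negative on the fundamental chamber. This is the base case of the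
inductions over chambers. -/
theorem dunkl_fundCh (v : AffV V) (f : FSpace D M) :
    dunkl κ ρ v f D.fundCh = derivTensor v (f D.fundCh) := by
  rw [dunkl_apply, Finset.sum_eq_zero, sub_zero]
  intro a ha
  rw [Set.Finite.mem_toFinset] at ha
  exact absurd (chi_fundCh_of_pos ha.1) ha.2

open Classical in
theorem actF_dunkl (w : D.extWeyl) (v : AffV V) (f : FSpace D M) (C : D.Chamber) :
    actF ρ w (dunkl κ ρ v f) C = derivTensor (w.1 v) (actF ρ w f C) -
      ∑ᶠ e : D.affRoots, if (mapRoot w⁻¹ e).1 ∈ D.posAffRoots then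
        dunklTerm ρ κ (w.1 v) (actF ρ w f) C e else 0 := by
  rw [actF_apply, dunkl_apply_finsum, map_sub, actTensor_derivTensor, ← actF_apply]
  congr 1
  refine ((actTensor ρ w).toAddMonoidHom.map_finsum (Set.Finite.subset (Finset.finite_toSet _)
    (support_dunklTerm_subset ρ κ v f (C.move w⁻¹)))).trans ?_
  refine (finsum_congr fun a => ?_).trans (finsum_comp_equiv (mapRootEquiv w))
  have : mapRoot w⁻¹ (mapRootEquiv w a) = a := (mapRootEquiv w).left_inv a
  rw [this]
  change actTensor ρ w (ite _ _ _) = _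
  rw [apply_ite (actTensor ρ w), map_zero, actTensor_dunklTerm]
  rfl

theorem actF_dunkl_of_mem_Omega {w : D.extWeyl} (hw : w ∈ D.Ω) (v : AffV V) (f : FSpace D M) :
    actF ρ w (dunkl κ ρ v f) = dunkl κ ρ (w.1 v) (actF ρ w f) := by
  funext C
  rw [actF_dunkl, dunkl_apply_finsum]
  congr 1
  refine finsum_congr fun e => ?_
  have : (mapRoot w⁻¹ e).1 ∈ D.posAffRoots ↔ e.1 ∈ D.posAffRoots := by
    refine ⟨fun h => ?_, fun h => Omega_inv hw _ h⟩
    have := hw _ h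
    change w.1 (w⁻¹.1 e.1) ∈ _ at this
    rwa [val_inv_apply] at this
  classical exact if_congr this rfl rfl

/-- The roots made positive by `s_a` are the positive ones with `a` replaced by `-a`. The difference
of these two terms is a multiple of `s_a s_a f = f`, and the coefficients add up because `χ_a +
χ_{-a} = 1`. -/
theorem actF_s_dunkl (a : D.SimpleRoot) (v : AffV V) (f : FSpace D M) :
    actF ρ (D.s a.1) (dunkl κ ρ v f) = dunkl κ ρ (refl a.1.1 v) (actF ρ (D.s a.1) f) -
      (κ.k a.1 * (form a.1.1 v : ℝ)) • f := by
  classical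
  funext C
  rw [Pi.sub_apply, Pi.smul_apply, actF_dunkl, dunkl_apply_finsum, sub_sub, s_val, s_inv]
  congr 1
  set T := dunklTerm ρ κ (refl a.1.1 v) (actF ρ (D.s a.1) f) C with hT
  let n : D.affRoots := ⟨-a.1.1, neg_mem_affRoots a.1.2⟩
  have hpa := pos_of_simple a.2
  have hna : n ≠ a.1 := fun h => not_neg_of_pos hpa (by
    have : -a.1.1 = a.1.1 := congrArg Subtype.val h
    rwa [this])
  have hsn : D.s n = D.s a.1 := s_congr (Or.inr rfl)
  have hk : κ.k n = κ.k a.1 := κ.invariant (D.s a.1) _ _ (by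
    rw [s_val, map_neg, refl_self a.1.2, neg_neg])
  have hfv : form a.1.1 (refl a.1.1 v) = -form a.1.1 v := by
    rw [← form_refl_left, refl_self a.1.2, map_neg, LinearMap.neg_apply]
  have hTa : T n - T a.1 = (κ.k a.1 * (form a.1.1 v : ℝ)) • f C := by
    have h1 : actF ρ (D.s a.1) (actF ρ (D.s a.1) f) = f := by
      rw [← actF_mul, s_mul_s, actF_one]
    simp only [hT, dunklTerm, hsn, h1, hk, n]
    rw [← sub_smul, map_neg, LinearMap.neg_apply, hfv]
    have h2 := chi_add_chi_neg a.1.2 C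
    congr 1
    push_cast
    linear_combination (κ.k a.1 * (form a.1.1 v : ℝ)) * h2
  -- The exchange of `a` and `-a` is stated termwise with sums only, so that both sides can be
  -- summed over all roots.
  have hpt : ∀ e : D.affRoots, (if (mapRoot (D.s a.1) e).1 ∈ D.posAffRoots then T e else 0) +
      (if e = a.1 then T a.1 else 0) = (if e.1 ∈ D.posAffRoots then T e else 0) +
      (if e = n then T n else 0) := by
    intro e
    by_cases h1 : e = a.1
    · subst h1
      have h2 : (mapRoot (D.s a.1) a.1).1 = -a.1.1 := refl_self a.1.2
      rw [h2, if_neg (not_neg_of_pos hpa), if_pos rfl, if_pos hpa, if_neg hna.symm, add_comm]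
    by_cases h2 : e = n
    · subst h2
      have h3 : (mapRoot (D.s a.1) n).1 = a.1.1 := by
        change refl a.1.1 (-a.1.1) = _
        rw [map_neg, refl_self a.1.2, neg_neg]
      rw [h3, if_pos hpa, if_neg hna, if_neg (not_neg_of_pos hpa), if_pos rfl, add_comm]
    · have h3 : (mapRoot (D.s a.1) e).1 ∈ D.posAffRoots ↔ e.1 ∈ D.posAffRoots :=
        refl_pos_iff a.2 (fun h => h1 (Subtype.ext h)) (fun h => h2 (Subtype.ext h))
      rw [if_neg h1, if_neg h2]
      rw [add_zero, add_zero]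
      exact if_congr h3 rfl rfl
  have hP : (Function.support fun e : D.affRoots =>
      if e.1 ∈ D.posAffRoots then T e else 0).Finite :=
    Set.Finite.subset (Finset.finite_toSet _) (support_dunklTerm_subset ρ κ _ _ C)
  have hsingle : ∀ b : D.affRoots, (Function.support fun e : D.affRoots =>
      if e = b then T b else 0).Finite := fun b =>
    (Set.finite_singleton b).subset fun e he => by
      by_contra h
      exact he (if_neg h)
  have hQ : (Function.support fun e : D.affRoots =>
      if (mapRoot (D.s a.1) e).1 ∈ D.posAffRoots then T e else 0).Finite := by
    refine ((hP.union (hsingle n)).union (hsingle a.1)).subset fun e he => ?_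
    by_contra h
    simp only [Set.mem_union, Function.mem_support, not_or, not_not] at h
    have h4 := hpt e
    rw [h.1.1, h.1.2, h.2, add_zero, add_zero] at h4
    exact he h4
  have hfs : ∀ b : D.affRoots, (∑ᶠ e : D.affRoots, if e = b then T b else 0) = T b := by
    intro b
    rw [finsum_eq_single _ b fun e he => if_neg he, if_pos rfl]
  have hsum := finsum_congr hpt
  rw [finsum_add_distrib hQ (hsingle _), finsum_add_distrib hP (hsingle _), hfs, hfs] at hsum
  rw [← hTa, ← add_sub_assoc, ← hsum, add_sub_cancel_right]

/-- The step reflects `C` in a wall of the fundamental chamber, not of `C` itself; this is the form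
matching the cross relations, which hold for simple `a`. -/
theorem chamber_induction {p : D.Chamber → Prop} (h0 : p D.fundCh)
    (hs : ∀ (a : D.SimpleRoot) (C : D.Chamber), p C → p (C.move (D.s a.1))) (C : D.Chamber) :
    p C := by
  obtain ⟨l, rfl⟩ := exists_eq_move C
  induction l with
  | nil => rwa [word_nil, move_one]
  | cons a l ih =>
    rw [word_cons, ← move_move]
    exact hs a _ ih

/-- The Dunkl operators commute. -/
theorem dunkl_comm (v v' : AffV V) (f : FSpace D M) :
    dunkl κ ρ v (dunkl κ ρ v' f) = dunkl κ ρ v' (dunkl κ ρ v f) := by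
  funext C
  refine chamber_induction (p := fun C => ∀ v v' f, dunkl κ ρ v (dunkl κ ρ v' f) C =
    dunkl κ ρ v' (dunkl κ ρ v f) C) ?_ ?_ C v v' f
  · intro v v' f
    simp only [dunkl_fundCh]
    exact derivTensor_comm v v' _
  · intro a C ih v v' f
    refine actTensor_injective ρ (D.s a.1) ?_
    have h1 : ∀ g : FSpace D M, actTensor ρ (D.s a.1) (g (C.move (D.s a.1))) =
        actF ρ (D.s a.1) g C := by
      intro g
      rw [actF_apply, s_inv]
    have h2 : ∀ u : AffV V, dunkl κ ρ (refl a.1.1 u) f = dunkl κ ρ u f -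
        ((2 / form a.1.1 a.1.1 * form a.1.1 u : ℝ) : ℂ) • dunkl κ ρ a.1.1 f := by
      intro u
      rw [refl_apply, form_coroot, form_comm u, sub_eq_add_neg, ← neg_smul, dunkl_add, dunkl_smul]
      simp [sub_eq_add_neg]
    rw [h1, h1]
    -- After moving `s_a` inside, the second-order terms are compared on `C` by induction, and the
    -- first-order terms are symmetric in `v` and `v'` once `𝒟_{s_a u}` is expanded.
    simp only [actF_s_dunkl, map_sub, map_smul, Pi.sub_apply, Pi.smul_apply, h2]
    rw [ih]
    push_cast
    module

end Dunkl

/-! ### Homomorphisms from the Cherednik algebra -/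

section Universal

variable {ι V : Type*} [NormedAddCommGroup V] [InnerProductSpace ℝ V] {D : AffineDatum ι V}
  (κ : D.Multiplicity)

theorem CherednikAlg.vec_add (v v' : CAffV V) :
    CherednikAlg.vec κ (v + v') = CherednikAlg.vec κ v + CherednikAlg.vec κ v' := by
  simpa [CherednikAlg.vec] using RingQuot.mkAlgHom_rel ℂ (Rel.add (κ := κ) v v')

theorem CherednikAlg.vec_smul (r : ℂ) (v : CAffV V) :
    CherednikAlg.vec κ (r • v) = r • CherednikAlg.vec κ v := by
  simpa [CherednikAlg.vec] using RingQuot.mkAlgHom_rel ℂ (Rel.smul (κ := κ) r v)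

theorem CherednikAlg.grp_one : CherednikAlg.grp κ 1 = 1 := by
  simpa [CherednikAlg.grp] using RingQuot.mkAlgHom_rel ℂ (Rel.one (κ := κ))

theorem CherednikAlg.grp_mul (w w' : D.extWeyl) :
    CherednikAlg.grp κ (w * w') = CherednikAlg.grp κ w * CherednikAlg.grp κ w' := by
  simpa [CherednikAlg.grp] using RingQuot.mkAlgHom_rel ℂ (Rel.mul (κ := κ) w w')

theorem CherednikAlg.induction {p : CherednikAlg κ → Prop}
    (hvec : ∀ v : AffV V, p (CherednikAlg.vec κ (1 ⊗ₜ[ℝ] v)))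
    (hgrp : ∀ w, p (CherednikAlg.grp κ w)) (hscalar : ∀ r : ℂ, p (algebraMap ℂ _ r))
    (hadd : ∀ x y, p x → p y → p (x + y)) (hmul : ∀ x y, p x → p y → p (x * y))
    (h : CherednikAlg κ) : p h := by
  obtain ⟨h, rfl⟩ := RingQuot.mkAlgHom_surjective ℂ (Rel κ) h
  induction h using FreeAlgebra.induction with
  | grade0 r => rw [AlgHom.commutes]; exact hscalar r
  | grade1 g =>
    rcases g with v | w
    · change p (CherednikAlg.vec κ v)
      induction v using TensorProduct.induction_on with
      | zero =>
        have h0 := CherednikAlg.vec_smul κ 0 0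
        rw [zero_smul, zero_smul] at h0
        rw [h0, ← map_zero (algebraMap ℂ _)]
        exact hscalar 0
      | tmul z v =>
        have h1 : z ⊗ₜ[ℝ] v = z • ((1 : ℂ) ⊗ₜ[ℝ] v) := by
          rw [TensorProduct.smul_tmul', smul_eq_mul, mul_one]
        rw [h1, CherednikAlg.vec_smul, Algebra.smul_def]
        exact hmul _ _ (hscalar z) (hvec v)
      | add v v' h h' => rw [CherednikAlg.vec_add]; exact hadd _ _ h h'
    · exact hgrp w
  | mul x y hx hy => rw [map_mul]; exact hmul _ _ hx hy
  | add x y hx hy => rw [map_add]; exact hadd _ _ hx hy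

variable {κ} {A : Type*} [Ring A] [Algebra ℂ A]

theorem CherednikAlg.hom_ext {φ ψ : CherednikAlg κ →ₐ[ℂ] A}
    (hvec : ∀ v : AffV V, φ (CherednikAlg.vec κ (1 ⊗ₜ[ℝ] v)) = ψ (CherednikAlg.vec κ (1 ⊗ₜ[ℝ] v)))
    (hgrp : ∀ w, φ (CherednikAlg.grp κ w) = ψ (CherednikAlg.grp κ w)) : φ = ψ := by
  refine AlgHom.ext fun h => ?_
  induction h using CherednikAlg.induction with
  | hvec v => exact hvec v
  | hgrp w => exact hgrp w
  | hscalar r => rw [AlgHom.commutes, AlgHom.commutes]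
  | hadd x y hx hy => rw [map_add, map_add, hx, hy]
  | hmul x y hx hy => rw [map_mul, map_mul, hx, hy]

/-- The relations need only be checked on real vectors: both sides are complex linear in each vector
argument, so pure tensors suffice. -/
theorem CherednikAlg.exists_hom (vec : AffV V → A) (grp : D.extWeyl → A)
    (hadd : ∀ v v', vec (v + v') = vec v + vec v')
    (hsmul : ∀ (r : ℝ) v, vec (r • v) = (r : ℂ) • vec v)
    (hcomm : ∀ v v', vec v * vec v' = vec v' * vec v)
    (hone : grp 1 = 1) (hmul : ∀ w w', grp (w * w') = grp w * grp w')
    (hrefl : ∀ (a : D.SimpleRoot) v, grp (D.s a.1) * vec v =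
      vec (refl a.1.1 v) * grp (D.s a.1) - algebraMap ℂ A (κ.k a.1 * (form a.1.1 v : ℝ)))
    (homega : ∀ w ∈ D.Ω, ∀ v, grp w * vec v = vec (w.1 v) * grp w) :
    ∃ φ : CherednikAlg κ →ₐ[ℂ] A, (∀ v : AffV V, φ (CherednikAlg.vec κ (1 ⊗ₜ[ℝ] v)) = vec v) ∧
      ∀ w, φ (CherednikAlg.grp κ w) = grp w := by
  let vecR : AffV V →ₗ[ℝ] A :=
    { toFun := vec
      map_add' := hadd
      map_smul' := fun r v => hsmul r v }
  let vecC : CAffV V →ₗ[ℂ] A := vecR.liftBaseChange ℂ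
  have hvecC : ∀ (z : ℂ) (v : AffV V), vecC (z ⊗ₜ[ℝ] v) = z • vec v := fun z v => by
    simp [vecC, vecR]
  let Φ : FreeAlgebra ℂ D.Gen →ₐ[ℂ] A := FreeAlgebra.lift ℂ fun g =>
    match g with
    | .vec v => vecC v
    | .grp w => grp w
  have hΦv : ∀ v, Φ (.ι ℂ (.vec v)) = vecC v := fun v => by simp [Φ]
  have hΦg : ∀ w, Φ (.ι ℂ (.grp w)) = grp w := fun w => by simp [Φ]
  have hΦ : ∀ ⦃x y⦄, Rel κ x y → Φ x = Φ y := by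
    intro x y h
    induction h with
    | add v v' => simp only [map_add, hΦv]
    | smul r v => simp only [map_smul, hΦv]
    | comm v v' =>
      simp only [map_mul, hΦv]
      induction v using TensorProduct.induction_on with
      | zero => simp
      | add x y hx hy => simp only [map_add, add_mul, mul_add, hx, hy]
      | tmul z v =>
        induction v' using TensorProduct.induction_on with
        | zero => simp
        | add x y hx hy => simp only [map_add, add_mul, mul_add, hx, hy]
        | tmul z' v' =>
          rw [hvecC, hvecC, smul_mul_smul_comm, smul_mul_smul_comm, hcomm, mul_comm z]
    | one => rw [hΦg, hone, map_one]
    | mul w w' => rw [map_mul, hΦg, hΦg, hΦg, hmul]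
    | cross_refl a ha v =>
      simp only [map_mul, map_sub, hΦv, hΦg, AlgHom.commutes]
      induction v using TensorProduct.induction_on with
      | zero => simp
      | add x y hx hy =>
        simp only [map_add, add_mul, mul_add, hx, hy]
        abel
      | tmul z v =>
        have h1 := hrefl ⟨a, ha⟩ v
        rw [LinearMap.baseChange_tmul, hvecC, hvecC, mul_smul_comm, h1, smul_sub,
          smul_mul_assoc, Algebra.smul_def z (algebraMap ℂ A _), ← map_mul, ← map_mul,
          LinearMap.BilinForm.baseChange_tmul]
        simp only [one_mul, Complex.real_smul]
        congr 2
        ring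
    | cross_omega w hw v =>
      simp only [map_mul, hΦv, hΦg]
      induction v using TensorProduct.induction_on with
      | zero => simp
      | add x y hx hy => simp only [map_add, add_mul, mul_add, hx, hy]
      | tmul z v =>
        rw [LinearMap.baseChange_tmul, hvecC, hvecC, mul_smul_comm, homega w hw, smul_mul_assoc]
        rfl
  refine ⟨RingQuot.liftAlgHom ℂ ⟨Φ, hΦ⟩, fun v => ?_, fun w => ?_⟩
  · rw [CherednikAlg.vec, RingQuot.liftAlgHom_mkAlgHom_apply, hΦv, hvecC, one_smul]
  · rw [CherednikAlg.grp, RingQuot.liftAlgHom_mkAlgHom_apply, hΦg]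

end Universal

/-! ### The representation by Dunkl operators -/

section DunklRep

variable {ι V M : Type*} [Finite ι] [NormedAddCommGroup V] [InnerProductSpace ℝ V]
  [FiniteDimensional ℝ V] {D : AffineDatum ι V} [AddCommGroup M] [Module ℂ M]
  (κ : D.Multiplicity) (ρ : Representation ℂ D.extWeyl M)

theorem existsUnique_dunklRep :
    ∃! π : CherednikAlg κ →ₐ[ℂ] Module.End ℂ (FSpace D M), IsDunklRep κ ρ π := by
  obtain ⟨π, h1, h2⟩ := CherednikAlg.exists_hom (κ := κ) (A := Module.End ℂ (FSpace D M))
    (dunkl κ ρ) (actF ρ) (dunkl_add ρ κ) (dunkl_smul ρ κ)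
    (fun v v' => LinearMap.ext (dunkl_comm ρ κ v v')) (LinearMap.ext (actF_one ρ))
    (fun w w' => LinearMap.ext (actF_mul ρ w w'))
    (fun a v => LinearMap.ext (actF_s_dunkl ρ κ a v))
    (fun w hw v => LinearMap.ext (actF_dunkl_of_mem_Omega ρ κ hw v))
  refine ⟨π, ⟨h2, h1⟩, fun π' h => CherednikAlg.hom_ext (fun v => ?_) fun w => ?_⟩
  · rw [h.vec, h1]
  · rw [h.grp, h2]

end DunklRep

/-! ### The integral-reflection operators -/

section IntegralReflection

variable {ι V M : Type*} [NormedAddCommGroup V] [InnerProductSpace ℝ V]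
  {D : AffineDatum ι V} [AddCommGroup M] [Module ℂ M]

/-- Evaluation of elements of `C^ω ⊗ M` at a point. -/
def evTensor (x : VPlus V) : AnalyticFun V ⊗[ℂ] M →ₗ[ℂ] M :=
  TensorProduct.lift (LinearMap.lsmul ℂ M ∘ₗ evalAt x)

theorem evTensor_tmul (x : VPlus V) (f : AnalyticFun V) (m : M) :
    evTensor x (f ⊗ₜ[ℂ] m) = f.1 x • m := rfl

variable [FiniteDimensional ℝ V]

/-- An element of `C^ω ⊗ M` all of whose derivatives vanish at a point is zero. -/
theorem eq_zero_of_evTensor (x : VPlus V) (z : AnalyticFun V ⊗[ℂ] M)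
    (h : ∀ (y : AffV V) (n : ℕ), evTensor x ((derivTensor y)^[n] z) = 0) : z = 0 := by
  classical
  -- Coordinates in a basis of `M` reduce the statement to scalar analytic functions.
  let b := Module.Basis.ofVectorSpace ℂ M
  let e := TensorProduct.equivFinsuppOfBasisRight (M := AnalyticFun V) b
  have h1 : ∀ (i) (z : AnalyticFun V ⊗[ℂ] M), (e z i).1 x = b.repr (evTensor x z) i := by
    intro i z
    induction z using TensorProduct.induction_on with
    | zero => simp [show (0 : AnalyticFun V).1 x = 0 from rfl]
    | tmul f m =>
      rw [evTensor_tmul, TensorProduct.equivFinsuppOfBasisRight_apply_tmul_apply,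
        AnalyticFun.val_smul, Pi.smul_apply, map_smul, Finsupp.smul_apply, smul_eq_mul,
        smul_eq_mul, mul_comm]
    | add z z' hz hz' =>
      rw [map_add, Finsupp.add_apply, AnalyticFun.val_add, Pi.add_apply, hz, hz', map_add,
        map_add, Finsupp.add_apply]
  have h2 : ∀ (i) (y : AffV V) (z : AnalyticFun V ⊗[ℂ] M),
      e (derivTensor y z) i = dirDeriv y (e z i) := by
    intro i y z
    induction z using TensorProduct.induction_on with
    | zero => simp
    | tmul f m =>
      change e (dirDeriv y f ⊗ₜ m) i = _
      rw [TensorProduct.equivFinsuppOfBasisRight_apply_tmul_apply,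
        TensorProduct.equivFinsuppOfBasisRight_apply_tmul_apply, map_smul]
    | add z z' hz hz' => simp only [map_add, Finsupp.add_apply, hz, hz']
  have h3 : ∀ (i) (y : AffV V) (n : ℕ),
      e ((derivTensor y)^[n] z) i = (dirDeriv y)^[n] (e z i) := by
    intro i y n
    induction n with
    | zero => rfl
    | succ n ih => rw [Function.iterate_succ_apply', Function.iterate_succ_apply', h2, ih]
  refine (LinearEquiv.map_eq_zero_iff e).1 (Finsupp.ext fun i => ?_)
  refine eq_zero_of_derivatives _ x fun y n => ?_
  rw [← h3, h1, h, map_zero]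
  rfl

variable (ρ : Representation ℂ D.extWeyl M) (κ : D.Multiplicity)

theorem evTensor_actTensor {x : VPlus V} {w : D.extWeyl} (h : w.1 x.1 = x.1)
    (z : AnalyticFun V ⊗[ℂ] M) : evTensor x (actTensor ρ w z) = ρ w (evTensor x z) := by
  have hx : (⟨w⁻¹.1 x.1, extWeyl_mem_VPlus w⁻¹ x.2⟩ : VPlus V) = x :=
    Subtype.ext ((congrArg w⁻¹.1 h.symm).trans (inv_val_apply w x.1))
  induction z using TensorProduct.induction_on with
  | zero => simp
  | tmul f m => rw [actTensor, TensorProduct.map_tmul, evTensor_tmul, evTensor_tmul, act_val, hx,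
      map_smul]
  | add z z' hz hz' => simp only [map_add, hz, hz']

/-- The integral operator on `C^ω ⊗ M`. -/
def intTensor (a : D.affRoots) : AnalyticFun V ⊗[ℂ] M →ₗ[ℂ] AnalyticFun V ⊗[ℂ] M :=
  TensorProduct.map (intRefl a) LinearMap.id

/-- On the wall of `a` the integration interval is degenerate, so there the integral-reflection
operator has the same value as `s_a`. -/
theorem evTensor_intTensor {x : VPlus V} {a : D.affRoots} (h : form a.1 x.1 = 0)
    (z : AnalyticFun V ⊗[ℂ] M) : evTensor x (intTensor a z) = 0 := by
  induction z using TensorProduct.induction_on with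
  | zero => simp
  | tmul f m => rw [intTensor, TensorProduct.map_tmul, evTensor_tmul, intRefl_val_eq_zero a f h,
      zero_smul]
  | add z z' hz hz' => simp only [map_add, hz, hz', add_zero]

theorem intTensor_derivTensor (a : D.affRoots) (v : AffV V) (z : AnalyticFun V ⊗[ℂ] M) :
    intTensor a (derivTensor v z) =
      derivTensor (refl a.1 v) (intTensor a z) + ((form a.1 v : ℝ) : ℂ) • z := by
  induction z using TensorProduct.induction_on with
  | zero => simp
  | tmul f m =>
    simp only [intTensor, derivTensor, TensorProduct.map_tmul, LinearMap.id_apply,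
      intRefl_dirDeriv, TensorProduct.add_tmul, TensorProduct.smul_tmul']
  | add z z' hz hz' =>
    simp only [map_add, hz, hz', smul_add]
    abel

theorem actTensor_intTensor (w : D.extWeyl) (a : D.affRoots) (z : AnalyticFun V ⊗[ℂ] M) :
    actTensor ρ w (intTensor a z) = intTensor (mapRoot w a) (actTensor ρ w z) := by
  induction z using TensorProduct.induction_on with
  | zero => simp
  | tmul f m => simp only [actTensor, intTensor, TensorProduct.map_tmul, LinearMap.id_apply,
      act_intRefl]
  | add z z' hz hz' => simp only [map_add, hz, hz']

/-- The integral-reflection operator of a simple affine root. -/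
def reflOp (a : D.SimpleRoot) : Module.End ℂ (AnalyticFun V ⊗[ℂ] M) :=
  actTensor ρ (D.s a.1) - κ.k a.1 • intTensor a.1

theorem reflOp_apply (a : D.SimpleRoot) (z : AnalyticFun V ⊗[ℂ] M) :
    reflOp ρ κ a z = actTensor ρ (D.s a.1) z - κ.k a.1 • intTensor a.1 z := rfl

theorem reflOp_derivTensor (a : D.SimpleRoot) (v : AffV V) (z : AnalyticFun V ⊗[ℂ] M) :
    reflOp ρ κ a (derivTensor v z) = derivTensor (refl a.1.1 v) (reflOp ρ κ a z) -
      (κ.k a.1 * (form a.1.1 v : ℝ)) • z := by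
  rw [reflOp_apply, reflOp_apply, actTensor_derivTensor, intTensor_derivTensor, map_sub, map_smul,
    s_val]
  module

theorem derivTensor_reflOp (a : D.SimpleRoot) (v : AffV V) (z : AnalyticFun V ⊗[ℂ] M) :
    derivTensor v (reflOp ρ κ a z) = reflOp ρ κ a (derivTensor (refl a.1.1 v) z) -
      (κ.k a.1 * (form a.1.1 v : ℝ)) • z := by
  rw [reflOp_derivTensor, refl_refl, ← form_refl_left, refl_self a.1.2, map_neg,
    LinearMap.neg_apply]
  push_cast
  module

/-- The action of `Ω` on the simple affine roots. -/
def mapSimple {w : D.extWeyl} (hw : w ∈ D.Ω) (a : D.SimpleRoot) : D.SimpleRoot :=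
  ⟨mapRoot w a.1, Omega_simple hw a.2⟩

theorem mul_word_eq {w : D.extWeyl} (hw : w ∈ D.Ω) (l : List D.SimpleRoot) :
    w * word l = word (l.map (mapSimple hw)) * w := by
  induction l with
  | nil => simp
  | cons a l ih =>
    rw [word_cons, ← mul_assoc, s_mul_eq, mul_assoc, ih, List.map_cons, word_cons, mul_assoc]
    rfl

theorem actTensor_reflOp {w : D.extWeyl} (hw : w ∈ D.Ω) (a : D.SimpleRoot)
    (z : AnalyticFun V ⊗[ℂ] M) :
    actTensor ρ w (reflOp ρ κ a z) = reflOp ρ κ (mapSimple hw a) (actTensor ρ w z) := by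
  rw [reflOp_apply, reflOp_apply, map_sub, map_smul, actTensor_intTensor, ← actTensor_mul,
    ← actTensor_mul, s_mul_eq, κ.invariant w a.1 (mapRoot w a.1) rfl]
  rfl

end IntegralReflection

/-! ### The local relations between the integral-reflection operators -/

section Local

variable {ι V M : Type*} [NormedAddCommGroup V] [InnerProductSpace ℝ V]
  {D : AffineDatum ι V} [AddCommGroup M] [Module ℂ M]

variable (D) in
/-- The subgroup generated by the simple reflections that fix a point. -/
def localGroup (x : AffV V) : Set D.extWeyl :=
  {w | ∃ l : List D.SimpleRoot, (∀ a ∈ l, form a.1.1 x = 0) ∧ w = word l}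

theorem fix_of_mem_localGroup {x : AffV V} {w : D.extWeyl} (hw : w ∈ D.localGroup x) :
    w.1 x = x := by
  obtain ⟨l, hl, rfl⟩ := hw
  exact word_fix hl

theorem s_mul_mem_localGroup {x : AffV V} {a : D.SimpleRoot} (ha : form a.1.1 x = 0)
    {w : D.extWeyl} (hw : w ∈ D.localGroup x) : D.s a.1 * w ∈ D.localGroup x := by
  obtain ⟨l, hl, rfl⟩ := hw
  exact ⟨a :: l, by simpa [ha] using hl, by simp⟩

variable [FiniteDimensional ℝ V]

/-- A function on chambers that decreases with the distance from the fundamental chamber. -/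
def depth (w : D.extWeyl) : ℝ := form (w.1 D.rho) D.rho

/-- The increment is `-(2/(a, a))(a, wρ)(a, ρ)`, with `(a, wρ) < 0 < (a, ρ)`: reflecting across a
hyperplane that separates from `C₊` increases depth. -/
theorem depth_lt {a : D.affRoots} (ha : a.1 ∈ D.posAffRoots) {w : D.extWeyl}
    (h : form a.1 (w.1 D.rho) < 0) : depth w < depth (D.s a * w) := by
  have h1 := form_pos rho_mem ha
  rw [depth, depth, mul_val_apply, s_val, refl_apply, form_coroot, form_comm (w.1 D.rho) a.1]
  simp only [map_sub, map_smul, LinearMap.sub_apply, LinearMap.smul_apply, smul_eq_mul]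
  have h2 := mul_pos (mul_pos (div_pos two_pos (form_self_pos a.2)) (neg_pos.2 h)) h1
  linarith

/-- The sum of the values at `x` of the components on the chambers around `x`. -/
def localSum (x : VPlus V) (S : Finset D.extWeyl) : FSpace D M →ₗ[ℂ] M :=
  ∑ w ∈ S, evTensor x ∘ₗ LinearMap.proj (D.fundCh.move w)

theorem localSum_apply (x : VPlus V) (S : Finset D.extWeyl) (f : FSpace D M) :
    localSum x S f = ∑ w ∈ S, evTensor x (f (D.fundCh.move w)) := by
  simp [localSum, LinearMap.sum_apply]

/-- `s_a` fixes `x` and permutes the chambers around it; summing over them makes the evaluation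
equivariant. -/
theorem localSum_actF (ρ : Representation ℂ D.extWeyl M) {x : VPlus V} {S : Finset D.extWeyl} (hS : ∀ w, w ∈ S ↔ w ∈ D.localGroup x.1)
    {a : D.SimpleRoot} (ha : form a.1.1 x.1 = 0) (f : FSpace D M) :
    localSum x S (actF ρ (D.s a.1) f) = ρ (D.s a.1) (localSum x S f) := by
  rw [localSum_apply, localSum_apply, map_sum]
  refine Finset.sum_nbij' (fun w => D.s a.1 * w) (fun w => D.s a.1 * w) ?_ ?_ ?_ ?_ ?_
  · exact fun w hw => (hS _).2 (s_mul_mem_localGroup ha ((hS w).1 hw))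
  · exact fun w hw => (hS _).2 (s_mul_mem_localGroup ha ((hS w).1 hw))
  · intro w _
    rw [← mul_assoc, s_mul_s, one_mul]
  · intro w _
    rw [← mul_assoc, s_mul_s, one_mul]
  · intro w _
    rw [actF_apply, evTensor_actTensor ρ (by rw [s_val, refl_of_form_eq_zero ha]), move_move,
      s_inv]

variable [Finite ι]

/-- The inversions of an element fixing `x` are nonpositive at `x`, so they form a subset of a
finite set, and the inversion set determines the element. -/
theorem finite_localGroup {x : AffV V} (hx : x ∈ VPlus V)
    (hx0 : ∀ a ∈ D.simpleAffRoots, 0 ≤ form a x) : (D.localGroup x).Finite := by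
  refine Set.Finite.of_finite_image (f := inv)
    ((finite_pos_le (D := D) hx 0).finite_subsets.subset ?_) ?_
  · rintro _ ⟨w, hw, rfl⟩ b ⟨hb, h⟩
    refine ⟨hb, ?_⟩
    have := form_nonneg_of_mem_cone hx0 h.2
    rw [map_neg, LinearMap.neg_apply, form_val_left, inv_inv, fix_of_mem_localGroup hw] at this
    linarith
  · rintro _ ⟨l, hl, rfl⟩ _ ⟨l', hl', rfl⟩ h
    have h1 : word (l.reverse ++ l') = 1 := by
      refine word_eq_one_of_pos fun b hb => ?_
      rw [word_append, word_reverse, mul_inv_rev, inv_inv, mul_val_apply]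
      rcases mapRoot_pos_or_neg (word l) ⟨b, hb.1⟩ with h2 | h2
      · refine (mapRoot_pos_or_neg (word l')⁻¹ (mapRoot (word l) ⟨b, hb.1⟩)).resolve_right
          fun h3 => ?_
        have h4 : (word l).1 b ∈ inv (word l) := h ▸ ⟨h2, h3⟩
        have h5 := h4.2
        rw [inv_val_apply] at h5
        exact not_neg_of_pos hb h5
      · have h4 : -((word l).1 b) ∈ inv (word l') := by
          rw [← h]
          refine ⟨h2, ?_⟩
          rw [map_neg, inv_val_apply, neg_neg]
          exact hb
        have h5 := h4.2
        rwa [map_neg, neg_neg] at h5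
    rw [word_append, word_reverse, inv_mul_eq_one] at h1
    exact h1

/-! ### Comparison of Dunkl jets with ordinary jets at a point -/

variable (ρ : Representation ℂ D.extWeyl M) (κ : D.Multiplicity)

/-- The families that vanish on all chambers of depth at least that of `w₀C₊`, other than
`w₀C₊`. -/
def IsSupportedBelow (w₀ : D.extWeyl) (f : FSpace D M) : Prop :=
  ∀ l : List D.SimpleRoot, word l ≠ w₀ → depth w₀ ≤ depth (word l) →
    f (D.fundCh.move (word l)) = 0

variable {ρ κ}

/-- The Dunkl terms at a chamber use values on its mirror images in hyperplanes separating it from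
`C₊`. Those have strictly greater depth, where `f` vanishes. -/
theorem IsSupportedBelow.dunkl_apply {w₀ : D.extWeyl} {f : FSpace D M}
    (hf : IsSupportedBelow w₀ f) (v : AffV V) (l : List D.SimpleRoot)
    (h : depth w₀ ≤ depth (word l)) :
    dunkl κ ρ v f (D.fundCh.move (word l)) = derivTensor v (f (D.fundCh.move (word l))) := by
  rw [AffineDatum.dunkl_apply, Finset.sum_eq_zero, sub_zero]
  intro a ha
  rw [Set.Finite.mem_toFinset] at ha
  have hneg : form a.1 ((word l).1 D.rho) < 0 := by
    by_contra hn
    exact ha.2 (if_neg fun h' => hn (h' _ ⟨_, rho_mem, rfl⟩))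
  have hlt := depth_lt ha.1 hneg
  obtain ⟨m, hm⟩ := s_mem_word a
  have h1 : D.s a * word l = word (m ++ l) := by rw [word_append, hm]
  have h2 := hf (m ++ l) (by
    rw [← h1]
    rintro h'
    rw [h'] at hlt
    linarith) (by rw [← h1]; linarith)
  rw [dunklTerm, actF_apply, s_inv, move_move, h1, h2, map_zero, smul_zero]

theorem IsSupportedBelow.dunkl {w₀ : D.extWeyl} {f : FSpace D M}
    (hf : IsSupportedBelow w₀ f) (v : AffV V) : IsSupportedBelow w₀ (dunkl κ ρ v f) := by
  intro l h1 h2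
  rw [hf.dunkl_apply v l h2, hf l h1 h2, map_zero]

variable (ρ κ)

/-- The families in `F_M` and the elements of `C^ω ⊗ M` that have the same derivatives at `x`, with
respect to the Dunkl operators and the directional derivatives. -/
def SameJet (x : VPlus V) (S : Finset D.extWeyl) (f : FSpace D M) (z : AnalyticFun V ⊗[ℂ] M) :
    Prop :=
  ∀ L : List (AffV V), localSum x S (L.foldl (fun g v => dunkl κ ρ v g) f) =
    evTensor x (L.foldl (fun g v => derivTensor v g) z)

variable {ρ κ}

/-- Both operators move past derivatives by the same cross relation, so induction on the number of
derivatives reduces to values at `x`, where both act as `ρ(s_a)`. -/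
theorem SameJet.reflOp {x : VPlus V} {S : Finset D.extWeyl}
    (hS : ∀ w, w ∈ S ↔ w ∈ D.localGroup x.1) {a : D.SimpleRoot} (ha : form a.1.1 x.1 = 0)
    {f : FSpace D M} {z : AnalyticFun V ⊗[ℂ] M} (h : SameJet ρ κ x S f z) :
    SameJet ρ κ x S (actF ρ (D.s a.1) f) (reflOp ρ κ a z) := by
  have hlin : ∀ (L : List (AffV V)) (r : ℂ) (f g : FSpace D M),
      L.foldl (fun g v => AffineDatum.dunkl κ ρ v g) (f - r • g) =
        L.foldl (fun g v => AffineDatum.dunkl κ ρ v g) f -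
        r • L.foldl (fun g v => AffineDatum.dunkl κ ρ v g) g := by
    intro L r
    induction L with
    | nil => exact fun _ _ => rfl
    | cons v L ih =>
      intro f g
      rw [List.foldl_cons, map_sub, map_smul, ih, List.foldl_cons, List.foldl_cons]
  have hlin' : ∀ (L : List (AffV V)) (r : ℂ) (f g : AnalyticFun V ⊗[ℂ] M),
      L.foldl (fun g v => derivTensor v g) (f - r • g) =
        L.foldl (fun g v => derivTensor v g) f -
        r • L.foldl (fun g v => derivTensor v g) g := by
    intro L r
    induction L with
    | nil => exact fun _ _ => rfl
    | cons v L ih =>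
      intro f g
      rw [List.foldl_cons, map_sub, map_smul, ih, List.foldl_cons, List.foldl_cons]
  intro L
  induction L generalizing f z with
  | nil =>
    have h0 := h []
    rw [List.foldl_nil, List.foldl_nil] at h0 ⊢
    rw [localSum_actF ρ hS ha, h0, reflOp_apply, map_sub, map_smul, evTensor_intTensor ha,
      evTensor_actTensor ρ (by rw [s_val, refl_of_form_eq_zero ha]), smul_zero, sub_zero]
  | cons v L ih =>
    have h1 : AffineDatum.dunkl κ ρ v (actF ρ (D.s a.1) f) =
        actF ρ (D.s a.1) (AffineDatum.dunkl κ ρ (refl a.1.1 v) f) -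
        (κ.k a.1 * (form a.1.1 v : ℝ)) • f := by
      rw [actF_s_dunkl, refl_refl, ← form_refl_left, refl_self a.1.2, map_neg, LinearMap.neg_apply]
      push_cast
      module
    rw [List.foldl_cons, List.foldl_cons, h1, derivTensor_reflOp, hlin, hlin', map_sub, map_sub,
      map_smul, map_smul, h L,
      ih (f := AffineDatum.dunkl κ ρ (refl a.1.1 v) f) (z := derivTensor (refl a.1.1 v) z)
        fun L' => h (refl a.1.1 v :: L')]

theorem SameJet.word {x : VPlus V} {S : Finset D.extWeyl}
    (hS : ∀ w, w ∈ S ↔ w ∈ D.localGroup x.1) {l : List D.SimpleRoot}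
    (hl : ∀ a ∈ l, form a.1.1 x.1 = 0)
    {f : FSpace D M} {z : AnalyticFun V ⊗[ℂ] M} (h : SameJet ρ κ x S f z) :
    SameJet ρ κ x S (actF ρ (word l) f)
      ((l.map (AffineDatum.reflOp ρ κ)).prod z) := by
  induction l with
  | nil => simpa [actF_one] using h
  | cons a l ih =>
    rw [word_cons, actF_mul, List.map_cons, List.prod_cons]
    exact (ih fun e he => hl e (List.mem_cons_of_mem _ he)).reflOp hS (hl a List.mem_cons_self)

theorem SameJet.unique {x : VPlus V} {S : Finset D.extWeyl} {f : FSpace D M}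
    {z z' : AnalyticFun V ⊗[ℂ] M} (h : SameJet ρ κ x S f z) (h' : SameJet ρ κ x S f z') :
    z = z' := by
  refine sub_eq_zero.1 (eq_zero_of_evTensor x _ fun y n => ?_)
  have key : ∀ z : AnalyticFun V ⊗[ℂ] M, (derivTensor y)^[n] z =
      (List.replicate n y).foldl (fun g v => derivTensor v g) z := by
    intro z
    induction n generalizing z with
    | zero => rfl
    | succ n ih => rw [Function.iterate_succ_apply, List.replicate_succ, List.foldl_cons, ih]
  rw [iterate_map_sub, map_sub, key, key, ← h, ← h', sub_self]

/-- The integral-reflection operators satisfy the local relations. -/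
theorem localRelations_reflOp : LocalRelations (reflOp (V := V) ρ κ) := by
  classical
  intro x hx hx0 l l' hl hl' hll
  refine LinearMap.ext fun z => ?_
  set x' : VPlus V := ⟨x, hx⟩
  have hfin := finite_localGroup hx hx0
  set S := hfin.toFinset
  have hS : ∀ w, w ∈ S ↔ w ∈ D.localGroup x := fun w => hfin.mem_toFinset
  -- Every other chamber around `x` has depth at least that of `w₀`. A family supported on `w₀C₊`
  -- therefore stays zero on them under Dunkl operators.
  obtain ⟨w₀, hw₀, hmin⟩ := S.exists_min_image depth ⟨1, (hS 1).2 ⟨[], by simp, rfl⟩⟩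
  obtain ⟨l₀, hl₀, hw₀'⟩ := (hS w₀).1 hw₀
  set C₀ := D.fundCh.move w₀
  have hjet : ∀ f : FSpace D M, IsSupportedBelow w₀ f → SameJet ρ κ x' S f (f C₀) := by
    intro f hf L
    induction L generalizing f with
    | nil =>
      rw [List.foldl_nil, List.foldl_nil, localSum_apply]
      refine Finset.sum_eq_single w₀ (fun w hw hne => ?_) (fun h => absurd hw₀ h)
      obtain ⟨m, hm, hwm⟩ := (hS w).1 hw
      rw [hwm, hf m (hwm ▸ hne) (hwm ▸ hmin w hw), map_zero]
    | cons v L ih =>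
      rw [List.foldl_cons, List.foldl_cons, ih _ (hf.dunkl v)]
      have := hf.dunkl_apply (κ := κ) (ρ := ρ) v l₀ (by rw [hw₀'])
      rw [← hw₀'] at this
      rw [this]
  have hsupp : IsSupportedBelow w₀ (Pi.single C₀ z : FSpace D M) := by
    intro m hm _
    refine Pi.single_eq_of_ne (fun h => hm ?_) _
    rw [hw₀']
    refine eq_of_move_eq ?_
    rw [h, ← hw₀']
  have h1 := hjet _ hsupp
  rw [Pi.single_eq_same] at h1
  -- Both words act on the family as the same group element, so the two images of `z` share the jet
  -- of a single family and coincide.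
  have h2 := h1.word hS hl'
  rw [← hll] at h2
  exact (h1.word hS hl).unique h2

end Local

/-! ### The representation by integral-reflection operators -/

section Representation

variable {ι V M : Type*} [NormedAddCommGroup V] [InnerProductSpace ℝ V]
  [FiniteDimensional ℝ V] {D : AffineDatum ι V} [AddCommGroup M] [Module ℂ M]
  (κ : D.Multiplicity) (ρ : Representation ℂ D.extWeyl M)

/-- The product of the integral-reflection operators along a word. -/
def reflWord (l : List D.SimpleRoot) : Module.End ℂ (AnalyticFun V ⊗[ℂ] M) :=
  (l.map (reflOp ρ κ)).prod

theorem actTensor_reflWord {w : D.extWeyl} (hw : w ∈ D.Ω) (l : List D.SimpleRoot)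
    (z : AnalyticFun V ⊗[ℂ] M) :
    actTensor ρ w (reflWord κ ρ l z) =
      reflWord κ ρ (l.map (mapSimple hw)) (actTensor ρ w z) := by
  induction l with
  | nil => rfl
  | cons a l ih =>
    simp only [reflWord, List.map_cons, List.prod_cons, Module.End.mul_apply] at ih ⊢
    rw [actTensor_reflOp ρ κ hw, ih]

variable {κ ρ}

theorem IsIntegralReflectionRep.grp_s
    {Q : CherednikAlg κ →ₐ[ℂ] Module.End ℂ (AnalyticFun V ⊗[ℂ] M)}
    (hQ : IsIntegralReflectionRep κ ρ Q) (a : D.SimpleRoot) :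
    Q (CherednikAlg.grp κ (D.s a.1)) = reflOp ρ κ a := hQ.refl a.1 a.2

theorem chamber_eq_move_iff {w : D.extWeyl} {C : D.Chamber} :
    C.1 = w.1 '' D.fundChamber ↔ C = D.fundCh.move w :=
  ⟨fun h => Subtype.ext h, fun h => congrArg Subtype.val h⟩

theorem map_grp_mul_apply (Q : CherednikAlg κ →ₐ[ℂ] Module.End ℂ (AnalyticFun V ⊗[ℂ] M))
    (w w' : D.extWeyl) (f : AnalyticFun V ⊗[ℂ] M) :
    Q (CherednikAlg.grp κ (w * w')) f = Q (CherednikAlg.grp κ w) (Q (CherednikAlg.grp κ w') f) := by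
  rw [CherednikAlg.grp_mul, map_mul, Module.End.mul_apply]

variable (κ ρ) [Finite ι]

/-- A word and an element of `Ω` are chosen for each group element. The `Ω`-factor is forced, and
the choice of word is immaterial by the local relations. -/
theorem exists_integralReflection_action :
    ∃ Q : D.extWeyl → Module.End ℂ (AnalyticFun V ⊗[ℂ] M),
      ∀ (l : List D.SimpleRoot), ∀ w ∈ D.Ω, Q (word l * w) = reflWord κ ρ l * actTensor ρ w := by
  choose l ω hω h using exists_word_mul_Omega (D := D)
  refine ⟨fun w => reflWord κ ρ (l w) * actTensor ρ (ω w), fun m w hw => ?_⟩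
  have h1 := h (word m * w)
  have h2 := word_eq_of_mul_Omega_eq hw (hω _) h1
  have h3 : w = ω (word m * w) := by rwa [← h2, mul_right_inj] at h1
  change reflWord κ ρ (l (word m * w)) * actTensor ρ (ω (word m * w)) = _
  rw [← h3, reflWord, ← (localRelations_reflOp (ρ := ρ) (κ := κ)).prod_eq h2, reflWord]

theorem exists_integralReflectionRep :
    ∃ Q : CherednikAlg κ →ₐ[ℂ] Module.End ℂ (AnalyticFun V ⊗[ℂ] M),
      IsIntegralReflectionRep κ ρ Q := by
  obtain ⟨q, hq⟩ := exists_integralReflection_action κ ρ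
  have hs : ∀ a : D.SimpleRoot, q (D.s a.1) = reflOp ρ κ a := by
    intro a
    have := hq [a] 1 Omega_one
    rw [word_singleton, mul_one] at this
    rw [this]
    refine LinearMap.ext fun z => ?_
    simp [reflWord, actTensor_one]
  have hω : ∀ w ∈ D.Ω, q w = actTensor ρ w := by
    intro w hw
    have := hq [] w hw
    rw [word_nil, one_mul] at this
    rw [this]
    rfl
  obtain ⟨Q, h1, h2⟩ := CherednikAlg.exists_hom (κ := κ)
    (A := Module.End ℂ (AnalyticFun V ⊗[ℂ] M)) derivTensor q
    derivTensor_add derivTensor_smul (fun v v' => LinearMap.ext (derivTensor_comm v v'))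
    (by rw [hω 1 Omega_one]; exact LinearMap.ext (actTensor_one ρ))
    (fun w w' => by
      obtain ⟨l, ω, hw, rfl⟩ := exists_word_mul_Omega w
      obtain ⟨l', ω', hw', rfl⟩ := exists_word_mul_Omega w'
      -- `ω` is moved past the second word by permuting its letters; the operators satisfy the same
      -- rule by `actTensor_reflWord`.
      have e : word l * ω * (word l' * ω') =
          word (l ++ l'.map (mapSimple hw)) * (ω * ω') := by
        rw [word_append, mul_assoc, ← mul_assoc ω, mul_word_eq hw]
        simp only [mul_assoc]
      rw [e, hq _ _ (Omega_mul hw hw'), hq _ _ hw, hq _ _ hw']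
      refine LinearMap.ext fun z => ?_
      simp only [Module.End.mul_apply, actTensor_reflWord κ ρ hw, actTensor_mul]
      simp [reflWord])
    (fun a v => LinearMap.ext fun z => by
      rw [hs]
      exact reflOp_derivTensor ρ κ a v z)
    (fun w hw v => LinearMap.ext fun z => by
      rw [hω w hw]
      exact actTensor_derivTensor ρ w v z)
  exact ⟨Q, ⟨fun a ha => (h2 _).trans (hs ⟨a, ha⟩), fun w hw => (h2 w).trans (hω w hw), h1⟩⟩

variable {κ ρ}

theorem IsIntegralReflectionRep.unique
    {Q Q' : CherednikAlg κ →ₐ[ℂ] Module.End ℂ (AnalyticFun V ⊗[ℂ] M)}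
    (h : IsIntegralReflectionRep κ ρ Q) (h' : IsIntegralReflectionRep κ ρ Q') : Q = Q' := by
  refine CherednikAlg.hom_ext (fun v => by rw [h.vec, h'.vec]) fun w => ?_
  obtain ⟨l, ω, hω, rfl⟩ := exists_word_mul_Omega w
  rw [CherednikAlg.grp_mul, map_mul, map_mul, h.omega ω hω, h'.omega ω hω]
  congr 1
  induction l with
  | nil => rw [word_nil, CherednikAlg.grp_one, map_one, map_one]
  | cons a l ih =>
    rw [word_cons, CherednikAlg.grp_mul, map_mul, map_mul, ih, h.grp_s, h'.grp_s]

/-! ### The propagation operator -/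

variable {Q : CherednikAlg κ →ₐ[ℂ] Module.End ℂ (AnalyticFun V ⊗[ℂ] M)}

theorem isPropagationOperator_iff {T : AnalyticFun V ⊗[ℂ] M →ₗ[ℂ] FSpace D M} :
    IsPropagationOperator κ ρ Q T ↔ ∀ (f : AnalyticFun V ⊗[ℂ] M) (l : List D.SimpleRoot),
      T f (D.fundCh.move (word l)) =
        actTensor ρ (word l) (Q (CherednikAlg.grp κ (word l)⁻¹) f) := by
  constructor
  · exact fun h f l => h f (word l) (word_mem_affWeyl l) _ rfl
  · intro h f w hw C hC
    obtain ⟨l, rfl⟩ := exists_word_of_mem_affWeyl hw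
    rw [chamber_eq_move_iff.1 hC]
    exact h f l

theorem existsUnique_propagationOperator :
    ∃! T : AnalyticFun V ⊗[ℂ] M →ₗ[ℂ] FSpace D M, IsPropagationOperator κ ρ Q T := by
  choose l hl using exists_eq_move (D := D)
  refine ⟨LinearMap.pi fun C => actTensor ρ (word (l C)) ∘ₗ Q (CherednikAlg.grp κ (word (l C))⁻¹),
    isPropagationOperator_iff.2 fun f m => ?_, fun T hT => LinearMap.ext fun f => funext fun C => ?_⟩
  · rw [LinearMap.pi_apply, ← eq_of_move_eq (hl (D.fundCh.move (word m)))]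
    rfl
  · rw [hl C, isPropagationOperator_iff.1 hT, LinearMap.pi_apply, ← hl C]
    rfl

variable {T : AnalyticFun V ⊗[ℂ] M →ₗ[ℂ] FSpace D M}

theorem IsPropagationOperator.apply_fundCh (hT : IsPropagationOperator κ ρ Q T)
    (f : AnalyticFun V ⊗[ℂ] M) : T f D.fundCh = f := by
  have := isPropagationOperator_iff.1 hT f []
  rw [word_nil, move_one, inv_one, CherednikAlg.grp_one, map_one, actTensor_one] at this
  exact this

/-- Formal: on `mC₊` both sides equal the action of `m` applied to `Q(m⁻¹ l) f`, using only
multiplicativity of `Q`. -/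
theorem IsPropagationOperator.actF_word (hT : IsPropagationOperator κ ρ Q T)
    (l : List D.SimpleRoot) (f : AnalyticFun V ⊗[ℂ] M) :
    T (Q (CherednikAlg.grp κ (word l)) f) = actF ρ (word l) (T f) := by
  funext C
  obtain ⟨m, rfl⟩ := exists_eq_move C
  have e : (word l)⁻¹ * word m = word (l.reverse ++ m) := by rw [word_append, word_reverse]
  rw [actF_apply, move_move, e, isPropagationOperator_iff.1 hT, isPropagationOperator_iff.1 hT,
    ← actTensor_mul, ← map_grp_mul_apply, ← e, mul_inv_rev, inv_inv, mul_inv_cancel_left]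

/-- An element of `Ω` preserves `C₊` and permutes the simple reflections. On it `Q` is the plain
action, so it can be absorbed on either side. -/
theorem IsPropagationOperator.actF_Omega (hQ : IsIntegralReflectionRep κ ρ Q)
    (hT : IsPropagationOperator κ ρ Q T) {w : D.extWeyl} (hw : w ∈ D.Ω)
    (f : AnalyticFun V ⊗[ℂ] M) :
    T (Q (CherednikAlg.grp κ w) f) = actF ρ w (T f) := by
  funext C
  obtain ⟨m, rfl⟩ := exists_eq_move C
  have e := mul_word_eq (Omega_inv hw) m
  have h1 : D.fundCh.move (w⁻¹ * word m) =
      D.fundCh.move (word (m.map (mapSimple (Omega_inv hw)))) := by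
    rw [e, ← move_move, Omega_move (Omega_inv hw)]
  have e1 : w * word (m.map (mapSimple (Omega_inv hw))) = word m * w := by
    rw [← mul_inv_eq_iff_eq_mul, mul_assoc, ← e, mul_inv_cancel_left]
  have e2 : w * (word (m.map (mapSimple (Omega_inv hw))))⁻¹ = (word m)⁻¹ * w := by
    rw [mul_inv_eq_iff_eq_mul, mul_assoc, e1, inv_mul_cancel_left]
  rw [actF_apply, move_move, h1, isPropagationOperator_iff.1 hT, isPropagationOperator_iff.1 hT,
    ← actTensor_mul, e1, actTensor_mul, ← hQ.omega w hw, ← map_grp_mul_apply,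
    ← map_grp_mul_apply, e2]

theorem IsPropagationOperator.actF_grp (hQ : IsIntegralReflectionRep κ ρ Q)
    (hT : IsPropagationOperator κ ρ Q T) (w : D.extWeyl) (f : AnalyticFun V ⊗[ℂ] M) :
    T (Q (CherednikAlg.grp κ w) f) = actF ρ w (T f) := by
  obtain ⟨l, ω, hω, rfl⟩ := exists_word_mul_Omega w
  rw [CherednikAlg.grp_mul, map_mul, Module.End.mul_apply, hT.actF_word, hT.actF_Omega hQ hω,
    actF_mul]

/-- On `C₊` both sides are the derivative of `f`. From `C` to `s_a C` the identity passes because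
the two kinds of operators obey the same cross relation and `T` commutes with the action of `s_a`.
-/
theorem IsPropagationOperator.dunkl (hQ : IsIntegralReflectionRep κ ρ Q)
    (hT : IsPropagationOperator κ ρ Q T) (v : AffV V) (f : AnalyticFun V ⊗[ℂ] M) :
    T (derivTensor v f) = dunkl κ ρ v (T f) := by
  funext C
  refine chamber_induction (p := fun C => ∀ v f, T (derivTensor v f) C =
    AffineDatum.dunkl κ ρ v (T f) C) ?_ ?_ C v f
  · intro v f
    rw [dunkl_fundCh, hT.apply_fundCh, hT.apply_fundCh]
  · intro a C ih v f
    refine actTensor_injective ρ (D.s a.1) ?_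
    have h1 : ∀ g : FSpace D M, actTensor ρ (D.s a.1) (g (C.move (D.s a.1))) =
        actF ρ (D.s a.1) g C := fun g => by rw [actF_apply, s_inv]
    rw [h1, h1, ← hT.actF_grp hQ, hQ.grp_s, reflOp_derivTensor, actF_s_dunkl, ← hT.actF_grp hQ,
      hQ.grp_s, map_sub, map_smul, Pi.sub_apply, Pi.sub_apply, ih]

theorem IsPropagationOperator.intertwines
    {π : CherednikAlg κ →ₐ[ℂ] Module.End ℂ (FSpace D M)} (hQ : IsIntegralReflectionRep κ ρ Q)
    (hπ : IsDunklRep κ ρ π) (hT : IsPropagationOperator κ ρ Q T) (h : CherednikAlg κ) :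
    T ∘ₗ Q h = π h ∘ₗ T := by
  induction h using CherednikAlg.induction with
  | hvec v => rw [hQ.vec, hπ.vec]; exact LinearMap.ext (hT.dunkl hQ v)
  | hgrp w => rw [hπ.grp]; exact LinearMap.ext (hT.actF_grp hQ w)
  | hscalar r =>
    rw [AlgHom.commutes, AlgHom.commutes]
    exact LinearMap.ext fun f => map_smul T r f
  | hadd x y hx hy => rw [map_add, map_add, LinearMap.comp_add, LinearMap.add_comp, hx, hy]
  | hmul x y hx hy =>
    rw [map_mul, map_mul, Module.End.mul_eq_comp, Module.End.mul_eq_comp, ← LinearMap.comp_assoc,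
      hx, LinearMap.comp_assoc, hy, LinearMap.comp_assoc]

end Representation

end AffineDatum
end TrigCherednik
end

open TrigCherednik AffineDatum in
theorem mainTheorem7 {ι V M : Type*} [Finite ι] [NormedAddCommGroup V] [InnerProductSpace ℝ V]
    [FiniteDimensional ℝ V] (D : AffineDatum ι V) (κ : D.Multiplicity)
    [AddCommGroup M] [Module ℂ M] [FiniteDimensional ℂ M] (ρ : Representation ℂ D.extWeyl M) :
    (∃! Q : CherednikAlg κ →ₐ[ℂ] Module.End ℂ (AnalyticFun V ⊗[ℂ] M),
      IsIntegralReflectionRep κ ρ Q) ∧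
    (∃! π : CherednikAlg κ →ₐ[ℂ] Module.End ℂ (FSpace D M), IsDunklRep κ ρ π) ∧
    ∀ (Q : CherednikAlg κ →ₐ[ℂ] Module.End ℂ (AnalyticFun V ⊗[ℂ] M))
      (π : CherednikAlg κ →ₐ[ℂ] Module.End ℂ (FSpace D M)),
      IsIntegralReflectionRep κ ρ Q → IsDunklRep κ ρ π →
        (∃! T : AnalyticFun V ⊗[ℂ] M →ₗ[ℂ] FSpace D M, IsPropagationOperator κ ρ Q T) ∧
        ∀ T : AnalyticFun V ⊗[ℂ] M →ₗ[ℂ] FSpace D M, IsPropagationOperator κ ρ Q T →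
          ∀ h : CherednikAlg κ, T ∘ₗ Q h = π h ∘ₗ T := by
  obtain ⟨Q₀, hQ₀⟩ := exists_integralReflectionRep κ ρ
  exact ⟨⟨Q₀, hQ₀, fun Q hQ => hQ.unique hQ₀⟩, existsUnique_dunklRep κ ρ,
    fun Q π hQ hπ => ⟨existsUnique_propagationOperator,
      fun T hT h => hT.intertwines hQ hπ h⟩⟩
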